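/- Let $O$ be the square-tiled surface made of $12$ unit squares, labelled $1,\dots,12$, in which the right side of square $i$ is glued to the left side of square $h(i)$ and the top side of square $i$ to the bottom side of square $v(i)$, where $$h=(1,2,3)(4,5,6)(7,8,9)(10,11,12),\qquad v=(1,4,7)(2,9,11)(3,10,5)(6,12,8).$$ (Up to a linear change of coordinates, $O$ is the threefold translation cover of the regular octahedron; it has genus $4$.) Let $p\colon O\to\mathbb R^2/\mathbb Z^2$ be the natural covering, branched over $0$, let $\omega=p^*dz$, and let $H_1^{(0)}(O)=\{\gamma\in H_1(O;\mathbb R):\int_\gamma\omega=0\}$ be the zero-holonomy subspace. Let $\mathrm{Aff}(O)$ be the group of homeomorphisms of $O$ that preserve the set of vertices of the squares and are, away from the vertices, affine in the translation charts with a constant derivative in $\mathrm{SL}(2,\mathbb R)$; let $\mathrm{Aut}(O)=\{f : p\circ f=p\}$; and let the Veech group $\mathrm{SL}(O)$ be the group of derivatives of elements of $\mathrm{Aff}(O)$. Every $f\in\mathrm{Aff}(O)$ preserves $H_1^{(0)}(O)$; let $\alpha(f)$ be its action there. The Kontsevich–Zorich monodromy group of $O$ is $\alpha(\mathrm{Aff}(O))$.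 Let $T=\begin{pmatrix}1&1\\0&1\end{pmatrix}$ and $S=\begin{pmatrix}1&0\\1&1\end{pmatrix}$. For $i=1,4,7,10$ let $\sigma_i\in H_1(O;\mathbb R)$ be the class of the closed horizontal curve of length $3$ that begins on the left side of square $i$ and runs to the right, and for $j=1,2,3,6$ let $\zeta_j$ be the class of the closed vertical curve of length $3$ that begins on the bottom side of square $j$ and runs upwards. Put $\Sigma_i=\sigma_i-\sigma_{10}$ and $Z_j=\zeta_1-\zeta_j$. Then: (1) $\mathrm{SL}(O)=\langle T^3,\,S^{-1}T\rangle$. (2) $(\Sigma_1,\Sigma_4,\Sigma_7,Z_2,Z_3,Z_6)$ is a basis of $H_1^{(0)}(O)$. (3) There are affine homeomorphisms of $O$ with derivatives $T^3$ and $S^{-1}T$ whose actions on $H_1^{(0)}(O)$ have, in this basis (the columns being the images of the basis vectors), the matrices $$\alpha(T^3)=\begin{pmatrix}1&0&0&0&0&1\\0&1&0&1&0&0\\0&0&1&0&1&0\\0&0&0&1&0&0\\0&0&0&0&1&0\\0&0&0&0&0&1\end{pmatrix},\qquad \alpha(S^{-1}T)=\begin{pmatrix}-1&-1&-1&1&1&1\\0&0&1&0&-1&0\\1&0&0&0&0&-1\\0&0&1&0&0&0\\1&0&0&0&0&0\\-1&-1&-1&0&0&0\end{pmatrix},$$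 and these are determined up to the action of $\mathrm{Aut}(O)$: the actions on $H_1^{(0)}(O)$ of all affine homeomorphisms with derivative $T^3$, respectively $S^{-1}T$, are exactly the products $\alpha(T^3)\,\alpha(\tau)$, respectively $\alpha(S^{-1}T)\,\alpha(\tau)$, with $\tau\in\mathrm{Aut}(O)$. (4) Up to the action of $\mathrm{Aut}(O)$, the Kontsevich–Zorich monodromy group of $O$ is generated by these two matrices: $$\alpha(\mathrm{Aff}(O))=\langle \alpha(T^3),\,\alpha(S^{-1}T)\rangle\cdot\alpha(\mathrm{Aut}(O)).$$ -/

import Mathlib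

set_option maxSynthPendingDepth 3

open scoped Topology

noncomputable section

/-! ### Real singular homology in degree one -/

namespace Sing

variable {X Y Z : Type} [TopologicalSpace X] [TopologicalSpace Y] [TopologicalSpace Z]

/-- Singular `n`-simplices of `X`. -/
abbrev Simplex (n : ℕ) (X : Type) [TopologicalSpace X] : Type :=
  C(stdSimplex ℝ (Fin (n + 1)), X)

/-- Real singular `n`-chains of `X`. -/
abbrev Chain (n : ℕ) (X : Type) [TopologicalSpace X] : Type :=
  Simplex n X →₀ ℝ

/-- The inclusion of the `k`-th face of the standard `(n+1)`-simplex. -/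
def face (n : ℕ) (k : Fin (n + 2)) :
    C(stdSimplex ℝ (Fin (n + 1)), stdSimplex ℝ (Fin (n + 2))) :=
  ⟨stdSimplex.map k.succAbove, stdSimplex.continuous_map _⟩

/-- The singular boundary operator. -/
def boundary (n : ℕ) (X : Type) [TopologicalSpace X] : Chain (n + 1) X →ₗ[ℝ] Chain n X :=
  Finsupp.linearCombination ℝ fun s : Simplex (n + 1) X =>
    ∑ k : Fin (n + 2), Finsupp.single (s.comp (face n k)) ((-1 : ℝ) ^ (k : ℕ))

/-- The boundary operator from 1-chains to 0-chains. -/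
def bd1 (X : Type) [TopologicalSpace X] : Chain 1 X →ₗ[ℝ] Chain 0 X := boundary 0 X

/-- The boundary operator from 2-chains to 1-chains. -/
def bd2 (X : Type) [TopologicalSpace X] : Chain 2 X →ₗ[ℝ] Chain 1 X := boundary 1 X

/-- Singular 1-cycles. -/
abbrev Cycles (X : Type) [TopologicalSpace X] : Submodule ℝ (Chain 1 X) :=
  LinearMap.ker (bd1 X)

/-- Singular 1-boundaries, inside the 1-cycles. -/
abbrev Boundaries (X : Type) [TopologicalSpace X] : Submodule ℝ (Cycles X) :=
  (LinearMap.range (bd2 X)).submoduleOf (Cycles X)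

/-- The first singular homology group `H₁(X; ℝ)`. -/
abbrev H1 (X : Type) [TopologicalSpace X] : Type := Cycles X ⧸ Boundaries X

/-- Push-forward of chains along a continuous map. -/
def chainMap (n : ℕ) (f : C(X, Y)) : Chain n X →ₗ[ℝ] Chain n Y :=
  Finsupp.lmapDomain ℝ ℝ fun s : Simplex n X => f.comp s

theorem boundary_chainMap (n : ℕ) (f : C(X, Y)) (c : Chain (n + 1) X) :
    boundary n Y (chainMap (n + 1) f c) = chainMap n f (boundary n X c) := by
  have h : boundary n Y ∘ₗ chainMap (n + 1) f = chainMap n f ∘ₗ boundary n X := by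
    ext1 s
    ext1
    simp [boundary, chainMap, Finsupp.mapDomain_single,
      ContinuousMap.comp_assoc]
  exact LinearMap.congr_fun h c

/-- Push-forward of 1-cycles. -/
def cyclesMap (f : C(X, Y)) : Cycles X →ₗ[ℝ] Cycles Y :=
  (chainMap 1 f).restrict fun c hc => by
    have hc' : boundary 0 X c = 0 := hc
    have h : boundary 0 Y (chainMap 1 f c) = 0 := by
      rw [boundary_chainMap, hc', map_zero]
    exact h

/-- The induced map `f_* : H₁(X; ℝ) → H₁(Y; ℝ)`. -/
def H1map (f : C(X, Y)) : H1 X →ₗ[ℝ] H1 Y :=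
  Submodule.mapQ _ _ (cyclesMap f) fun c hc => by
    obtain ⟨d, hd⟩ : ∃ d, bd2 X d = (c : Chain 1 X) := hc
    exact ⟨chainMap 2 f d, (boundary_chainMap 1 f d).trans (congrArg (chainMap 1 f) hd)⟩

/-! ### Integration of the angular form along singular 1-simplices of the circle -/

theorem exists_lift {n : ℕ} (u : Simplex n UnitAddCircle) :
    ∃ l : C(stdSimplex ℝ (Fin (n + 1)), ℝ), ∀ s, ((l s : ℝ) : UnitAddCircle) = u s := by
  let a : stdSimplex ℝ (Fin (n + 1)) := stdSimplex.vertex 0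
  have hc : ∀ (t : unitInterval) (s : stdSimplex ℝ (Fin (n + 1))),
      (1 - (t : ℝ)) • (a : Fin (n + 1) → ℝ) + (t : ℝ) • (s : Fin (n + 1) → ℝ)
        ∈ stdSimplex ℝ (Fin (n + 1)) := fun t s =>
    convex_stdSimplex ℝ _ a.2 s.2 (by linarith [t.2.2]) t.2.1 (by ring)
  let K : C(unitInterval × stdSimplex ℝ (Fin (n + 1)), UnitAddCircle) :=
    u.comp ⟨fun q => ⟨_, hc q.1 q.2⟩, Continuous.subtype_mk (by fun_prop) _⟩
  obtain ⟨e, he⟩ := QuotientAddGroup.mk_surjective (u a)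
  have h0 : ∀ s, K (0, s) = ((ContinuousMap.const _ e : C(stdSimplex ℝ (Fin (n + 1)), ℝ)) s :
      UnitAddCircle) := by
    intro s
    have : K (0, s) = u a := by
      change u _ = u a
      congr 1
      apply Subtype.ext
      simp
      rfl
    rw [this, ← he]
    rfl
  have cov := AddCircle.isCoveringMap_coe (1 : ℝ)
  refine ⟨(cov.liftHomotopy K (ContinuousMap.const _ e) h0).comp
    ⟨fun s => (1, s), by fun_prop⟩, fun s => ?_⟩
  have := congrFun (cov.liftHomotopy_lifts K (ContinuousMap.const _ e) h0) (1, s)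
  refine Eq.trans this ?_
  change u _ = u s
  congr 1
  apply Subtype.ext
  simp
  rfl

/-- `∫_u dθ` for a path `u` in `ℝ/ℤ`: the increment of a continuous lift of `u` to `ℝ`. -/
def increment (u : Simplex 1 UnitAddCircle) : ℝ :=
  (exists_lift u).choose (stdSimplex.vertex 1) - (exists_lift u).choose (stdSimplex.vertex 0)

theorem increment_eq (u : Simplex 1 UnitAddCircle) (l : C(stdSimplex ℝ (Fin 2), ℝ))
    (hl : ∀ s, ((l s : ℝ) : UnitAddCircle) = u s) :
    increment u = l (stdSimplex.vertex 1) - l (stdSimplex.vertex 0) := by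
  set m := (exists_lift u).choose with hm
  have hm' : ∀ s, ((m s : ℝ) : UnitAddCircle) = u s := (exists_lift u).choose_spec
  have cov := AddCircle.isCoveringMap_coe (1 : ℝ)
  obtain ⟨k, hk⟩ : ∃ k : ℤ, (k : ℝ) = l (stdSimplex.vertex 0) - m (stdSimplex.vertex 0) := by
    have : ((l (stdSimplex.vertex 0) - m (stdSimplex.vertex 0) : ℝ) : UnitAddCircle) = 0 := by
      rw [AddCircle.coe_sub, hl, hm', sub_self]
    obtain ⟨k, hk⟩ := (AddCircle.coe_eq_zero_iff (1 : ℝ)).1 this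
    exact ⟨k, by simpa using hk⟩
  have key : (⇑l : stdSimplex ℝ (Fin 2) → ℝ) = fun s => m s + k := by
    refine cov.eq_of_comp_eq l.continuous (by fun_prop) ?_ (stdSimplex.vertex 0) (by
      rw [hk]; ring)
    funext s
    have hk0 : (((k : ℤ) : ℝ) : UnitAddCircle) = 0 :=
      (AddCircle.coe_eq_zero_iff (1 : ℝ)).2 ⟨k, by simp⟩
    change ((l s : ℝ) : UnitAddCircle) = ((m s + (k : ℝ) : ℝ) : UnitAddCircle)
    rw [AddCircle.coe_add, hk0, add_zero, hl, hm']
  have e1 := congrFun key (stdSimplex.vertex 1)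
  have e0 := congrFun key (stdSimplex.vertex 0)
  rw [e1, e0]
  change m _ - m _ = _
  ring

/-- The period `∫_c u^* dθ` of a real singular 1-chain `c` of `X`, for `u : X → ℝ/ℤ`. -/
def chainPeriod (u : C(X, UnitAddCircle)) : Chain 1 X →ₗ[ℝ] ℝ :=
  Finsupp.linearCombination ℝ fun s : Simplex 1 X => increment (u.comp s)

theorem chainPeriod_boundary (u : C(X, UnitAddCircle)) (c : Chain 2 X) :
    chainPeriod u (bd2 X c) = 0 := by
  have h : chainPeriod u ∘ₗ bd2 X = 0 := by
    ext1 s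
    ext1
    obtain ⟨l, hl⟩ := exists_lift (u.comp s)
    have hf : ∀ k : Fin 3, increment (u.comp (s.comp (face 1 k))) =
        l (stdSimplex.vertex (k.succAbove 1)) - l (stdSimplex.vertex (k.succAbove 0)) := by
      intro k
      rw [increment_eq _ (l.comp (face 1 k)) fun t => hl _]
      simp [face]
    simp [bd2, boundary, chainPeriod, hf, Fin.sum_univ_three]
    have a1 : (2 : Fin 3).succAbove (1 : Fin 2) = 1 := by decide
    simp only [a1]
    ring
  exact LinearMap.congr_fun h c

/-- The period homomorphism `H₁(X; ℝ) → ℝ`, `γ ↦ ∫_γ u^* dθ`, for `u : X → ℝ/ℤ`. -/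
def period (u : C(X, UnitAddCircle)) : H1 X →ₗ[ℝ] ℝ :=
  Submodule.liftQ _ (chainPeriod u ∘ₗ (Cycles X).subtype) fun c hc => by
    obtain ⟨d, hd⟩ : ∃ d, bd2 X d = (c : Chain 1 X) := hc
    exact (congrArg (chainPeriod u) hd).symm.trans (chainPeriod_boundary u d)

end Sing

/-! ### Square-tiled surfaces -/

/-- An origami with squares labelled by `Fin n`: the right side of square `i` is glued to the left
side of square `h i`, and the top side of square `i` to the bottom side of square `v i`. -/
structure Origami (n : ℕ) where
  h : Equiv.Perm (Fin n)
  v : Equiv.Perm (Fin n)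

namespace Origami

open Sing

variable {n : ℕ} (O : Origami n)

/-- The gluing of the sides of the closed unit squares. -/
inductive Glue : Fin n × unitInterval × unitInterval → Fin n × unitInterval × unitInterval → Prop
  | right (i : Fin n) (y : unitInterval) : Glue (i, 1, y) (O.h i, 0, y)
  | top (i : Fin n) (x : unitInterval) : Glue (i, x, 1) (O.v i, x, 0)

/-- The square-tiled surface: the quotient space of the disjoint union of `n` closed unit squares
by the equivalence relation generated by the gluing. -/
def Surface : Type := Quot O.Glue

instance : TopologicalSpace O.Surface := inferInstanceAs (TopologicalSpace (Quot O.Glue))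

/-- The quotient map. -/
def proj (p : Fin n × unitInterval × unitInterval) : O.Surface := Quot.mk O.Glue p

theorem continuous_proj : Continuous O.proj := continuous_quot_mk

/-- The point with coordinates `(x, y)` in square `i`; only used for `x, y ∈ [0, 1]`. -/
def pt (i : Fin n) (x y : ℝ) : O.Surface :=
  O.proj (i, Set.projIcc 0 1 zero_le_one x, Set.projIcc 0 1 zero_le_one y)

/-- The translation charts. For `.inl i` this is the immersion of the horizontal open strip
`ℝ × (0, 1)` which is the obvious inclusion of square `i` on `[0, 1] × (0, 1)`; for `.inr i` it is
the immersion of the vertical open strip `(0, 1) × ℝ` which is the obvious inclusion of square `i`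
on `(0, 1) × [0, 1]`. Their images cover exactly the complement of the vertices of the squares. -/
def chart : Fin n ⊕ Fin n → (Fin 2 → ℝ) → O.Surface
  | .inl i, p => O.pt ((O.h ^ ⌊p 0⌋) i) (Int.fract (p 0)) (p 1)
  | .inr i, p => O.pt ((O.v ^ ⌊p 1⌋) i) (p 0) (Int.fract (p 1))

/-- The open strip on which a translation chart is considered. -/
def chartDomain : Fin n ⊕ Fin n → Set (Fin 2 → ℝ)
  | .inl _ => {p | p 1 ∈ Set.Ioo (0 : ℝ) 1}
  | .inr _ => {p | p 0 ∈ Set.Ioo (0 : ℝ) 1}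

/-- `f` is an (orientation and area preserving) affine homeomorphism with derivative `A`: away from
the vertices it takes values away from the vertices and reads `q ↦ A q + b` in translation charts.
In particular, `f` permutes the vertices. -/
def IsAffine (f : O.Surface ≃ₜ O.Surface) (A : Matrix.SpecialLinearGroup (Fin 2) ℝ) : Prop :=
  ∀ c, ∀ p ∈ chartDomain c, ∃ (d : Fin n ⊕ Fin n) (b : Fin 2 → ℝ),
    A.1.mulVec p + b ∈ chartDomain d ∧
      ∀ᶠ q in 𝓝 p, f (O.chart c q) = O.chart d (A.1.mulVec q + b)

/-- The Veech group: the derivatives of the affine homeomorphisms. -/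
def veechGroup : Set (Matrix.SpecialLinearGroup (Fin 2) ℝ) :=
  {A | ∃ f, O.IsAffine f A}

/-- First coordinate of the covering `O → ℝ²/ℤ²`, `(i, x, y) ↦ (x, y) mod ℤ²`. -/
def coordX : C(O.Surface, UnitAddCircle) where
  toFun := Quot.lift (fun p => ((p.2.1 : ℝ) : UnitAddCircle)) (by
    rintro _ _ (⟨i, y⟩ | ⟨i, x⟩)
    · simp
    · rfl)
  continuous_toFun := continuous_quot_lift _
    ((AddCircle.continuous_mk' (1 : ℝ)).comp (by fun_prop))

/-- Second coordinate of the covering `O → ℝ²/ℤ²`. -/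
def coordY : C(O.Surface, UnitAddCircle) where
  toFun := Quot.lift (fun p => ((p.2.2 : ℝ) : UnitAddCircle)) (by
    rintro _ _ (⟨i, y⟩ | ⟨i, x⟩)
    · rfl
    · simp)
  continuous_toFun := continuous_quot_lift _
    ((AddCircle.continuous_mk' (1 : ℝ)).comp (by fun_prop))

/-- Automorphisms: the homeomorphisms that commute with the covering `O → ℝ²/ℤ²`. -/
def IsAutomorphism (f : O.Surface ≃ₜ O.Surface) : Prop :=
  ∀ x, O.coordX (f x) = O.coordX x ∧ O.coordY (f x) = O.coordY x

/-- The holonomy `γ ↦ ∫_γ ω ∈ ℝ²`, where `ω` is the pull-back of `dz` along `O → ℝ²/ℤ²`. -/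
def holonomy : H1 O.Surface →ₗ[ℝ] ℝ × ℝ :=
  (period O.coordX).prod (period O.coordY)

/-- The zero-holonomy subspace `H₁⁽⁰⁾(O) = {γ ∈ H₁(O; ℝ) | ∫_γ ω = 0}`. -/
def zeroHolonomy : Submodule ℝ (H1 O.Surface) := LinearMap.ker O.holonomy

/-- `g = α(f)`: the automorphism `g` of `H₁⁽⁰⁾(O)` is the restriction of the action of `f` on
`H₁(O; ℝ)`. -/
def Induces (f : O.Surface ≃ₜ O.Surface) (g : O.zeroHolonomy ≃ₗ[ℝ] O.zeroHolonomy) : Prop :=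
  ∀ x : O.zeroHolonomy, (g x : H1 O.Surface) = H1map (f : C(O.Surface, O.Surface)) x

/-- The elements `α(f)`, for `f` an affine homeomorphism with derivative `A`. -/
def monodromyOver (A : Matrix.SpecialLinearGroup (Fin 2) ℝ) :
    Set (O.zeroHolonomy ≃ₗ[ℝ] O.zeroHolonomy) :=
  {g | ∃ f, O.IsAffine f A ∧ O.Induces f g}

/-- The Kontsevich–Zorich monodromy group `α(Aff(O))`. -/
def kzMonodromy : Set (O.zeroHolonomy ≃ₗ[ℝ] O.zeroHolonomy) :=
  {g | ∃ f A, O.IsAffine f A ∧ O.Induces f g}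

/-- The image of the automorphism group of `O`, acting on `H₁⁽⁰⁾(O)`. -/
def autMonodromy : Set (O.zeroHolonomy ≃ₗ[ℝ] O.zeroHolonomy) :=
  {g | ∃ f, O.IsAutomorphism f ∧ O.Induces f g}

/-! ### Horizontal and vertical closed curves -/

/-- The midpoint of the unit interval. -/
def half : unitInterval := ⟨1 / 2, by norm_num, by norm_num⟩

/-- The horizontal segment across square `i` at height `1/2`, from left to right. -/
def hSegment (i : Fin n) : Simplex 1 O.Surface where
  toFun s := O.proj (i, stdSimplexHomeomorphUnitInterval s, half)
  continuous_toFun := O.continuous_proj.comp (by fun_prop)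

/-- The vertical segment across square `i` at abscissa `1/2`, from bottom to top. -/
def vSegment (i : Fin n) : Simplex 1 O.Surface where
  toFun s := O.proj (i, half, stdSimplexHomeomorphUnitInterval s)
  continuous_toFun := O.continuous_proj.comp (by fun_prop)

theorem bd1_single {X : Type} [TopologicalSpace X] (s : Simplex 1 X) :
    bd1 X (Finsupp.single s 1) =
      Finsupp.single (ContinuousMap.const _ (s (stdSimplex.vertex 1))) 1 -
        Finsupp.single (ContinuousMap.const _ (s (stdSimplex.vertex 0))) 1 := by
  have hf : ∀ k : Fin 2, s.comp (face 0 k) =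
      ContinuousMap.const _ (s (stdSimplex.vertex (k.succAbove 0))) := by
    intro k
    ext t
    obtain rfl : t = stdSimplex.vertex 0 := Subsingleton.elim _ _
    simp [face]
  simp [bd1, boundary, hf, Fin.sum_univ_two, sub_eq_add_neg]

theorem hSegment_glue (i : Fin n) :
    O.hSegment i (stdSimplex.vertex 1) = O.hSegment (O.h i) (stdSimplex.vertex 0) :=
  Quot.sound (Glue.right i half)

theorem vSegment_glue (i : Fin n) :
    O.vSegment i (stdSimplex.vertex 1) = O.vSegment (O.v i) (stdSimplex.vertex 0) :=
  Quot.sound (Glue.top i half)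

/-- The class in `H₁(O; ℝ)` of the closed horizontal curve that begins on the left side of square
`i` and runs to the right through the `m` squares `i, h i, …, h^(m-1) i`. -/
def hCurve (i : Fin n) (m : ℕ) (hm : (O.h ^ m) i = i) : H1 O.Surface :=
  Submodule.Quotient.mk ⟨∑ k ∈ Finset.range m, Finsupp.single (O.hSegment ((O.h ^ k) i)) 1, by
    rw [LinearMap.mem_ker, map_sum]
    simp only [bd1_single, hSegment_glue, ← Equiv.Perm.mul_apply, ← pow_succ']
    rw [Finset.sum_range_sub fun k => (Finsupp.single (ContinuousMap.const _
      (O.hSegment ((O.h ^ k) i) (stdSimplex.vertex 0))) 1 : Chain 0 O.Surface), hm]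
    simp⟩

/-- The class in `H₁(O; ℝ)` of the closed vertical curve that begins on the bottom side of square
`i` and runs upwards through the `m` squares `i, v i, …, v^(m-1) i`. -/
def vCurve (i : Fin n) (m : ℕ) (hm : (O.v ^ m) i = i) : H1 O.Surface :=
  Submodule.Quotient.mk ⟨∑ k ∈ Finset.range m, Finsupp.single (O.vSegment ((O.v ^ k) i)) 1, by
    rw [LinearMap.mem_ker, map_sum]
    simp only [bd1_single, vSegment_glue, ← Equiv.Perm.mul_apply, ← pow_succ']
    rw [Finset.sum_range_sub fun k => (Finsupp.single (ContinuousMap.const _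
      (O.vSegment ((O.v ^ k) i) (stdSimplex.vertex 0))) 1 : Chain 0 O.Surface), hm]
    simp⟩

end Origami

/-! ### The threefold translation cover of the octahedron -/

namespace Octahedron

/-- The 12-square origami `O`. With the squares labelled from `1` to `12`, square `k` being
`k - 1 : Fin 12`, the permutations are
`h = (1 2 3)(4 5 6)(7 8 9)(10 11 12)` and `v = (1 4 7)(2 9 11)(3 10 5)(6 12 8)`. -/
def O : Origami 12 where
  h := ⟨![1, 2, 0, 4, 5, 3, 7, 8, 6, 10, 11, 9], ![2, 0, 1, 5, 3, 4, 8, 6, 7, 11, 9, 10],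
    by decide, by decide⟩
  v := ⟨![3, 8, 9, 6, 2, 11, 0, 5, 10, 4, 1, 7], ![6, 10, 4, 0, 9, 7, 3, 11, 1, 2, 8, 5],
    by decide, by decide⟩

theorem h_pow (i : Fin 12) : (O.h ^ 3) i = i := by revert i; decide

theorem v_pow (i : Fin 12) : (O.v ^ 3) i = i := by revert i; decide

/-- The class of the horizontal curve `σ_k`, beginning on the left side of square `k = i + 1`. -/
def sig (i : Fin 12) : Sing.H1 O.Surface := O.hCurve i 3 (h_pow i)

/-- The class of the vertical curve `ζ_k`, beginning on the bottom side of square `k = i + 1`. -/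
def zet (i : Fin 12) : Sing.H1 O.Surface := O.vCurve i 3 (v_pow i)

/-- The classes `Σ₁, Σ₄, Σ₇, Z₂, Z₃, Z₆`, where `Σ_k = σ_k - σ₁₀` and `Z_k = ζ₁ - ζ_k`. -/
def zeroHolonomyFamily : Fin 6 → Sing.H1 O.Surface :=
  ![sig 0 - sig 9, sig 3 - sig 9, sig 6 - sig 9, zet 0 - zet 1, zet 0 - zet 2, zet 0 - zet 5]

/-- The matrix `T`. -/
def T : Matrix.SpecialLinearGroup (Fin 2) ℝ := ⟨!![1, 1; 0, 1], by simp [Matrix.det_fin_two]⟩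

/-- The matrix `S`. -/
def S : Matrix.SpecialLinearGroup (Fin 2) ℝ := ⟨!![1, 0; 1, 1], by simp [Matrix.det_fin_two]⟩

/-- The matrix `α(T³)`. -/
def matT3 : Matrix (Fin 6) (Fin 6) ℝ :=
  !![1, 0, 0, 0, 0, 1;
     0, 1, 0, 1, 0, 0;
     0, 0, 1, 0, 1, 0;
     0, 0, 0, 1, 0, 0;
     0, 0, 0, 0, 1, 0;
     0, 0, 0, 0, 0, 1]

/-- The matrix `α(S⁻¹T)`. -/
def matSinvT : Matrix (Fin 6) (Fin 6) ℝ :=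
  !![-1, -1, -1, 1, 1, 1;
     0, 0, 1, 0, -1, 0;
     1, 0, 0, 0, 0, -1;
     0, 0, 1, 0, 0, 0;
     1, 0, 0, 0, 0, 0;
     -1, -1, -1, 0, 0, 0]

end Octahedron

end

/-! An affine homeomorphism permutes the finitely many vertices of the squares, so in coordinates
modulo 1 it is linear with integral matrix: it lifts an automorphism of the torus
(`IsAffine.exists_covers`). Conversely, a homeomorphism that lifts an integral matrix is affine,
because the covering of the torus is injective near every point that is not a vertex
(`Covers.isAffine`). Everything therefore concerns lifts of elements of SL(2, ℤ), and the
automorphisms are the lifts of the identity.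

Veech group. The horizontal cylinders have height 1 and length 3, so T³ lifts to a multi-twist; U =
S⁻¹T lifts by means of a suitable relabelling of the squares. Let Γ = ⟨T³, U⟩. Since SL(2, ℤ) = Γ ∪
ΓTΓ (`mem_or_exists_mul_T_mul`), a lift of any matrix outside Γ would produce a lift of T itself,
and the relations between h and v forbid that (`not_covers_T`).

Homology. The open stars of the six vertices contract to points, so H₁ is generated by the sides of
the squares (`toChainClass_mem_sideSpan`). The four horizontal and four vertical cylinders have dual
circle-valued maps, hence eight periods; a cycle on which all eight vanish is a combination of
boundaries of squares (`exists_potential`, `eq_zero_of_periods`). In each direction the four periods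
add up to a component of the holonomy, so on the zero-holonomy subspace six of them suffice, and up
to sign these are dual to the given family (`dualCoord_family`). This gives the basis, and the two
matrices become finite sums over the twelve squares.

Monodromy. Two lifts of one matrix differ by an automorphism (`Covers.mem_monodromyOver_iff`). Any
affine homeomorphism lies over some element of Γ, and is compared with the lift given by a word in
the two generators. -/

noncomputable section

open Set

/-! ### Affine homeomorphisms are the lifts of integral automorphisms of the torus. -/

namespace Origami

/-! ### Points, strips and maps out of a square-tiled surface -/

variable {n : ℕ} (O : Origami n)

theorem continuous_pt (i : Fin n) : Continuous fun q : ℝ × ℝ => O.pt i q.1 q.2 :=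
  O.continuous_proj.comp (by fun_prop)

theorem pt_right (i : Fin n) (y : ℝ) : O.pt i 1 y = O.pt (O.h i) 0 y := by
  simp only [pt, projIcc_left, projIcc_right]
  exact Quot.sound (Glue.right i _)

theorem pt_top (i : Fin n) (x : ℝ) : O.pt i x 1 = O.pt (O.v i) x 0 := by
  simp only [pt, projIcc_left, projIcc_right]
  exact Quot.sound (Glue.top i _)

theorem exists_pt (z : O.Surface) :
    ∃ i, ∃ x ∈ Icc (0 : ℝ) 1, ∃ y ∈ Icc (0 : ℝ) 1, O.pt i x y = z := by
  obtain ⟨⟨i, x, y⟩, rfl⟩ := Quot.exists_rep z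
  refine ⟨i, x, x.2, y, y.2, ?_⟩
  simp only [pt, projIcc_val]
  rfl

/-- The continuous map out of a square-tiled surface defined by compatible maps on the squares. -/
def desc {Y : Type*} [TopologicalSpace Y] (F : Fin n → ℝ → ℝ → Y)
    (hF : ∀ i, Continuous fun q : ℝ × ℝ => F i q.1 q.2)
    (hr : ∀ i, ∀ y ∈ Icc (0 : ℝ) 1, F i 1 y = F (O.h i) 0 y)
    (ht : ∀ i, ∀ x ∈ Icc (0 : ℝ) 1, F i x 1 = F (O.v i) x 0) : C(O.Surface, Y) where
  toFun := Quot.lift (fun p => F p.1 p.2.1 p.2.2) (by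
    rintro _ _ (⟨i, y⟩ | ⟨i, x⟩)
    · exact hr i y y.2
    · exact ht i x x.2)
  continuous_toFun := continuous_quot_lift _ (by
    rw [continuous_prod_of_discrete_left]
    exact fun i => (hF i).comp (by fun_prop : Continuous fun q : unitInterval × unitInterval =>
      ((q.1 : ℝ), (q.2 : ℝ))))

theorem desc_pt {Y : Type*} [TopologicalSpace Y] {F : Fin n → ℝ → ℝ → Y}
    (hF : ∀ i, Continuous fun q : ℝ × ℝ => F i q.1 q.2)
    (hr : ∀ i, ∀ y ∈ Icc (0 : ℝ) 1, F i 1 y = F (O.h i) 0 y)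
    (ht : ∀ i, ∀ x ∈ Icc (0 : ℝ) 1, F i x 1 = F (O.v i) x 0)
    (i : Fin n) {x y : ℝ} (hx : x ∈ Icc (0 : ℝ) 1) (hy : y ∈ Icc (0 : ℝ) 1) :
    O.desc F hF hr ht (O.pt i x y) = F i x y := by
  change F i (projIcc 0 1 zero_le_one x : ℝ) (projIcc 0 1 zero_le_one y : ℝ) = _
  rw [projIcc_of_mem _ hx, projIcc_of_mem _ hy]

theorem coordX_pt (i : Fin n) {x : ℝ} (hx : x ∈ Icc (0 : ℝ) 1) (y : ℝ) :
    O.coordX (O.pt i x y) = (x : UnitAddCircle) := by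
  change ((projIcc (0 : ℝ) 1 zero_le_one x : ℝ) : UnitAddCircle) = _
  rw [projIcc_of_mem _ hx]

theorem coordY_pt (i : Fin n) (x : ℝ) {y : ℝ} (hy : y ∈ Icc (0 : ℝ) 1) :
    O.coordY (O.pt i x y) = (y : UnitAddCircle) := by
  change ((projIcc (0 : ℝ) 1 zero_le_one y : ℝ) : UnitAddCircle) = _
  rw [projIcc_of_mem _ hy]

theorem fract_mem_Icc (x : ℝ) : Int.fract x ∈ Icc (0 : ℝ) 1 :=
  ⟨Int.fract_nonneg x, (Int.fract_lt_one x).le⟩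

theorem coe_fract (x : ℝ) : ((Int.fract x : ℝ) : UnitAddCircle) = x := by
  rw [Int.fract, AddCircle.coe_sub, sub_eq_self]
  exact (AddCircle.coe_eq_zero_iff (1 : ℝ)).2 ⟨⌊x⌋, by simp⟩

theorem coe_eq_zero_iff_exists_int (x : ℝ) : (x : UnitAddCircle) = 0 ↔ ∃ k : ℤ, (k : ℝ) = x := by
  rw [AddCircle.coe_eq_zero_iff]
  simp

theorem coe_intCast (k : ℤ) : ((k : ℝ) : UnitAddCircle) = 0 :=
  (coe_eq_zero_iff_exists_int _).2 ⟨k, rfl⟩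

theorem coe_eq_coe_iff (x y : ℝ) :
    (x : UnitAddCircle) = y ↔ ∃ k : ℤ, x = y + k := by
  rw [← sub_eq_zero, ← AddCircle.coe_sub, coe_eq_zero_iff_exists_int]
  exact exists_congr fun k => ⟨fun h => by linarith, fun h => by linarith⟩

/-- Maps on the strips `[k, k + 1] × ℝ` that agree on the common sides form a continuous map. -/
theorem continuous_strip {Y : Type*} [TopologicalSpace Y] (σ : Equiv.Perm (Fin n))
    (P : Fin n → ℝ × ℝ → Y) (hP : ∀ i, Continuous (P i))
    (hσ : ∀ i y, P i (1, y) = P (σ i) (0, y)) (i : Fin n) :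
    Continuous fun q : ℝ × ℝ => P ((σ ^ ⌊q.1⌋) i) (Int.fract q.1, q.2) := by
  have hloc : LocallyFinite fun k : ℤ => Icc (k : ℝ) (k + 1) := by
    intro x
    refine ⟨Ioo (x - 1) (x + 1), Ioo_mem_nhds (by linarith) (by linarith), ?_⟩
    refine (finite_Icc (⌊x⌋ - 3) (⌊x⌋ + 3)).subset ?_
    rintro k ⟨z, ⟨h1, h2⟩, h3, h4⟩
    have := Int.floor_le x
    have := Int.lt_floor_add_one x
    constructor
    · have : ((⌊x⌋ - 3 : ℤ) : ℝ) ≤ k := by push_cast; linarith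
      exact_mod_cast this
    · have : (k : ℝ) ≤ ((⌊x⌋ + 3 : ℤ) : ℝ) := by push_cast; linarith
      exact_mod_cast this
  refine LocallyFinite.continuous (f := fun k : ℤ => Prod.fst ⁻¹' Icc (k : ℝ) (k + 1))
    (hloc.preimage_continuous continuous_fst) ?_ (fun k => isClosed_Icc.preimage continuous_fst) ?_
  · rw [← preimage_iUnion, preimage_eq_univ_iff]
    intro x _
    exact mem_iUnion.2 ⟨⌊x⌋, Int.floor_le x, (Int.lt_floor_add_one x).le⟩
  · intro k
    have hc : Continuous fun q : ℝ × ℝ => P ((σ ^ k) i) (q.1 - k, q.2) :=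
      (hP _).comp (by fun_prop)
    refine hc.continuousOn.congr ?_
    rintro ⟨x, y⟩ ⟨h1, h2⟩
    simp only at h1 h2 ⊢
    -- Only at the right end does the floor jump to `k + 1`; there `hσ` identifies the two
    -- expressions.
    rcases h2.lt_or_eq with h2 | rfl
    · have : ⌊x⌋ = k := Int.floor_eq_iff.2 ⟨h1, h2⟩
      rw [Int.fract, this]
    · have : ⌊(k : ℝ) + 1⌋ = 1 + k := by simp [add_comm]
      rw [Int.fract, this, zpow_one_add, Equiv.Perm.mul_apply, add_sub_cancel_left, hσ]
      simp [add_comm]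

/-- The immersion of the horizontal strip `ℝ × [0, 1]`. -/
def hStrip (i : Fin n) (x y : ℝ) : O.Surface := O.pt ((O.h ^ ⌊x⌋) i) (Int.fract x) y

/-- The immersion of the vertical strip `[0, 1] × ℝ`. -/
def vStrip (i : Fin n) (x y : ℝ) : O.Surface := O.pt ((O.v ^ ⌊y⌋) i) x (Int.fract y)

theorem chart_inl (i : Fin n) (p : Fin 2 → ℝ) : O.chart (.inl i) p = O.hStrip i (p 0) (p 1) := rfl

theorem continuous_hStrip (i : Fin n) : Continuous fun q : ℝ × ℝ => O.hStrip i q.1 q.2 :=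
  continuous_strip O.h (fun i q => O.pt i q.1 q.2) O.continuous_pt O.pt_right i

theorem continuous_vStrip (i : Fin n) : Continuous fun q : ℝ × ℝ => O.vStrip i q.1 q.2 :=
  (continuous_strip O.v (fun i q => O.pt i q.2 q.1)
    (fun i => (O.continuous_pt i).comp continuous_swap) O.pt_top i).comp continuous_swap

theorem hStrip_add_int (i : Fin n) (x y : ℝ) (k : ℤ) :
    O.hStrip i (x + k) y = O.hStrip ((O.h ^ k) i) x y := by
  simp [hStrip, zpow_add]

theorem vStrip_add_int (i : Fin n) (x y : ℝ) (k : ℤ) :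
    O.vStrip i x (y + k) = O.vStrip ((O.v ^ k) i) x y := by
  simp [vStrip, zpow_add]

theorem hStrip_add_one (i : Fin n) (x y : ℝ) :
    O.hStrip i (x + 1) y = O.hStrip (O.h i) x y := by
  simpa using O.hStrip_add_int i x y 1

theorem vStrip_add_one (i : Fin n) (x y : ℝ) :
    O.vStrip i x (y + 1) = O.vStrip (O.v i) x y := by
  simpa using O.vStrip_add_int i x y 1

theorem hStrip_eq_pt (i : Fin n) {x : ℝ} (hx : x ∈ Icc (0 : ℝ) 1) (y : ℝ) :
    O.hStrip i x y = O.pt i x y := by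
  rcases hx.2.lt_or_eq with h | rfl
  · simp [hStrip, Int.floor_eq_zero_iff.2 ⟨hx.1, h⟩, Int.fract_eq_self.2 ⟨hx.1, h⟩]
  · simp [hStrip, pt_right]

theorem vStrip_eq_pt (i : Fin n) (x : ℝ) {y : ℝ} (hy : y ∈ Icc (0 : ℝ) 1) :
    O.vStrip i x y = O.pt i x y := by
  rcases hy.2.lt_or_eq with h | rfl
  · simp [vStrip, Int.floor_eq_zero_iff.2 ⟨hy.1, h⟩, Int.fract_eq_self.2 ⟨hy.1, h⟩]
  · simp [vStrip, pt_top]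

theorem coordX_hStrip (i : Fin n) (x y : ℝ) : O.coordX (O.hStrip i x y) = (x : UnitAddCircle) := by
  rw [hStrip, coordX_pt _ _ (fract_mem_Icc x), coe_fract]

theorem coordY_hStrip (i : Fin n) (x : ℝ) {y : ℝ} (hy : y ∈ Icc (0 : ℝ) 1) :
    O.coordY (O.hStrip i x y) = (y : UnitAddCircle) := O.coordY_pt _ _ hy

theorem coordX_vStrip (i : Fin n) {x : ℝ} (hx : x ∈ Icc (0 : ℝ) 1) (y : ℝ) :
    O.coordX (O.vStrip i x y) = (x : UnitAddCircle) := O.coordX_pt _ hx _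

theorem coordY_vStrip (i : Fin n) (x y : ℝ) : O.coordY (O.vStrip i x y) = (y : UnitAddCircle) := by
  rw [vStrip, coordY_pt _ _ _ (fract_mem_Icc y), coe_fract]

end Origami

namespace Origami

variable {n : ℕ} (O : Origami n)

/-! ### Bump functions and local injectivity of the covering -/

/-- A function whose support is the interior of square `i`. -/
def squareBump (i : Fin n) : C(O.Surface, ℝ) :=
  O.desc (fun j x y => if j = i then x * (1 - x) * (y * (1 - y)) else 0)
    (fun j => by split_ifs <;> fun_prop) (fun j y _ => by simp) (fun j x _ => by simp)

/-- A function supported in the two half squares adjacent to the left side of square `i`. -/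
def leftBump (i : Fin n) : C(O.Surface, ℝ) :=
  O.desc (fun j x y => ((if j = i then max 0 (1 / 2 - x) else 0) +
      (if O.h j = i then max 0 (x - 1 / 2) else 0)) * (y * (1 - y)))
    (fun j => by split_ifs <;> fun_prop) (fun j y _ => by norm_num) (fun j x _ => by simp)

/-- A function supported in the two half squares adjacent to the bottom side of square `i`. -/
def bottomBump (i : Fin n) : C(O.Surface, ℝ) :=
  O.desc (fun j x y => ((if j = i then max 0 (1 / 2 - y) else 0) +
      (if O.v j = i then max 0 (y - 1 / 2) else 0)) * (x * (1 - x)))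
    (fun j => by split_ifs <;> fun_prop) (fun j y _ => by simp) (fun j x _ => by norm_num)

theorem pos_of_mul_one_sub_ne_zero {x : ℝ} (hx : x ∈ Icc (0 : ℝ) 1) (h : x * (1 - x) ≠ 0) :
    x ∈ Ioo (0 : ℝ) 1 := by
  refine ⟨lt_of_le_of_ne hx.1 ?_, lt_of_le_of_ne hx.2 ?_⟩ <;> rintro rfl <;> simp at h

theorem of_squareBump_ne_zero {i j : Fin n} {x y : ℝ} (hx : x ∈ Icc (0 : ℝ) 1)
    (hy : y ∈ Icc (0 : ℝ) 1) (h : O.squareBump i (O.pt j x y) ≠ 0) :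
    j = i ∧ x ∈ Ioo (0 : ℝ) 1 ∧ y ∈ Ioo (0 : ℝ) 1 := by
  rw [squareBump, desc_pt _ _ _ _ _ hx hy] at h
  split_ifs at h with hj
  · exact ⟨hj, pos_of_mul_one_sub_ne_zero hx (left_ne_zero_of_mul h),
      pos_of_mul_one_sub_ne_zero hy (right_ne_zero_of_mul h)⟩
  · exact absurd rfl h

theorem half_bump_ne_zero {p q : Prop} [Decidable p] [Decidable q] {x : ℝ}
    (h : (if p then max 0 (1 / 2 - x) else 0) + (if q then max 0 (x - 1 / 2) else 0) ≠ 0) :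
    (p ∧ x < 1 / 2) ∨ (q ∧ 1 / 2 < x) := by
  by_contra! hc
  apply h
  have h1 : (if p then max 0 (1 / 2 - x) else 0) = 0 := by
    split_ifs with hp
    · exact max_eq_left (by linarith [hc.1 hp])
    · rfl
  have h2 : (if q then max 0 (x - 1 / 2) else 0) = 0 := by
    split_ifs with hq
    · exact max_eq_left (by linarith [hc.2 hq])
    · rfl
  rw [h1, h2, add_zero]

theorem of_leftBump_ne_zero {i j : Fin n} {x y : ℝ} (hx : x ∈ Icc (0 : ℝ) 1)
    (hy : y ∈ Icc (0 : ℝ) 1) (h : O.leftBump i (O.pt j x y) ≠ 0) :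
    ((j = i ∧ x < 1 / 2) ∨ (O.h j = i ∧ 1 / 2 < x)) ∧ y ∈ Ioo (0 : ℝ) 1 := by
  rw [leftBump, desc_pt _ _ _ _ _ hx hy] at h
  exact ⟨half_bump_ne_zero (left_ne_zero_of_mul h),
    pos_of_mul_one_sub_ne_zero hy (right_ne_zero_of_mul h)⟩

theorem of_bottomBump_ne_zero {i j : Fin n} {x y : ℝ} (hx : x ∈ Icc (0 : ℝ) 1)
    (hy : y ∈ Icc (0 : ℝ) 1) (h : O.bottomBump i (O.pt j x y) ≠ 0) :
    ((j = i ∧ y < 1 / 2) ∨ (O.v j = i ∧ 1 / 2 < y)) ∧ x ∈ Ioo (0 : ℝ) 1 := by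
  rw [bottomBump, desc_pt _ _ _ _ _ hx hy] at h
  exact ⟨half_bump_ne_zero (left_ne_zero_of_mul h),
    pos_of_mul_one_sub_ne_zero hx (right_ne_zero_of_mul h)⟩

theorem squareBump_pt_ne_zero (i : Fin n) {x y : ℝ} (hx : x ∈ Ioo (0 : ℝ) 1)
    (hy : y ∈ Ioo (0 : ℝ) 1) : O.squareBump i (O.pt i x y) ≠ 0 := by
  rw [squareBump, desc_pt _ _ _ _ _ (Ioo_subset_Icc_self hx) (Ioo_subset_Icc_self hy), if_pos rfl]
  have h1 := hx.1.ne'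
  have h2 := hy.1.ne'
  have h3 := (sub_pos.2 hx.2).ne'
  have h4 := (sub_pos.2 hy.2).ne'
  positivity

theorem leftBump_pt_ne_zero (i : Fin n) {y : ℝ} (hy : y ∈ Ioo (0 : ℝ) 1) :
    O.leftBump i (O.pt i 0 y) ≠ 0 := by
  rw [leftBump, desc_pt _ _ _ _ _ (by simp) (Ioo_subset_Icc_self hy), if_pos rfl]
  have h2 := hy.1.ne'
  have h4 := (sub_pos.2 hy.2).ne'
  have : max (0 : ℝ) (0 - 1 / 2) = 0 := by norm_num
  rw [this]
  simp [h2, h4]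

theorem bottomBump_pt_ne_zero (i : Fin n) {x : ℝ} (hx : x ∈ Ioo (0 : ℝ) 1) :
    O.bottomBump i (O.pt i x 0) ≠ 0 := by
  rw [bottomBump, desc_pt _ _ _ _ _ (Ioo_subset_Icc_self hx) (by simp), if_pos rfl]
  have h2 := hx.1.ne'
  have h4 := (sub_pos.2 hx.2).ne'
  have : max (0 : ℝ) (0 - 1 / 2) = 0 := by norm_num
  rw [this]
  simp [h2, h4]

theorem eq_of_coe_eq_of_abs_lt {x y : ℝ} (h : (x : UnitAddCircle) = y) (hxy : |x - y| < 1) :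
    x = y := by
  obtain ⟨k, hk⟩ := (coe_eq_coe_iff x y).1 h
  have : |(k : ℝ)| < 1 := by rwa [show (k : ℝ) = x - y by linarith]
  have : k = 0 := Int.abs_lt_one_iff.1 (by exact_mod_cast this)
  simp [hk, this]

theorem eq_of_coe_eq_of_mem_Ioo {x y : ℝ} (h : (x : UnitAddCircle) = y) (hx : x ∈ Ioo (0 : ℝ) 1)
    (hy : y ∈ Icc (0 : ℝ) 1) : x = y :=
  eq_of_coe_eq_of_abs_lt h (abs_lt.2 ⟨by linarith [hx.1, hy.2], by linarith [hx.2, hy.1]⟩)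

theorem eq_zero_or_one_of_coe_eq_zero {x : ℝ} (h : (x : UnitAddCircle) = 0)
    (hx : x ∈ Icc (0 : ℝ) 1) : x = 0 ∨ x = 1 := by
  by_contra! hc
  have hx' : x ∈ Ioo (0 : ℝ) 1 := ⟨lt_of_le_of_ne hx.1 hc.1.symm, lt_of_le_of_ne hx.2 hc.2⟩
  exact hc.1 (eq_of_coe_eq_of_mem_Ioo (by simpa using h) hx' (by simp))

theorem eq_or_one_zero_of_coe_eq {x y : ℝ} (h : (x : UnitAddCircle) = y) (hx : x ∈ Icc (0 : ℝ) 1)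
    (hy : y ∈ Icc (0 : ℝ) 1) (hxy : y ≤ x) : x = y ∨ (x = 1 ∧ y = 0) := by
  by_cases h1 : x - y < 1
  · exact .inl (eq_of_coe_eq_of_abs_lt h (abs_lt.2 ⟨by linarith, h1⟩))
  · exact .inr ⟨by linarith [hx.2, hy.1], by linarith [hx.2, hy.1]⟩

/-- The vertices of the squares. -/
def vertices : Set O.Surface := {z | O.coordX z = 0 ∧ O.coordY z = 0}

theorem finite_vertices : O.vertices.Finite := by
  refine (finite_range fun i => O.pt i 0 0).subset ?_
  rintro z ⟨h1, h2⟩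
  obtain ⟨i, x, hx, y, hy, rfl⟩ := O.exists_pt z
  rw [coordX_pt _ _ hx] at h1
  rw [coordY_pt _ _ _ hy] at h2
  rcases eq_zero_or_one_of_coe_eq_zero h1 hx with rfl | rfl <;>
    rcases eq_zero_or_one_of_coe_eq_zero h2 hy with rfl | rfl <;>
    simp [pt_right, pt_top]

theorem pt_mem_vertices (i : Fin n) : O.pt i 0 0 ∈ O.vertices := by
  simp [vertices, coordX_pt, coordY_pt]

/-- A point which is not a vertex is interior to a square, to a left side or to a bottom side. -/
theorem cases_of_notMem_vertices {z : O.Surface} (hz : z ∉ O.vertices) :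
    ∃ i, (∃ x ∈ Ioo (0 : ℝ) 1, ∃ y ∈ Ioo (0 : ℝ) 1, z = O.pt i x y) ∨
      (∃ y ∈ Ioo (0 : ℝ) 1, z = O.pt i 0 y) ∨ (∃ x ∈ Ioo (0 : ℝ) 1, z = O.pt i x 0) := by
  obtain ⟨i, x, hx, y, hy, rfl⟩ := O.exists_pt z
  have hend : ∀ {t : ℝ}, t ∈ Icc (0 : ℝ) 1 → t ∈ Ioo (0 : ℝ) 1 ∨ t = 0 ∨ t = 1 := by
    rintro t ht
    rcases ht.1.eq_or_lt with h | h
    · exact .inr (.inl h.symm)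
    · rcases ht.2.eq_or_lt with h' | h'
      · exact .inr (.inr h')
      · exact .inl ⟨h, h'⟩
  rcases hend hx with hx' | rfl | rfl <;> rcases hend hy with hy' | rfl | rfl
  · exact ⟨i, .inl ⟨x, hx', y, hy', rfl⟩⟩
  · exact ⟨i, .inr (.inr ⟨x, hx', rfl⟩)⟩
  · exact ⟨O.v i, .inr (.inr ⟨x, hx', O.pt_top _ _⟩)⟩
  · exact ⟨i, .inr (.inl ⟨y, hy', rfl⟩)⟩
  · exact absurd (O.pt_mem_vertices i) hz
  · rw [pt_top] at hz
    exact absurd (O.pt_mem_vertices _) hz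
  · exact ⟨O.h i, .inr (.inl ⟨y, hy', O.pt_right _ _⟩)⟩
  · rw [pt_right] at hz
    exact absurd (O.pt_mem_vertices _) hz
  · rw [pt_right, pt_top] at hz
    exact absurd (O.pt_mem_vertices _) hz

/-- The neighbourhood is the set where a bump function does not vanish: an open square, or two half
squares along a common side. Half squares are used so that the coordinate modulo 1 also tells on
which side of the edge a point lies. -/
theorem exists_nhds_injOn {z : O.Surface} (hz : z ∉ O.vertices) :
    ∃ W ∈ 𝓝 z, ∀ a ∈ W, ∀ b ∈ W, O.coordX a = O.coordX b → O.coordY a = O.coordY b → a = b := by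
  have key : ∀ u : C(O.Surface, ℝ), u z ≠ 0 → u ⁻¹' {0}ᶜ ∈ 𝓝 z := fun u hu =>
    u.continuous.continuousAt.preimage_mem_nhds (isOpen_compl_singleton.mem_nhds hu)
  obtain ⟨i, ⟨x, hx, y, hy, rfl⟩ | ⟨y, hy, rfl⟩ | ⟨x, hx, rfl⟩⟩ := O.cases_of_notMem_vertices hz
  · refine ⟨_, key (O.squareBump i) (O.squareBump_pt_ne_zero i hx hy), ?_⟩
    intro a ha b hb hX hY
    obtain ⟨j, x₁, hx₁, y₁, hy₁, rfl⟩ := O.exists_pt a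
    obtain ⟨k, x₂, hx₂, y₂, hy₂, rfl⟩ := O.exists_pt b
    rw [coordX_pt _ _ hx₁, coordX_pt _ _ hx₂] at hX
    rw [coordY_pt _ _ _ hy₁, coordY_pt _ _ _ hy₂] at hY
    obtain ⟨rfl, h1, h2⟩ := O.of_squareBump_ne_zero hx₁ hy₁ ha
    obtain ⟨rfl, h3, h4⟩ := O.of_squareBump_ne_zero hx₂ hy₂ hb
    rw [eq_of_coe_eq_of_mem_Ioo hX h1 hx₂, eq_of_coe_eq_of_mem_Ioo hY h2 hy₂]
  · refine ⟨_, key (O.leftBump i) (O.leftBump_pt_ne_zero i hy), ?_⟩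
    intro a ha b hb hX hY
    obtain ⟨j, x₁, hx₁, y₁, hy₁, rfl⟩ := O.exists_pt a
    obtain ⟨k, x₂, hx₂, y₂, hy₂, rfl⟩ := O.exists_pt b
    rw [coordX_pt _ _ hx₁, coordX_pt _ _ hx₂] at hX
    rw [coordY_pt _ _ _ hy₁, coordY_pt _ _ _ hy₂] at hY
    obtain ⟨h1, h2⟩ := O.of_leftBump_ne_zero hx₁ hy₁ ha
    obtain ⟨h3, h4⟩ := O.of_leftBump_ne_zero hx₂ hy₂ hb
    rw [eq_of_coe_eq_of_mem_Ioo hY h2 hy₂]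
    rcases h1 with ⟨e1, h1⟩ | ⟨e1, h1⟩ <;> rcases h3 with ⟨e3, h3⟩ | ⟨e3, h3⟩
    · rw [eq_of_coe_eq_of_abs_lt hX (abs_lt.2 ⟨by linarith [hx₁.1], by linarith [hx₂.1]⟩), e1, e3]
    · rcases eq_or_one_zero_of_coe_eq hX.symm hx₂ hx₁ (by linarith) with h | ⟨rfl, rfl⟩
      · linarith
      · rw [pt_right, e1, e3]
    · rcases eq_or_one_zero_of_coe_eq hX hx₁ hx₂ (by linarith) with h | ⟨rfl, rfl⟩
      · linarith
      · rw [pt_right, e1, e3]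
    · rw [eq_of_coe_eq_of_abs_lt hX (abs_lt.2 ⟨by linarith [hx₂.2], by linarith [hx₁.2]⟩),
        O.h.injective (e1.trans e3.symm)]
  · refine ⟨_, key (O.bottomBump i) (O.bottomBump_pt_ne_zero i hx), ?_⟩
    intro a ha b hb hX hY
    obtain ⟨j, x₁, hx₁, y₁, hy₁, rfl⟩ := O.exists_pt a
    obtain ⟨k, x₂, hx₂, y₂, hy₂, rfl⟩ := O.exists_pt b
    rw [coordX_pt _ _ hx₁, coordX_pt _ _ hx₂] at hX
    rw [coordY_pt _ _ _ hy₁, coordY_pt _ _ _ hy₂] at hY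
    obtain ⟨h1, h2⟩ := O.of_bottomBump_ne_zero hx₁ hy₁ ha
    obtain ⟨h3, h4⟩ := O.of_bottomBump_ne_zero hx₂ hy₂ hb
    rw [eq_of_coe_eq_of_mem_Ioo hX h2 hx₂]
    rcases h1 with ⟨e1, h1⟩ | ⟨e1, h1⟩ <;> rcases h3 with ⟨e3, h3⟩ | ⟨e3, h3⟩
    · rw [eq_of_coe_eq_of_abs_lt hY (abs_lt.2 ⟨by linarith [hy₁.1], by linarith [hy₂.1]⟩), e1, e3]
    · rcases eq_or_one_zero_of_coe_eq hY.symm hy₂ hy₁ (by linarith) with h | ⟨rfl, rfl⟩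
      · linarith
      · rw [pt_top, e1, e3]
    · rcases eq_or_one_zero_of_coe_eq hY hy₁ hy₂ (by linarith) with h | ⟨rfl, rfl⟩
      · linarith
      · rw [pt_top, e1, e3]
    · rw [eq_of_coe_eq_of_abs_lt hY (abs_lt.2 ⟨by linarith [hy₂.2], by linarith [hy₁.2]⟩),
        O.v.injective (e1.trans e3.symm)]

/-! ### Translation charts -/

theorem continuous_chart (c : Fin n ⊕ Fin n) : Continuous (O.chart c) := by
  rcases c with i | i
  · exact (O.continuous_hStrip i).comp (by fun_prop : Continuous fun p : Fin 2 → ℝ => (p 0, p 1))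
  · exact (O.continuous_vStrip i).comp (by fun_prop : Continuous fun p : Fin 2 → ℝ => (p 0, p 1))

theorem isOpen_chartDomain (c : Fin n ⊕ Fin n) : IsOpen (chartDomain c) := by
  rcases c with i | i
  · exact isOpen_Ioo.preimage (continuous_apply 1)
  · exact isOpen_Ioo.preimage (continuous_apply 0)

theorem coord_chart {c : Fin n ⊕ Fin n} {p : Fin 2 → ℝ} (hp : p ∈ chartDomain c) :
    O.coordX (O.chart c p) = (p 0 : UnitAddCircle) ∧
      O.coordY (O.chart c p) = (p 1 : UnitAddCircle) := by
  rcases c with i | i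
  · exact ⟨O.coordX_hStrip _ _ _, O.coordY_hStrip _ _ (Ioo_subset_Icc_self hp)⟩
  · exact ⟨O.coordX_vStrip _ (Ioo_subset_Icc_self hp) _, O.coordY_vStrip _ _ _⟩

theorem coe_ne_zero_of_mem_Ioo {x : ℝ} (hx : x ∈ Ioo (0 : ℝ) 1) : (x : UnitAddCircle) ≠ 0 :=
  fun h => hx.1.ne' (eq_of_coe_eq_of_mem_Ioo (by simpa using h) hx (by simp))

theorem chart_notMem_vertices {c : Fin n ⊕ Fin n} {p : Fin 2 → ℝ} (hp : p ∈ chartDomain c) :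
    O.chart c p ∉ O.vertices := by
  rintro ⟨h1, h2⟩
  rw [(O.coord_chart hp).1] at h1
  rw [(O.coord_chart hp).2] at h2
  rcases c with i | i
  · exact coe_ne_zero_of_mem_Ioo hp h2
  · exact coe_ne_zero_of_mem_Ioo hp h1

theorem exists_chart {z : O.Surface} (hz : z ∉ O.vertices) :
    ∃ c, ∃ p ∈ chartDomain c, O.chart c p = z := by
  obtain ⟨i, ⟨x, hx, y, hy, rfl⟩ | ⟨y, hy, rfl⟩ | ⟨x, hx, rfl⟩⟩ := O.cases_of_notMem_vertices hz
  · exact ⟨.inl i, ![x, y], hy, O.hStrip_eq_pt i (Ioo_subset_Icc_self hx) y⟩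
  · exact ⟨.inl i, ![0, y], hy, O.hStrip_eq_pt i (by simp) y⟩
  · exact ⟨.inr i, ![x, 0], hx, O.vStrip_eq_pt i x (by simp)⟩

/-! ### Affine homeomorphisms cover linear automorphisms of the torus -/

/-- The homeomorphism `f` covers the automorphism of `ℝ²/ℤ²` given by the matrix `M`. -/
def Covers (f : O.Surface ≃ₜ O.Surface) (M : Matrix.SpecialLinearGroup (Fin 2) ℤ) : Prop :=
  ∀ z, O.coordX (f z) = M.1 0 0 • O.coordX z + M.1 0 1 • O.coordY z ∧
    O.coordY (f z) = M.1 1 0 • O.coordX z + M.1 1 1 • O.coordY z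

variable {O}

theorem Covers.trans {f g : O.Surface ≃ₜ O.Surface} {M N : Matrix.SpecialLinearGroup (Fin 2) ℤ}
    (hf : O.Covers f M) (hg : O.Covers g N) : O.Covers (f.trans g) (N * M) := by
  intro z
  simp only [Homeomorph.trans_apply, (hg _).1, (hg _).2, (hf _).1, (hf _).2,
    Matrix.SpecialLinearGroup.coe_mul, Matrix.mul_apply, Fin.sum_univ_two]
  constructor <;> module

theorem Covers.symm {f : O.Surface ≃ₜ O.Surface} {M : Matrix.SpecialLinearGroup (Fin 2) ℤ}
    (hf : O.Covers f M) : O.Covers f.symm M⁻¹ := by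
  intro z
  obtain ⟨w, rfl⟩ := f.surjective z
  have hd : M.1 0 0 * M.1 1 1 - M.1 0 1 * M.1 1 0 = 1 := by
    rw [← Matrix.det_fin_two]; exact M.2
  rw [Homeomorph.symm_apply_apply, (hf w).1, (hf w).2, Matrix.SpecialLinearGroup.SL2_inv_expl]
  simp only [Matrix.cons_val', Matrix.cons_val_zero, Matrix.cons_val_one,
    Matrix.cons_val_fin_one]
  constructor
  · calc O.coordX w = (M.1 0 0 * M.1 1 1 - M.1 0 1 * M.1 1 0) • O.coordX w := by
          rw [hd, one_zsmul]
      _ = _ := by module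
  · calc O.coordY w = (M.1 0 0 * M.1 1 1 - M.1 0 1 * M.1 1 0) • O.coordY w := by
          rw [hd, one_zsmul]
      _ = _ := by module

theorem Covers.notMem_vertices {f : O.Surface ≃ₜ O.Surface}
    {M : Matrix.SpecialLinearGroup (Fin 2) ℤ} (hf : O.Covers f M) {z : O.Surface}
    (hz : z ∉ O.vertices) : f z ∉ O.vertices := by
  rintro ⟨h1, h2⟩
  apply hz
  have := hf.symm (f z)
  rw [Homeomorph.symm_apply_apply] at this
  constructor
  · rw [this.1, h1, h2, smul_zero, smul_zero, add_zero]
  · rw [this.2, h1, h2, smul_zero, smul_zero, add_zero]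

theorem coe_int_mul (k : ℤ) (x : ℝ) : ((k * x : ℝ) : UnitAddCircle) = k • (x : UnitAddCircle) := by
  rw [← AddCircle.coe_zsmul, zsmul_eq_mul]

theorem Covers.isAffine {f : O.Surface ≃ₜ O.Surface}
    {M : Matrix.SpecialLinearGroup (Fin 2) ℤ} (hf : O.Covers f M) :
    O.IsAffine f (M.map (Int.castRingHom ℝ)) := by
  intro c p hp
  obtain ⟨d, p', hp', hd⟩ := O.exists_chart (hf.notMem_vertices (O.chart_notMem_vertices hp))
  set A := (M.map (Int.castRingHom ℝ)).1 with hA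
  have hA0 : ∀ q : Fin 2 → ℝ, A.mulVec q 0 = M.1 0 0 * q 0 + M.1 0 1 * q 1 := fun q => by
    simp [hA, Matrix.mulVec, dotProduct, Fin.sum_univ_two]
  have hA1 : ∀ q : Fin 2 → ℝ, A.mulVec q 1 = M.1 1 0 * q 0 + M.1 1 1 * q 1 := fun q => by
    simp [hA, Matrix.mulVec, dotProduct, Fin.sum_univ_two]
  have hc : Continuous fun q => A.mulVec q + (p' - A.mulVec p) := by fun_prop
  have hcp : A.mulVec p + (p' - A.mulVec p) = p' := by abel
  refine ⟨d, p' - A.mulVec p, by rwa [hcp], ?_⟩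
  -- The translation part is integral, since `p'` and `A p` are coordinates of the same point of the
  -- torus.
  have h0 : (((p' - A.mulVec p) 0 : ℝ) : UnitAddCircle) = 0 := by
    rw [Pi.sub_apply, AddCircle.coe_sub, ← (O.coord_chart hp').1, hd, (hf _).1,
      (O.coord_chart hp).1, (O.coord_chart hp).2, hA0, AddCircle.coe_add, coe_int_mul, coe_int_mul,
      sub_self]
  have h1 : (((p' - A.mulVec p) 1 : ℝ) : UnitAddCircle) = 0 := by
    rw [Pi.sub_apply, AddCircle.coe_sub, ← (O.coord_chart hp').2, hd, (hf _).2,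
      (O.coord_chart hp).1, (O.coord_chart hp).2, hA1, AddCircle.coe_add, coe_int_mul, coe_int_mul,
      sub_self]
  -- Near `p` the two sides have the same image in the torus, and both stay in a neighbourhood where
  -- that image determines the point.
  obtain ⟨W, hW, hinj⟩ := O.exists_nhds_injOn (O.chart_notMem_vertices hp')
  have e1 : ∀ᶠ q in 𝓝 p, f (O.chart c q) ∈ W :=
    (f.continuous.comp (O.continuous_chart c)).continuousAt.preimage_mem_nhds
      (by simpa [hd] using hW)
  have e2 : ∀ᶠ q in 𝓝 p, O.chart d (A.mulVec q + (p' - A.mulVec p)) ∈ W :=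
    ((O.continuous_chart d).comp hc).continuousAt.preimage_mem_nhds (by
      rw [Function.comp_apply, hcp]; exact hW)
  have e3 : ∀ᶠ q in 𝓝 p, A.mulVec q + (p' - A.mulVec p) ∈ chartDomain d :=
    hc.continuousAt.preimage_mem_nhds ((isOpen_chartDomain d).mem_nhds (by rwa [hcp]))
  filter_upwards [e1, e2, e3, (isOpen_chartDomain c).mem_nhds hp] with q i1 i2 i3 i4
  refine hinj _ i1 _ i2 ?_ ?_
  · rw [(hf _).1, (O.coord_chart i4).1, (O.coord_chart i4).2, (O.coord_chart i3).1, Pi.add_apply,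
      AddCircle.coe_add, h0, hA0, AddCircle.coe_add, coe_int_mul, coe_int_mul, add_zero]
  · rw [(hf _).2, (O.coord_chart i4).1, (O.coord_chart i4).2, (O.coord_chart i3).2, Pi.add_apply,
      AddCircle.coe_add, h1, hA1, AddCircle.coe_add, coe_int_mul, coe_int_mul, add_zero]

/-- The definition only says that non-vertices go to non-vertices, so the preimage of the vertex set
lies in the vertex set; being finite of the same cardinality, it is all of it. -/
theorem IsAffine.map_mem_vertices {f : O.Surface ≃ₜ O.Surface}
    {A : Matrix.SpecialLinearGroup (Fin 2) ℝ} (hf : O.IsAffine f A) {z : O.Surface}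
    (hz : z ∈ O.vertices) : f z ∈ O.vertices := by
  have hsub : f ⁻¹' O.vertices ⊆ O.vertices := by
    intro w hw
    by_contra hc
    obtain ⟨c, p, hp, rfl⟩ := O.exists_chart hc
    obtain ⟨d, b, hb, he⟩ := hf c p hp
    rw [mem_preimage, he.self_of_nhds] at hw
    exact O.chart_notMem_vertices hb hw
  have hcard : O.vertices.ncard ≤ (f ⁻¹' O.vertices).ncard := by
    rw [← Homeomorph.image_symm, ncard_image_of_injective _ f.symm.injective]
  exact (eq_of_subset_of_ncard_le hsub hcard O.finite_vertices).ge hz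

theorem mem_closure_strip {p : Fin 2 → ℝ} (hp : p 1 ∈ Icc (0 : ℝ) 1) :
    p ∈ closure {q : Fin 2 → ℝ | q 1 ∈ Ioo (0 : ℝ) 1} := by
  have := (isOpenMap_eval (X := fun _ : Fin 2 => ℝ) 1).preimage_closure_eq_closure_preimage
    (continuous_apply 1) (Ioo (0 : ℝ) 1)
  rw [closure_Ioo (by norm_num)] at this
  exact this.subset hp

/-- If `u` is the `l`-th coordinate modulo `1` in the charts, then on each closed horizontal strip
`u ∘ f` is the `l`-th coordinate of the linear map `A` modulo `1`, up to a constant. -/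
theorem IsAffine.exists_const {f : O.Surface ≃ₜ O.Surface}
    {A : Matrix.SpecialLinearGroup (Fin 2) ℝ} (hf : O.IsAffine f A)
    (u : C(O.Surface, UnitAddCircle)) (l : Fin 2) (hu : ∀ (c : Fin n ⊕ Fin n), ∀ p ∈ chartDomain c,
      u (O.chart c p) = (p l : UnitAddCircle)) (i : Fin n) :
    ∃ k : UnitAddCircle, ∀ p : Fin 2 → ℝ, p 1 ∈ Icc (0 : ℝ) 1 →
      u (f (O.chart (.inl i) p)) = (A.1.mulVec p l : UnitAddCircle) + k := by
  let D : (Fin 2 → ℝ) → UnitAddCircle :=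
    fun p => u (f (O.chart (.inl i) p)) - (A.1.mulVec p l : UnitAddCircle)
  have hD : Continuous D :=
    ((u.continuous.comp f.continuous).comp (O.continuous_chart _)).sub
      ((AddCircle.continuous_mk' (1 : ℝ)).comp (by fun_prop : Continuous fun p : Fin 2 → ℝ =>
        A.1.mulVec p l))
  let S : Set (Fin 2 → ℝ) := {q : Fin 2 → ℝ | q 1 ∈ Ioo (0 : ℝ) 1}
  have hS : PreconnectedSpace S := by
    refine isPreconnected_iff_preconnectedSpace.1 (Convex.isPreconnected ?_)
    exact (convex_Ioo (0 : ℝ) 1).is_linear_preimage (f := fun q : Fin 2 → ℝ => q 1)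
      ⟨fun _ _ => rfl, fun _ _ => rfl⟩
  have hlc : IsLocallyConstant fun p : S => D p := by
    rw [IsLocallyConstant.iff_eventually_eq]
    rintro ⟨p, hp⟩
    obtain ⟨d, b, hb, he⟩ := hf (.inl i) p hp
    have hc : Continuous fun q => A.1.mulVec q + b := by fun_prop
    have key : ∀ᶠ q in 𝓝 p, D q = (b l : UnitAddCircle) := by
      filter_upwards [he, hc.continuousAt.preimage_mem_nhds ((isOpen_chartDomain d).mem_nhds hb)]
        with q h1 h2
      simp only [D]
      rw [h1, hu d (A.1.mulVec q + b) h2, Pi.add_apply, AddCircle.coe_add, add_sub_cancel_left]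
    have h2 := key.self_of_nhds
    have := (continuous_subtype_val (p := fun q => q ∈ S)).tendsto ⟨p, hp⟩
    filter_upwards [this.eventually key] with q hq
    exact hq.trans h2.symm
  let p₀ : S := ⟨fun _ => 1 / 2, by norm_num [S]⟩
  refine ⟨D p₀, fun p hp => ?_⟩
  have : EqOn D (fun _ => D p₀) S := fun q hq =>
    hlc.apply_eq_of_preconnectedSpace ⟨q, hq⟩ p₀
  -- The closed strip is needed because the corners, where the constant will be evaluated, lie on
  -- its boundary.
  have := this.closure hD continuous_const (mem_closure_strip hp)
  simp only [D] at this ⊢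
  rw [← this, add_sub_cancel]

/-- Corners of squares are sent to vertices, whose coordinates vanish modulo 1. The corner (0, 0)
kills the additive constant on each strip; the corners (1, 0) and (0, 1) then show that the columns
of `A` are integral. -/
theorem IsAffine.exists_covers [NeZero n] {f : O.Surface ≃ₜ O.Surface}
    {A : Matrix.SpecialLinearGroup (Fin 2) ℝ} (hf : O.IsAffine f A) :
    ∃ M : Matrix.SpecialLinearGroup (Fin 2) ℤ, A = M.map (Int.castRingHom ℝ) ∧ O.Covers f M := by
  have hv : ∀ i : Fin n, ∀ p : Fin 2 → ℝ, (p = 0 ∨ p = ![1, 0] ∨ p = ![0, 1]) →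
      f (O.chart (.inl i) p) ∈ O.vertices := by
    intro i p hp
    apply hf.map_mem_vertices
    rw [chart_inl]
    rcases hp with rfl | rfl | rfl
    · rw [hStrip_eq_pt _ _ (by simp)]
      exact O.pt_mem_vertices i
    · rw [hStrip_eq_pt _ _ (by simp)]
      simpa [pt_right] using O.pt_mem_vertices _
    · rw [hStrip_eq_pt _ _ (by simp)]
      simpa [pt_top] using O.pt_mem_vertices _
  have key : ∀ (u : C(O.Surface, UnitAddCircle)) (l : Fin 2),
      (∀ (c : Fin n ⊕ Fin n), ∀ p ∈ chartDomain c, u (O.chart c p) = (p l : UnitAddCircle)) →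
      (∀ z ∈ O.vertices, u z = 0) → (∀ i : Fin n, ∀ p : Fin 2 → ℝ, p 1 ∈ Icc (0 : ℝ) 1 →
        u (f (O.chart (.inl i) p)) = (A.1.mulVec p l : UnitAddCircle)) ∧
        ∀ m : Fin 2, ∃ k : ℤ, (k : ℝ) = A.1 l m := by
    intro u l hu hz
    have h1 : ∀ i : Fin n, ∀ p : Fin 2 → ℝ, p 1 ∈ Icc (0 : ℝ) 1 →
        u (f (O.chart (.inl i) p)) = (A.1.mulVec p l : UnitAddCircle) := by
      intro i p hp
      obtain ⟨k, hk⟩ := hf.exists_const u l hu i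
      have h0 := hk 0 (by simp)
      rw [hz _ (hv i 0 (.inl rfl))] at h0
      have : k = 0 := by simpa using h0.symm
      rw [hk p hp, this, add_zero]
    refine ⟨h1, fun m => ?_⟩
    rw [← coe_eq_zero_iff_exists_int]
    fin_cases m
    · have := h1 0 ![1, 0] (by simp)
      rw [hz _ (hv 0 _ (.inr (.inl rfl)))] at this
      simpa [Matrix.mulVec, dotProduct, Fin.sum_univ_two] using this.symm
    · have := h1 0 ![0, 1] (by simp)
      rw [hz _ (hv 0 _ (.inr (.inr rfl)))] at this
      simpa [Matrix.mulVec, dotProduct, Fin.sum_univ_two] using this.symm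
  obtain ⟨hX, hX'⟩ := key O.coordX 0 (fun c p hp => (O.coord_chart hp).1) fun z hz => hz.1
  obtain ⟨hY, hY'⟩ := key O.coordY 1 (fun c p hp => (O.coord_chart hp).2) fun z hz => hz.2
  have hentry : ∀ l m : Fin 2, ∃ k : ℤ, (k : ℝ) = A.1 l m := by
    intro l m
    fin_cases l
    exacts [hX' m, hY' m]
  choose N hN using hentry
  have hdet : (Matrix.of N).det = 1 := by
    have := A.2
    rw [Matrix.det_fin_two] at this ⊢
    simp only [← hN] at this
    exact_mod_cast this
  refine ⟨⟨Matrix.of N, hdet⟩, ?_, ?_⟩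
  · ext l m
    exact (hN l m).symm
  · intro z
    obtain ⟨i, x, hx, y, hy, rfl⟩ := O.exists_pt z
    have h1 := hX i ![x, y] hy
    have h2 := hY i ![x, y] hy
    rw [chart_inl] at h1 h2
    simp only [Matrix.cons_val_zero, Matrix.cons_val_one, hStrip_eq_pt _ _ hx, Matrix.mulVec,
      dotProduct, Fin.sum_univ_two, ← hN, AddCircle.coe_add, coe_int_mul] at h1 h2
    simp only [Matrix.of_apply, coordX_pt _ _ hx, coordY_pt _ _ _ hy]
    exact ⟨h1, h2⟩

theorem isAutomorphism_iff_covers {f : O.Surface ≃ₜ O.Surface} :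
    O.IsAutomorphism f ↔ O.Covers f 1 := by
  simp [IsAutomorphism, Covers]

end Origami

/-! ### Explicit lifts, and the combinatorial constraint on a lift of T. -/

namespace Origami

variable {n : ℕ} (O : Origami n)

/-! ### Shears along the horizontal cylinders -/

/-- The map which is `(x, y) ↦ (x + k y, y)` in the horizontal strips. -/
def shearMap (k : ℤ) (hk : O.h ^ k = 1) : C(O.Surface, O.Surface) :=
  O.desc (fun i x y => O.hStrip i (x + k * y) y)
    (fun i => (O.continuous_hStrip i).comp
      (by fun_prop : Continuous fun q : ℝ × ℝ => (q.1 + k * q.2, q.2)))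
    (fun i y _ => by rw [add_comm 1, hStrip_add_one, zero_add])
    -- At height 1 the shear translates the strip by `k`, which is trivial since `h ^ k = 1`; hence
    -- it matches the identity on the bottom side above.
    (fun i x hx => by
      rw [mul_one, hStrip_add_int, hk, hStrip_eq_pt _ _ hx, mul_zero, add_zero,
        hStrip_eq_pt _ _ hx]
      exact O.pt_top i x)

theorem shearMap_hStrip (k : ℤ) (hk : O.h ^ k = 1) (i : Fin n) (x : ℝ) {y : ℝ}
    (hy : y ∈ Icc (0 : ℝ) 1) : O.shearMap k hk (O.hStrip i x y) = O.hStrip i (x + k * y) y := by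
  rw [hStrip, shearMap, desc_pt _ _ _ _ _ (fract_mem_Icc x) hy, ← hStrip_add_int]
  congr 1
  linarith [Int.self_sub_floor x]

theorem shearMap_pt (k : ℤ) (hk : O.h ^ k = 1) (i : Fin n) {x y : ℝ} (hx : x ∈ Icc (0 : ℝ) 1)
    (hy : y ∈ Icc (0 : ℝ) 1) : O.shearMap k hk (O.pt i x y) = O.hStrip i (x + k * y) y := by
  rw [← hStrip_eq_pt _ _ hx, shearMap_hStrip _ _ _ _ _ hy]

theorem shearMap_shearMap (k l : ℤ) (hk : O.h ^ k = 1) (hl : O.h ^ l = 1) (hkl : k + l = 0)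
    (z : O.Surface) : O.shearMap l hl (O.shearMap k hk z) = z := by
  obtain ⟨i, x, hx, y, hy, rfl⟩ := O.exists_pt z
  rw [shearMap_pt _ _ _ _ hx hy, shearMap_hStrip _ _ _ _ _ hy, ← hStrip_eq_pt _ _ hx]
  congr 1
  have : (k : ℝ) + l = 0 := by exact_mod_cast hkl
  linear_combination y * this

/-- The affine multi-twist which is `(x, y) ↦ (x + k y, y)` in the horizontal strips. -/
def shear (k : ℤ) (hk : O.h ^ k = 1) : O.Surface ≃ₜ O.Surface where
  toFun := O.shearMap k hk
  invFun := O.shearMap (-k) (by rw [zpow_neg, hk, inv_one])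
  left_inv := O.shearMap_shearMap _ _ _ _ (by ring)
  right_inv := O.shearMap_shearMap _ _ _ _ (by ring)
  continuous_toFun := (O.shearMap k hk).continuous
  continuous_invFun := (O.shearMap (-k) _).continuous

theorem shear_pt (k : ℤ) (hk : O.h ^ k = 1) (i : Fin n) {x y : ℝ} (hx : x ∈ Icc (0 : ℝ) 1)
    (hy : y ∈ Icc (0 : ℝ) 1) : O.shear k hk (O.pt i x y) = O.hStrip i (x + k * y) y :=
  O.shearMap_pt k hk i hx hy

theorem covers_shear (k : ℤ) (hk : O.h ^ k = 1) :
    O.Covers (O.shear k hk) ⟨!![1, k; 0, 1], by simp [Matrix.det_fin_two]⟩ := by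
  intro z
  obtain ⟨i, x, hx, y, hy, rfl⟩ := O.exists_pt z
  rw [shear_pt _ _ _ _ hx hy, coordX_hStrip, coordY_hStrip _ _ _ hy, coordX_pt _ _ hx,
    coordY_pt _ _ _ hy, AddCircle.coe_add, coe_int_mul]
  simp

/-! ### Affine homeomorphisms of order six up to automorphisms -/

section Turn

variable (φ : Equiv.Perm (Fin n)) (hh : ∀ i, O.v (φ (O.h i)) = O.h (φ i))
  (hv : ∀ i, φ (O.v i) = O.h (φ i))

/-- The map which is `(x, y) ↦ (x + y, 1 - x)` from square `i` to the strip of square `φ i`. -/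
def turnMap (φ : Equiv.Perm (Fin n)) (hh : ∀ i, O.v (φ (O.h i)) = O.h (φ i))
    (hv : ∀ i, φ (O.v i) = O.h (φ i)) : C(O.Surface, O.Surface) :=
  O.desc (fun i x y => O.hStrip (φ i) (x + y) (1 - x))
    (fun i => (O.continuous_hStrip _).comp
      (by fun_prop : Continuous fun q : ℝ × ℝ => (q.1 + q.2, 1 - q.1)))
    -- The right side of square `i` goes to the bottom of `h (φ i)`, and the left side of `h i` to
    -- the top of `φ (h i)`: this is condition `hh`. Crossing a top side advances one square along
    -- the image strip: this is `hv`.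
    (fun i y hy => by
      rw [add_comm 1, hStrip_add_one, zero_add, sub_self, sub_zero, hStrip_eq_pt _ _ hy,
        hStrip_eq_pt _ _ hy, pt_top, hh])
    (fun i x _ => by rw [hStrip_add_one, add_zero, hv])

/-- The inverse of `turnMap`. -/
def turnInv (φ : Equiv.Perm (Fin n)) (hh : ∀ i, O.v (φ (O.h i)) = O.h (φ i))
    (hv : ∀ i, φ (O.v i) = O.h (φ i)) : C(O.Surface, O.Surface) :=
  O.desc (fun j x y => O.vStrip (φ.symm j) (1 - y) (x + y - 1))
    (fun j => (O.continuous_vStrip _).comp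
      (by fun_prop : Continuous fun q : ℝ × ℝ => (1 - q.2, q.1 + q.2 - 1)))
    (fun j y _ => by
      obtain ⟨i, rfl⟩ := φ.surjective j
      rw [← hv, Equiv.symm_apply_apply, Equiv.symm_apply_apply, ← vStrip_add_one]
      congr 1; ring)
    (fun j x hx => by
      obtain ⟨i, rfl⟩ := φ.surjective j
      obtain ⟨i, rfl⟩ := O.h.surjective i
      rw [hh, ← hv, Equiv.symm_apply_apply, Equiv.symm_apply_apply, ← vStrip_add_one,
        vStrip_eq_pt _ _ _ (by simpa using hx), vStrip_eq_pt _ _ _ (by simpa using hx)]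
      simp [pt_right])

/-- By `hv`, the relabelling turns powers of `v` into powers of `h`, so the formula on one square
persists along the whole vertical strip. -/
theorem turnMap_vStrip (i : Fin n) {x : ℝ} (hx : x ∈ Icc (0 : ℝ) 1) (y : ℝ) :
    O.turnMap φ hh hv (O.vStrip i x y) = O.hStrip (φ i) (x + y) (1 - x) := by
  have hpow : φ ((O.v ^ ⌊y⌋) i) = (O.h ^ ⌊y⌋) (φ i) := by
    have : φ * O.v = O.h * φ := Equiv.ext hv
    exact congrArg (· i) (SemiconjBy.zpow_right (a := φ) this ⌊y⌋)
  rw [vStrip, turnMap, desc_pt _ _ _ _ _ hx (fract_mem_Icc y), hpow, ← hStrip_add_int]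
  congr 1
  linarith [Int.self_sub_floor y]

theorem turnInv_hStrip (j : Fin n) (x : ℝ) {y : ℝ} (hy : y ∈ Icc (0 : ℝ) 1) :
    O.turnInv φ hh hv (O.hStrip j x y) = O.vStrip (φ.symm j) (1 - y) (x + y - 1) := by
  have hpow : φ.symm ((O.h ^ ⌊x⌋) j) = (O.v ^ ⌊x⌋) (φ.symm j) := by
    have : φ * O.v = O.h * φ := Equiv.ext hv
    have := congrArg (· (φ.symm j)) (SemiconjBy.zpow_right (a := φ) this ⌊x⌋)
    simp only [Equiv.Perm.mul_apply, Equiv.apply_symm_apply] at this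
    rw [← this, Equiv.symm_apply_apply]
  rw [hStrip, turnInv, desc_pt _ _ _ _ _ (fract_mem_Icc x) hy, hpow, ← vStrip_add_int]
  congr 1
  linarith [Int.self_sub_floor x]

theorem turnMap_pt (i : Fin n) {x y : ℝ} (hx : x ∈ Icc (0 : ℝ) 1) (hy : y ∈ Icc (0 : ℝ) 1) :
    O.turnMap φ hh hv (O.pt i x y) = O.hStrip (φ i) (x + y) (1 - x) :=
  O.desc_pt _ _ _ i hx hy

theorem one_sub_mem_Icc {x : ℝ} (hx : x ∈ Icc (0 : ℝ) 1) : 1 - x ∈ Icc (0 : ℝ) 1 :=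
  ⟨by linarith [hx.2], by linarith [hx.1]⟩

/-- The affine homeomorphism which is `(x, y) ↦ (x + y, 1 - x)` from square `i` to the strip of
square `φ i`. -/
def turn (φ : Equiv.Perm (Fin n)) (hh : ∀ i, O.v (φ (O.h i)) = O.h (φ i))
    (hv : ∀ i, φ (O.v i) = O.h (φ i)) : O.Surface ≃ₜ O.Surface where
  toFun := O.turnMap φ hh hv
  invFun := O.turnInv φ hh hv
  left_inv z := by
    obtain ⟨i, x, hx, y, hy, rfl⟩ := O.exists_pt z
    rw [turnMap_pt _ _ _ _ _ hx hy, turnInv_hStrip _ _ _ _ _ _ (one_sub_mem_Icc hx),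
      Equiv.symm_apply_apply, ← vStrip_eq_pt _ _ _ hy]
    congr 1 <;> ring
  right_inv z := by
    obtain ⟨i, x, hx, y, hy, rfl⟩ := O.exists_pt z
    rw [← hStrip_eq_pt _ _ hx, turnInv_hStrip _ _ _ _ _ _ hy,
      turnMap_vStrip _ _ _ _ _ (one_sub_mem_Icc hy), Equiv.apply_symm_apply]
    congr 1 <;> ring
  continuous_toFun := (O.turnMap φ hh hv).continuous
  continuous_invFun := (O.turnInv φ hh hv).continuous

theorem turn_pt (i : Fin n) {x y : ℝ} (hx : x ∈ Icc (0 : ℝ) 1) (hy : y ∈ Icc (0 : ℝ) 1) :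
    O.turn φ hh hv (O.pt i x y) = O.hStrip (φ i) (x + y) (1 - x) :=
  O.turnMap_pt φ hh hv i hx hy

theorem covers_turn :
    O.Covers (O.turn φ hh hv) ⟨!![1, 1; -1, 0], by simp [Matrix.det_fin_two]⟩ := by
  intro z
  obtain ⟨i, x, hx, y, hy, rfl⟩ := O.exists_pt z
  rw [turn_pt _ _ _ _ _ hx hy, coordX_hStrip, coordY_hStrip _ _ _ (one_sub_mem_Icc hx),
    coordX_pt _ _ hx, coordY_pt _ _ _ hy, AddCircle.coe_add, AddCircle.coe_sub]
  simp

end Turn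

/-! ### Lifting the unit square -/

/-- A map from the unit square that lifts the projection to the torus is one of the squares, on the
interior. -/
theorem exists_eq_pt_of_lift (c : C(ℝ × ℝ, O.Surface))
    (hc : ∀ x ∈ Ioo (0 : ℝ) 1, ∀ y ∈ Ioo (0 : ℝ) 1,
      O.coordX (c (x, y)) = (x : UnitAddCircle) ∧ O.coordY (c (x, y)) = (y : UnitAddCircle)) :
    ∃ j, ∀ x ∈ Ioo (0 : ℝ) 1, ∀ y ∈ Ioo (0 : ℝ) 1, c (x, y) = O.pt j x y := by
  have hex : ∀ x ∈ Ioo (0 : ℝ) 1, ∀ y ∈ Ioo (0 : ℝ) 1, ∃ j, c (x, y) = O.pt j x y := by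
    intro x hx y hy
    obtain ⟨j, x', hx', y', hy', h⟩ := O.exists_pt (c (x, y))
    obtain ⟨h1, h2⟩ := hc x hx y hy
    rw [← h, coordX_pt _ _ hx'] at h1
    rw [← h, coordY_pt _ _ _ hy'] at h2
    refine ⟨j, ?_⟩
    rw [← h, eq_of_coe_eq_of_mem_Ioo h1.symm hx hx', eq_of_coe_eq_of_mem_Ioo h2.symm hy hy']
  let S : Set (ℝ × ℝ) := Ioo (0 : ℝ) 1 ×ˢ Ioo (0 : ℝ) 1
  have hS : PreconnectedSpace S :=
    isPreconnected_iff_preconnectedSpace.1 (isPreconnected_Ioo.prod isPreconnected_Ioo)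
  have hhalf : (1 / 2 : ℝ) ∈ Ioo (0 : ℝ) 1 := by norm_num
  have : Nonempty (Fin n) := (hex _ hhalf _ hhalf).nonempty
  choose! J hJ using hex
  -- The bump of the square `J x y` remains nonzero at nearby points, and it is nonzero only inside
  -- that square.
  have hlc : IsLocallyConstant fun p : S => J p.1.1 p.1.2 := by
    rw [IsLocallyConstant.iff_eventually_eq]
    rintro ⟨⟨x, y⟩, hx, hy⟩
    have hne : O.squareBump (J x y) (c (x, y)) ≠ 0 := by
      rw [hJ x hx y hy]
      exact O.squareBump_pt_ne_zero _ hx hy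
    have hcont : Continuous fun p : S => O.squareBump (J x y) (c p.1) := by fun_prop
    filter_upwards [hcont.continuousAt.preimage_mem_nhds (isOpen_compl_singleton.mem_nhds hne)]
    rintro ⟨⟨x', y'⟩, hx', hy'⟩ h
    rw [mem_preimage, mem_compl_singleton_iff, hJ x' hx' y' hy'] at h
    exact (O.of_squareBump_ne_zero (Ioo_subset_Icc_self hx') (Ioo_subset_Icc_self hy') h).1
  refine ⟨J (1 / 2) (1 / 2), fun x hx y hy => ?_⟩
  rw [hJ x hx y hy]
  congr 1
  exact hlc.apply_eq_of_preconnectedSpace ⟨(x, y), hx, hy⟩ ⟨(1 / 2, 1 / 2), hhalf, hhalf⟩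

theorem half_mem_Ioo : (1 / 2 : ℝ) ∈ Ioo (0 : ℝ) 1 := by norm_num

/-- The common point is interior to the left side of some square `k`. Its `leftBump` is nonzero near
that point; approaching from `x < 1` inside `j` forces `h j = k`, and approaching from `x > 0`
inside `j'` forces `j' = k`. -/
theorem glue_right_of_lift {c c' : C(ℝ × ℝ, O.Surface)} {j j' : Fin n}
    (hj : ∀ x ∈ Ioo (0 : ℝ) 1, ∀ y ∈ Ioo (0 : ℝ) 1, c (x, y) = O.pt j x y)
    (hj' : ∀ x ∈ Ioo (0 : ℝ) 1, ∀ y ∈ Ioo (0 : ℝ) 1, c' (x, y) = O.pt j' x y)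
    (hX : O.coordX (c' (0, 1 / 2)) = 0)
    (hY : O.coordY (c' (0, 1 / 2)) = ((1 / 2 : ℝ) : UnitAddCircle))
    (h : c (1, 1 / 2) = c' (0, 1 / 2)) : O.h j = j' := by
  obtain ⟨k, hk⟩ : ∃ k, c' (0, 1 / 2) = O.pt k 0 (1 / 2) := by
    obtain ⟨k, x, hx, y, hy, hz⟩ := O.exists_pt (c' (0, 1 / 2))
    rw [← hz, coordX_pt _ _ hx] at hX
    rw [← hz, coordY_pt _ _ _ hy] at hY
    rw [← hz, ← eq_of_coe_eq_of_mem_Ioo hY.symm half_mem_Ioo hy]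
    rcases eq_zero_or_one_of_coe_eq_zero hX hx with rfl | rfl
    · exact ⟨k, rfl⟩
    · exact ⟨O.h k, O.pt_right _ _⟩
  have hne : O.leftBump k (c' (0, 1 / 2)) ≠ 0 := hk ▸ O.leftBump_pt_ne_zero k half_mem_Ioo
  have hne' : O.leftBump k (c (1, 1 / 2)) ≠ 0 := h ▸ hne
  have e1 : ∀ᶠ x in 𝓝[<] (1 : ℝ), O.leftBump k (c (x, 1 / 2)) ≠ 0 :=
    nhdsWithin_le_nhds ((by fun_prop : Continuous fun x : ℝ =>
      O.leftBump k (c (x, 1 / 2))).continuousAt.eventually_ne hne')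
  have e2 : ∀ᶠ x in 𝓝[>] (0 : ℝ), O.leftBump k (c' (x, 1 / 2)) ≠ 0 :=
    nhdsWithin_le_nhds ((by fun_prop : Continuous fun x : ℝ =>
      O.leftBump k (c' (x, 1 / 2))).continuousAt.eventually_ne hne)
  obtain ⟨x, hx, hx1, hx2⟩ := (e1.and (Ioo_mem_nhdsLT (by norm_num : (1 / 2 : ℝ) < 1))).exists
  obtain ⟨x', hx', hx1', hx2'⟩ := (e2.and (Ioo_mem_nhdsGT (by norm_num : (0 : ℝ) < 1 / 2))).exists
  rw [hj x ⟨by linarith, hx2⟩ _ half_mem_Ioo] at hx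
  rw [hj' x' ⟨hx1', by linarith⟩ _ half_mem_Ioo] at hx'
  obtain ⟨⟨-, h1⟩ | ⟨h1, -⟩, -⟩ := O.of_leftBump_ne_zero ⟨by linarith, hx2.le⟩
    (Ioo_subset_Icc_self half_mem_Ioo) hx
  · linarith
  obtain ⟨⟨h2, -⟩ | ⟨-, h2⟩, -⟩ := O.of_leftBump_ne_zero ⟨hx1'.le, by linarith⟩
    (Ioo_subset_Icc_self half_mem_Ioo) hx'
  · rw [h1, h2]
  · linarith

theorem glue_top_of_lift {c c' : C(ℝ × ℝ, O.Surface)} {j j' : Fin n}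
    (hj : ∀ x ∈ Ioo (0 : ℝ) 1, ∀ y ∈ Ioo (0 : ℝ) 1, c (x, y) = O.pt j x y)
    (hj' : ∀ x ∈ Ioo (0 : ℝ) 1, ∀ y ∈ Ioo (0 : ℝ) 1, c' (x, y) = O.pt j' x y)
    (hX : O.coordX (c' (1 / 2, 0)) = ((1 / 2 : ℝ) : UnitAddCircle))
    (hY : O.coordY (c' (1 / 2, 0)) = 0)
    (h : c (1 / 2, 1) = c' (1 / 2, 0)) : O.v j = j' := by
  obtain ⟨k, hk⟩ : ∃ k, c' (1 / 2, 0) = O.pt k (1 / 2) 0 := by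
    obtain ⟨k, x, hx, y, hy, hz⟩ := O.exists_pt (c' (1 / 2, 0))
    rw [← hz, coordX_pt _ _ hx] at hX
    rw [← hz, coordY_pt _ _ _ hy] at hY
    rw [← hz, ← eq_of_coe_eq_of_mem_Ioo hX.symm half_mem_Ioo hx]
    rcases eq_zero_or_one_of_coe_eq_zero hY hy with rfl | rfl
    · exact ⟨k, rfl⟩
    · exact ⟨O.v k, O.pt_top _ _⟩
  have hne : O.bottomBump k (c' (1 / 2, 0)) ≠ 0 := hk ▸ O.bottomBump_pt_ne_zero k half_mem_Ioo
  have hne' : O.bottomBump k (c (1 / 2, 1)) ≠ 0 := h ▸ hne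
  have e1 : ∀ᶠ y in 𝓝[<] (1 : ℝ), O.bottomBump k (c (1 / 2, y)) ≠ 0 :=
    nhdsWithin_le_nhds ((by fun_prop : Continuous fun y : ℝ =>
      O.bottomBump k (c (1 / 2, y))).continuousAt.eventually_ne hne')
  have e2 : ∀ᶠ y in 𝓝[>] (0 : ℝ), O.bottomBump k (c' (1 / 2, y)) ≠ 0 :=
    nhdsWithin_le_nhds ((by fun_prop : Continuous fun y : ℝ =>
      O.bottomBump k (c' (1 / 2, y))).continuousAt.eventually_ne hne)
  obtain ⟨y, hy, hy1, hy2⟩ := (e1.and (Ioo_mem_nhdsLT (by norm_num : (1 / 2 : ℝ) < 1))).exists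
  obtain ⟨y', hy', hy1', hy2'⟩ := (e2.and (Ioo_mem_nhdsGT (by norm_num : (0 : ℝ) < 1 / 2))).exists
  rw [hj _ half_mem_Ioo y ⟨by linarith, hy2⟩] at hy
  rw [hj' _ half_mem_Ioo y' ⟨hy1', by linarith⟩] at hy'
  obtain ⟨⟨-, h1⟩ | ⟨h1, -⟩, -⟩ := O.of_bottomBump_ne_zero
    (Ioo_subset_Icc_self half_mem_Ioo) ⟨by linarith, hy2.le⟩ hy
  · linarith
  obtain ⟨⟨h2, -⟩ | ⟨-, h2⟩, -⟩ := O.of_bottomBump_ne_zero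
    (Ioo_subset_Icc_self half_mem_Ioo) ⟨hy1'.le, by linarith⟩ hy'
  · rw [h1, h2]
  · linarith

/-- An affine homeomorphism covering the unit horizontal shear intertwines the permutations. -/
theorem Covers.exists_intertwine_of_shear {O : Origami n} {f : O.Surface ≃ₜ O.Surface}
    {M : Matrix.SpecialLinearGroup (Fin 2) ℤ} (hM : M.1 = !![1, 1; 0, 1]) (hf : O.Covers f M) :
    ∃ φ : Fin n → Fin n, (∀ i, O.h (φ i) = φ (O.h i)) ∧
      ∀ i, O.v (φ (O.h i)) = φ (O.v i) := by
  -- Precomposing with the inverse shear makes `c i` a lift of the unit square, so its interior is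
  -- carried onto one square `φ i`. The parallelogram of `h i` has its top along the top side of
  -- square `i`, whence the form of the second relation.
  let c : Fin n → C(ℝ × ℝ, O.Surface) := fun i =>
    ⟨fun q => f (O.hStrip i (q.1 - q.2) q.2), f.continuous.comp ((O.continuous_hStrip i).comp
      (by fun_prop : Continuous fun q : ℝ × ℝ => (q.1 - q.2, q.2)))⟩
  have hc : ∀ i x, ∀ y ∈ Icc (0 : ℝ) 1, O.coordX (c i (x, y)) = (x : UnitAddCircle) ∧
      O.coordY (c i (x, y)) = (y : UnitAddCircle) := by
    intro i x y hy
    change O.coordX (f _) = _ ∧ O.coordY (f _) = _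
    rw [(hf _).1, (hf _).2, coordX_hStrip, coordY_hStrip _ _ _ hy, hM]
    simp
  have hex : ∀ i, ∃ j, ∀ x ∈ Ioo (0 : ℝ) 1, ∀ y ∈ Ioo (0 : ℝ) 1, c i (x, y) = O.pt j x y :=
    fun i => O.exists_eq_pt_of_lift (c i) fun x _ y hy => hc i x y (Ioo_subset_Icc_self hy)
  choose φ hφ using hex
  have hhalf := Ioo_subset_Icc_self half_mem_Ioo
  refine ⟨φ, fun i => ?_, fun i => ?_⟩
  · obtain ⟨h1, h2⟩ := hc (O.h i) 0 (1 / 2) hhalf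
    refine O.glue_right_of_lift (hφ i) (hφ (O.h i)) (by simpa using h1) h2 ?_
    change f (O.hStrip i (1 - 1 / 2) (1 / 2)) = f (O.hStrip (O.h i) (0 - 1 / 2) (1 / 2))
    rw [← hStrip_add_one]
    norm_num
  · obtain ⟨h1, h2⟩ := hc (O.v i) (1 / 2) 0 (by simp)
    refine O.glue_top_of_lift (hφ (O.h i)) (hφ (O.v i)) h1 (by simpa using h2) ?_
    change f (O.hStrip (O.h i) (1 / 2 - 1) 1) = f (O.hStrip (O.v i) (1 / 2 - 0) 0)
    rw [← hStrip_add_one, sub_add_cancel, sub_zero, hStrip_eq_pt _ _ hhalf, hStrip_eq_pt _ _ hhalf,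
      pt_top]

end Origami

/-! ### A subgroup of index four of the modular group -/

namespace ModularSubgroup

open Matrix.SpecialLinearGroup

/-- The parabolic generator of `SL(2, ℤ)`. -/
def T : Matrix.SpecialLinearGroup (Fin 2) ℤ := ⟨!![1, 1; 0, 1], by decide⟩

/-- An element of order six of `SL(2, ℤ)`. -/
def U : Matrix.SpecialLinearGroup (Fin 2) ℤ := ⟨!![1, 1; -1, 0], by decide⟩

/-- The subgroup generated by `T³` and `U`. -/
def Γ : Subgroup (Matrix.SpecialLinearGroup (Fin 2) ℤ) := Subgroup.closure {T ^ 3, U}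

theorem closure_T_U : Subgroup.closure {T, U} = ⊤ := by
  rw [eq_top_iff, ← SpecialLinearGroup.SL2Z_generators, Subgroup.closure_le]
  have hT : T ∈ Subgroup.closure {T, U} := Subgroup.subset_closure (by simp)
  have hU : U ∈ Subgroup.closure {T, U} := Subgroup.subset_closure (by simp)
  rintro _ (rfl | rfl)
  · have : ModularGroup.S = U⁻¹ * T⁻¹ := Subtype.ext (by decide)
    rw [this]
    exact mul_mem (inv_mem hU) (inv_mem hT)
  · exact hT

theorem T_pow_three_mem : T ^ 3 ∈ Γ := Subgroup.subset_closure (by simp)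

theorem U_mem : U ∈ Γ := Subgroup.subset_closure (by simp)

/-- `Γ` has two double cosets. -/
theorem mem_or_exists_mul_T_mul (A : Matrix.SpecialLinearGroup (Fin 2) ℤ) :
    A ∈ Γ ∨ ∃ γ ∈ Γ, ∃ γ' ∈ Γ, A = γ * T * γ' := by
  have h3 := T_pow_three_mem
  have hU := U_mem
  -- The cosets Γ, ΓT, ΓTU, ΓTU² are permuted by right multiplication: T cycles the first three and
  -- fixes the last, while U fixes Γ and cycles the others because U³ = -1 is central. Each case
  -- below is one explicit matrix identity.
  suffices h : A ∈ Γ ∨ ∃ γ ∈ Γ, A = γ * T ∨ A = γ * (T * U) ∨ A = γ * (T * U ^ 2) by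
    rcases h with h | ⟨γ, hγ, h | h | h⟩
    · exact .inl h
    · exact .inr ⟨γ, hγ, 1, one_mem _, by rw [h, mul_one]⟩
    · exact .inr ⟨γ, hγ, U, hU, by rw [h, mul_assoc]⟩
    · exact .inr ⟨γ, hγ, U ^ 2, pow_mem hU 2, by rw [h, mul_assoc]⟩
  have hA : A ∈ Subgroup.closure {T, U} := closure_T_U ▸ Subgroup.mem_top A
  induction hA using Subgroup.closure_induction_right with
  | one => exact .inl (one_mem _)
  | mul_right x hx y hy ih =>
    rcases hy with rfl | rfl
    · rcases ih with h | ⟨γ, hγ, rfl | rfl | rfl⟩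
      · exact .inr ⟨x, h, .inl rfl⟩
      · refine .inr ⟨γ * (T ^ 3 * U ^ 4), mul_mem hγ (mul_mem h3 (pow_mem hU 4)), .inr (.inl ?_)⟩
        rw [mul_assoc, mul_assoc γ]
        exact congrArg _ (Subtype.ext (by decide))
      · refine .inl ?_
        have : γ * (T * U) * T = γ * U ^ 2 := by
          rw [mul_assoc]
          exact congrArg _ (Subtype.ext (by decide))
        exact this ▸ mul_mem hγ (pow_mem hU 2)
      · refine .inr ⟨γ * (U ^ 2 * (T ^ 3)⁻¹), mul_mem hγ (mul_mem (pow_mem hU 2) (inv_mem h3)),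
          .inr (.inr ?_)⟩
        rw [mul_assoc, mul_assoc γ]
        exact congrArg _ (Subtype.ext (by decide))
    · rcases ih with h | ⟨γ, hγ, rfl | rfl | rfl⟩
      · exact .inl (mul_mem h hU)
      · exact .inr ⟨γ, hγ, .inr (.inl (mul_assoc _ _ _))⟩
      · exact .inr ⟨γ, hγ, .inr (.inr (by rw [mul_assoc, mul_assoc, sq]))⟩
      · refine .inr ⟨γ * U ^ 3, mul_mem hγ (pow_mem hU 3), .inl ?_⟩
        rw [mul_assoc, mul_assoc γ]
        exact congrArg _ (Subtype.ext (by decide))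
  | mul_inv_cancel x hx y hy ih =>
    rcases hy with rfl | rfl
    · rcases ih with h | ⟨γ, hγ, rfl | rfl | rfl⟩
      · refine .inr ⟨x * (U ^ 2)⁻¹, mul_mem h (inv_mem (pow_mem hU 2)), .inr (.inl ?_)⟩
        rw [mul_assoc x]
        exact congrArg _ (Subtype.ext (by decide))
      · exact .inl (by simpa using hγ)
      · refine .inr ⟨γ * (U ^ 2 * (T ^ 3)⁻¹), mul_mem hγ (mul_mem (pow_mem hU 2) (inv_mem h3)),
          .inl ?_⟩
        rw [mul_assoc, mul_assoc γ]
        exact congrArg _ (Subtype.ext (by decide))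
      · refine .inr ⟨γ * (T ^ 3 * (U ^ 2)⁻¹), mul_mem hγ (mul_mem h3 (inv_mem (pow_mem hU 2))),
          .inr (.inr ?_)⟩
        rw [mul_assoc, mul_assoc γ]
        exact congrArg _ (Subtype.ext (by decide))
    · rcases ih with h | ⟨γ, hγ, rfl | rfl | rfl⟩
      · exact .inl (mul_mem h (inv_mem hU))
      · refine .inr ⟨γ * (U ^ 3)⁻¹, mul_mem hγ (inv_mem (pow_mem hU 3)), .inr (.inr ?_)⟩
        rw [mul_assoc, mul_assoc γ]
        exact congrArg _ (Subtype.ext (by decide))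
      · exact .inr ⟨γ, hγ, .inl (by group)⟩
      · exact .inr ⟨γ, hγ, .inr (.inl (by group))⟩

end ModularSubgroup

/-! ### The Veech group of the octahedral origami -/

namespace Octahedron

open Origami

/-- The relabelling of the squares under an affine homeomorphism with derivative `S⁻¹T`. -/
def turnPerm : Equiv.Perm (Fin 12) :=
  ⟨![0, 10, 5, 1, 4, 7, 2, 6, 11, 3, 9, 8], ![0, 3, 6, 9, 4, 2, 7, 5, 11, 10, 1, 8],
    by decide, by decide⟩

/-- Together with `turnPerm_v` this determines `turnPerm` from its value at `0`, since `h` and `v`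
act transitively on the squares. -/
theorem turnPerm_h : ∀ i, O.v (turnPerm (O.h i)) = O.h (turnPerm i) := by decide

theorem turnPerm_v : ∀ i, turnPerm (O.v i) = O.h (turnPerm i) := by decide

theorem h_zpow_three : O.h ^ (3 : ℤ) = 1 := Equiv.ext fun i => h_pow i

/-- The affine multi-twist with derivative `T³`. -/
def affT3 : O.Surface ≃ₜ O.Surface := O.shear 3 h_zpow_three

/-- An affine homeomorphism with derivative `S⁻¹T`. -/
def affSinvT : O.Surface ≃ₜ O.Surface := O.turn turnPerm turnPerm_h turnPerm_v

theorem covers_affT3 : O.Covers affT3 (ModularSubgroup.T ^ 3) := by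
  have : ModularSubgroup.T ^ 3 = ⟨!![1, (3 : ℤ); 0, 1], by simp [Matrix.det_fin_two]⟩ :=
    Subtype.ext (by decide)
  rw [this]
  exact O.covers_shear 3 h_zpow_three

theorem covers_affSinvT : O.Covers affSinvT ModularSubgroup.U :=
  O.covers_turn turnPerm turnPerm_h turnPerm_v

/-- A lift of T would give a map φ of the squares with (vh)φ = φv. As (vh)² = 1, φ is invariant
under v², hence under v because v³ = 1. Then φ 0 is fixed by vh, which has no fixed point. -/
theorem not_covers_T (f : O.Surface ≃ₜ O.Surface) : ¬ O.Covers f ModularSubgroup.T := by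
  intro hf
  obtain ⟨φ, h1, h2⟩ := hf.exists_intertwine_of_shear rfl
  have e1 : ∀ i, O.v (O.h (φ i)) = φ (O.v i) := fun i => by rw [h1, h2]
  have e2 : ∀ i, O.v (O.h (O.v (O.h i))) = i := by decide
  have e3 : ∀ i, O.v (O.v (O.v i)) = i := by decide
  have e4 : ∀ i, O.v (O.h i) ≠ i := by decide
  have e5 : ∀ i, φ (O.v (O.v i)) = φ i := fun i => by rw [← e1, ← e1, e2]
  have e6 : φ (O.v 0) = φ 0 := by
    rw [← e5 (O.v 0), e3]
  exact e4 (φ 0) (by rw [e1, e6])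

/-- If M = γTγ', composing `f` with inverses of lifts of γ and γ' would give a lift of T. -/
theorem mem_Γ_of_covers {f : O.Surface ≃ₜ O.Surface} {M : Matrix.SpecialLinearGroup (Fin 2) ℤ}
    (hf : O.Covers f M) (hΓ : ∀ γ ∈ ModularSubgroup.Γ, ∃ g, O.Covers g γ) :
    M ∈ ModularSubgroup.Γ := by
  rcases ModularSubgroup.mem_or_exists_mul_T_mul M with h | ⟨γ, hγ, γ', hγ', rfl⟩
  · exact h
  · obtain ⟨g, hg⟩ := hΓ _ hγ
    obtain ⟨g', hg'⟩ := hΓ _ hγ'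
    have := (hg'.symm.trans hf).trans hg.symm
    rw [show γ⁻¹ * (γ * ModularSubgroup.T * γ' * γ'⁻¹) = ModularSubgroup.T by group] at this
    exact absurd this (not_covers_T _)

theorem map_T : ModularSubgroup.T.map (Int.castRingHom ℝ) = T := by
  apply Subtype.ext
  rw [Matrix.SpecialLinearGroup.coe_matrix_coe]
  ext i j
  fin_cases i <;> fin_cases j <;> simp [ModularSubgroup.T, T]

theorem map_U : ModularSubgroup.U.map (Int.castRingHom ℝ) = S⁻¹ * T := by
  apply Subtype.ext
  rw [Matrix.SpecialLinearGroup.coe_matrix_coe, Matrix.SpecialLinearGroup.coe_mul,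
    Matrix.SpecialLinearGroup.coe_inv]
  ext i j
  fin_cases i <;> fin_cases j <;>
    simp [ModularSubgroup.U, T, S, Matrix.adjugate_fin_two]

theorem map_Γ : ModularSubgroup.Γ.map (Matrix.SpecialLinearGroup.map (Int.castRingHom ℝ)) =
    Subgroup.closure {T ^ 3, S⁻¹ * T} := by
  rw [ModularSubgroup.Γ, MonoidHom.map_closure, image_pair, map_pow, map_T, map_U]

end Octahedron

/-! ### Singular 1-chains modulo boundaries, periods, and generation of H₁ from an open cover. -/

namespace Sing

variable {X Y Z : Type} [TopologicalSpace X] [TopologicalSpace Y] [TopologicalSpace Z]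

/-! ### One-chains modulo boundaries -/

/-- Singular 1-chains modulo boundaries. -/
abbrev ChainClass (X : Type) [TopologicalSpace X] : Type := Chain 1 X ⧸ LinearMap.range (bd2 X)

/-- The class of a singular 1-simplex modulo boundaries. -/
def cls (s : Simplex 1 X) : ChainClass X :=
  (LinearMap.range (bd2 X)).mkQ (Finsupp.single s 1)

/-- The inclusion of `H₁` into the 1-chains modulo boundaries. -/
def toChainClass (X : Type) [TopologicalSpace X] : H1 X →ₗ[ℝ] ChainClass X :=
  Submodule.mapQ _ _ (Cycles X).subtype fun _ hc => hc

/-- This lets identities in H₁ be checked on single simplices, such as sides of squares, that are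
not cycles. -/
theorem toChainClass_injective : Function.Injective (toChainClass X) := by
  rw [injective_iff_map_eq_zero]
  intro γ hγ
  obtain ⟨c, rfl⟩ := Submodule.Quotient.mk_surjective _ γ
  have h : c.1 ∈ LinearMap.range (bd2 X) := (Submodule.Quotient.mk_eq_zero _).1 hγ
  exact (Submodule.Quotient.mk_eq_zero _).2 h

theorem chain_ext {M : Type*} [AddCommGroup M] [Module ℝ M] {φ ψ : ChainClass X →ₗ[ℝ] M}
    (h : ∀ s, φ (cls s) = ψ (cls s)) : φ = ψ := by
  apply Submodule.linearMap_qext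
  ext s
  exact h s

/-- Push-forward of 1-chains modulo boundaries. -/
def chainClassMap (f : C(X, Y)) : ChainClass X →ₗ[ℝ] ChainClass Y :=
  Submodule.mapQ _ _ (chainMap 1 f) (by
    rintro _ ⟨d, rfl⟩
    exact ⟨chainMap 2 f d, boundary_chainMap 1 f d⟩)

theorem chainClassMap_cls (f : C(X, Y)) (s : Simplex 1 X) :
    chainClassMap f (cls s) = cls (f.comp s) := by
  simp [chainClassMap, cls, chainMap, Finsupp.mapDomain_single]

theorem toChainClass_H1map (f : C(X, Y)) (γ : H1 X) :
    toChainClass Y (H1map f γ) = chainClassMap f (toChainClass X γ) := by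
  obtain ⟨c, rfl⟩ := Submodule.Quotient.mk_surjective _ γ
  rfl

theorem H1map_comp (g : C(Y, Z)) (f : C(X, Y)) (γ : H1 X) :
    H1map (g.comp f) γ = H1map g (H1map f γ) := by
  apply toChainClass_injective
  simp only [toChainClass_H1map]
  have : chainClassMap (g.comp f) = chainClassMap g ∘ₗ chainClassMap f :=
    chain_ext fun s => by simp [chainClassMap_cls, ContinuousMap.comp_assoc]
  rw [this, LinearMap.comp_apply]

theorem H1map_id (γ : H1 X) : H1map (ContinuousMap.id X) γ = γ := by
  apply toChainClass_injective
  rw [toChainClass_H1map]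
  have : chainClassMap (ContinuousMap.id X) = LinearMap.id :=
    chain_ext fun s => by simp [chainClassMap_cls]
  rw [this, LinearMap.id_apply]

/-- The period homomorphism on 1-chains modulo boundaries. -/
def chainClassPeriod (u : C(X, UnitAddCircle)) : ChainClass X →ₗ[ℝ] ℝ :=
  Submodule.liftQ _ (chainPeriod u) (by
    rintro _ ⟨d, rfl⟩
    exact chainPeriod_boundary u d)

theorem chainClassPeriod_cls (u : C(X, UnitAddCircle)) (s : Simplex 1 X) :
    chainClassPeriod u (cls s) = increment (u.comp s) := by
  simp [chainClassPeriod, cls, chainPeriod]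

theorem period_eq (u : C(X, UnitAddCircle)) (γ : H1 X) :
    period u γ = chainClassPeriod u (toChainClass X γ) := by
  obtain ⟨c, rfl⟩ := Submodule.Quotient.mk_surjective _ γ
  rfl

theorem period_H1map (u : C(Y, UnitAddCircle)) (f : C(X, Y)) (γ : H1 X) :
    period u (H1map f γ) = period (u.comp f) γ := by
  rw [period_eq, period_eq, toChainClass_H1map]
  have : chainClassPeriod u ∘ₗ chainClassMap f = chainClassPeriod (u.comp f) :=
    chain_ext fun s => by
      simp [chainClassMap_cls, chainClassPeriod_cls, ContinuousMap.comp_assoc]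
  rw [← this, LinearMap.comp_apply]

/-- The same integral combination of lifts of `u₁` and `u₂` is a lift of `u`. -/
theorem period_linear {u u₁ u₂ : C(X, UnitAddCircle)} {k m : ℤ}
    (h : ∀ x, u x = k • u₁ x + m • u₂ x) (γ : H1 X) :
    period u γ = k * period u₁ γ + m * period u₂ γ := by
  have : chainClassPeriod u = (k : ℝ) • chainClassPeriod u₁ + (m : ℝ) • chainClassPeriod u₂ := by
    refine chain_ext fun s => ?_
    obtain ⟨l₁, h₁⟩ := exists_lift (u₁.comp s)
    obtain ⟨l₂, h₂⟩ := exists_lift (u₂.comp s)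
    have hl : ∀ t, (((k : ℝ) • l₁ + (m : ℝ) • l₂) t : UnitAddCircle) = u.comp s t := by
      intro t
      simp only [ContinuousMap.add_apply, ContinuousMap.smul_apply, smul_eq_mul, AddCircle.coe_add,
        Origami.coe_int_mul, h₁, h₂]
      exact (h (s t)).symm
    simp only [LinearMap.add_apply, LinearMap.smul_apply, chainClassPeriod_cls,
      increment_eq _ _ h₁, increment_eq _ _ h₂, increment_eq _ _ hl, ContinuousMap.add_apply,
      ContinuousMap.smul_apply, smul_eq_mul]
    ring
  rw [period_eq, period_eq, period_eq, this]
  rfl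

theorem continuous_coord {n : ℕ} (k : Fin n) : Continuous fun t : stdSimplex ℝ (Fin n) => t.1 k :=
  (continuous_apply k).comp continuous_subtype_val

theorem bd2_single (s : Simplex 2 X) : bd2 X (Finsupp.single s 1) =
    Finsupp.single (s.comp (face 1 0)) 1 - Finsupp.single (s.comp (face 1 1)) 1 +
      Finsupp.single (s.comp (face 1 2)) 1 := by
  simp [bd2, boundary, Fin.sum_univ_three, sub_eq_add_neg]

theorem chainClassPeriod_of_lift (u : C(X, UnitAddCircle)) (s : Simplex 1 X) (r : ℝ)
    (h : ∀ t, u (s t) = ((r * t.1 1 : ℝ) : UnitAddCircle)) :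
    chainClassPeriod u (cls s) = r := by
  rw [chainClassPeriod_cls, increment_eq _ ⟨fun t => r * t.1 1,
    continuous_const.mul (continuous_coord 1)⟩ fun t => (h t).symm]
  simp [stdSimplex.vertex]

/-- The increment of a function along 1-chains. -/
def chainDiff (φ : X → ℝ) : Chain 1 X →ₗ[ℝ] ℝ :=
  (Finsupp.linearCombination ℝ fun s : Simplex 0 X => φ (s (stdSimplex.vertex 0))) ∘ₗ bd1 X

theorem chainDiff_single (φ : X → ℝ) (s : Simplex 1 X) :
    chainDiff φ (Finsupp.single s 1) =
      φ (s (stdSimplex.vertex 1)) - φ (s (stdSimplex.vertex 0)) := by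
  rw [chainDiff, LinearMap.comp_apply, Origami.bd1_single]
  simp

theorem chainDiff_boundary (φ : X → ℝ) (c : Chain 2 X) : chainDiff φ (bd2 X c) = 0 := by
  have h : chainDiff φ ∘ₗ bd2 X = 0 := by
    ext1 s
    ext1
    have hf : ∀ k : Fin 3, chainDiff φ (Finsupp.single (s.comp (face 1 k)) 1) =
        φ (s (stdSimplex.vertex (k.succAbove 1))) - φ (s (stdSimplex.vertex (k.succAbove 0))) := by
      intro k
      rw [chainDiff_single]
      simp [face]
    have a1 : (2 : Fin 3).succAbove (1 : Fin 2) = 1 := by decide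
    change chainDiff φ (bd2 X (Finsupp.single s 1)) = 0
    rw [bd2_single, map_add, map_sub, hf, hf, hf, a1]
    simp
  exact LinearMap.congr_fun h c

/-- The increment of a function along 1-chains modulo boundaries. -/
def chainClassDiff (φ : X → ℝ) : ChainClass X →ₗ[ℝ] ℝ :=
  Submodule.liftQ _ (chainDiff φ) (by
    rintro _ ⟨d, rfl⟩
    exact chainDiff_boundary φ d)

theorem chainClassDiff_cls (φ : X → ℝ) (s : Simplex 1 X) :
    chainClassDiff φ (cls s) = φ (s (stdSimplex.vertex 1)) - φ (s (stdSimplex.vertex 0)) := by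
  rw [← chainDiff_single]
  rfl

theorem chainClassDiff_toChainClass (φ : X → ℝ) (γ : H1 X) :
    chainClassDiff φ (toChainClass X γ) = 0 := by
  obtain ⟨c, rfl⟩ := Submodule.Quotient.mk_surjective _ γ
  change chainDiff φ c.1 = 0
  rw [chainDiff, LinearMap.comp_apply, LinearMap.mem_ker.1 c.2, map_zero]

/-! ### Affine simplices -/

section Seg

variable {E : Type*} [AddCommGroup E] [Module ℝ E] [TopologicalSpace E] [ContinuousAdd E]
  [ContinuousSMul ℝ E]

/-- The image under `Φ` of the segment from `P` to `Q`. -/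
def seg (Φ : C(E, X)) (P Q : E) : Simplex 1 X :=
  ⟨fun s => Φ (s.1 0 • P + s.1 1 • Q), Φ.continuous.comp
    (((continuous_coord 0).smul continuous_const).add ((continuous_coord 1).smul continuous_const))⟩

/-- The image under `Φ` of the triangle with vertices `P`, `Q` and `R`. -/
def tri (Φ : C(E, X)) (P Q R : E) : Simplex 2 X :=
  ⟨fun s => Φ (s.1 0 • P + s.1 1 • Q + s.1 2 • R), Φ.continuous.comp
    ((((continuous_coord 0).smul continuous_const).add
      ((continuous_coord 1).smul continuous_const)).add
      ((continuous_coord 2).smul continuous_const))⟩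

theorem face_apply (k : Fin 3) (s : stdSimplex ℝ (Fin 2)) :
    (face 1 k s).1 (k.succAbove 0) = s.1 0 ∧ (face 1 k s).1 (k.succAbove 1) = s.1 1 ∧
      (face 1 k s).1 k = 0 := by
  have h : ∀ j, (face 1 k s).1 j = FunOnFinite.linearMap ℝ ℝ k.succAbove s.1 j := fun j => rfl
  simp only [h, FunOnFinite.linearMap_apply_apply]
  refine ⟨?_, ?_, ?_⟩ <;> simp [Finset.filter_eq', Fin.succAbove_ne]

/-- The difference of the two sides bounds the image of the triangle with vertices `P`, `Q`, `R`.
This is the source of all homologies between affine paths below. -/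
theorem cls_seg_add (Φ : C(E, X)) (P Q R : E) :
    cls (seg Φ P Q) + cls (seg Φ Q R) = cls (seg Φ P R) := by
  rw [← sub_eq_zero]
  have h0 : (tri Φ P Q R).comp (face 1 0) = seg Φ Q R := by
    ext s
    obtain ⟨h1, h2, h3⟩ := face_apply 0 s
    change (face 1 0 s).1 1 = _ at h1
    change (face 1 0 s).1 2 = _ at h2
    change Φ _ = Φ _
    rw [h1, h2, h3, zero_smul, zero_add]
  have h1 : (tri Φ P Q R).comp (face 1 1) = seg Φ P R := by
    ext s
    obtain ⟨h1, h2, h3⟩ := face_apply 1 s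
    change (face 1 1 s).1 0 = _ at h1
    change (face 1 1 s).1 2 = _ at h2
    change Φ _ = Φ _
    rw [h1, h2, h3, zero_smul, add_zero]
  have h2 : (tri Φ P Q R).comp (face 1 2) = seg Φ P Q := by
    ext s
    obtain ⟨h1, h2, h3⟩ := face_apply 2 s
    change (face 1 2 s).1 0 = _ at h1
    change (face 1 2 s).1 1 = _ at h2
    change Φ _ = Φ _
    rw [h1, h2, h3, zero_smul, add_zero]
  simp only [cls, ← map_add, ← map_sub]
  rw [Submodule.mkQ_apply, Submodule.Quotient.mk_eq_zero]
  refine ⟨Finsupp.single (tri Φ P Q R) 1, ?_⟩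
  rw [bd2_single, h0, h1, h2]
  abel

theorem cls_seg_self (Φ : C(E, X)) (P : E) : cls (seg Φ P P) = 0 := by
  simpa using cls_seg_add Φ P P P

theorem cls_seg_symm (Φ : C(E, X)) (P Q : E) : cls (seg Φ Q P) = -cls (seg Φ P Q) := by
  rw [eq_neg_iff_add_eq_zero, cls_seg_add, cls_seg_self]

theorem cls_const (x : X) : cls (ContinuousMap.const _ x) = 0 :=
  cls_seg_self (ContinuousMap.const ℝ x) 0

end Seg

/-- Every singular 1-simplex is an affine simplex for some map from the line. -/
theorem exists_eq_seg (s : Simplex 1 X) : ∃ Φ : C(ℝ, X), seg Φ 0 1 = s := by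
  refine ⟨s.comp ⟨fun t => stdSimplexHomeomorphUnitInterval.symm (projIcc 0 1 zero_le_one t),
    stdSimplexHomeomorphUnitInterval.symm.continuous.comp continuous_projIcc⟩, ?_⟩
  ext t
  change s (stdSimplexHomeomorphUnitInterval.symm (projIcc 0 1 zero_le_one _)) = s t
  congr 1
  rw [Homeomorph.symm_apply_eq]
  have h : (stdSimplexHomeomorphUnitInterval t : ℝ) = t.1 1 := rfl
  rw [smul_zero, zero_add, smul_eq_mul, mul_one, ← h, projIcc_val]

/-! ### Generation of `H₁` from an open cover by contractible sets -/

/-- If, up to a submodule `W`, every 1-simplex is the difference of the values of a function at its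
end points, then `H₁` is contained in `W`. -/
theorem toChainClass_mem_of_simplices (K : X → ChainClass X) (W : Submodule ℝ (ChainClass X))
    (h : ∀ s : Simplex 1 X,
      cls s - (K (s (stdSimplex.vertex 1)) - K (s (stdSimplex.vertex 0))) ∈ W) (γ : H1 X) :
    toChainClass X γ ∈ W := by
  -- The correction by `K` factors through the boundary, so on cycles `L` is just the class.
  let L : Chain 1 X →ₗ[ℝ] ChainClass X := (LinearMap.range (bd2 X)).mkQ -
    (Finsupp.linearCombination ℝ fun s : Simplex 0 X => K (s (stdSimplex.vertex 0))) ∘ₗ bd1 X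
  have hL : ∀ c, L c ∈ W := by
    intro c
    induction c using Finsupp.induction_linear with
    | zero => simp
    | add c d hc hd => rw [map_add]; exact W.add_mem hc hd
    | single s r =>
      rw [← mul_one r, ← smul_eq_mul, ← Finsupp.smul_single, map_smul]
      refine W.smul_mem r ?_
      convert h s using 1
      simp only [L, LinearMap.sub_apply, LinearMap.comp_apply, Origami.bd1_single, map_sub,
        Finsupp.linearCombination_single, one_smul]
      rfl
  obtain ⟨c, rfl⟩ := Submodule.Quotient.mk_surjective _ γ
  have := hL c.1
  simp only [L, LinearMap.sub_apply, LinearMap.comp_apply, LinearMap.mem_ker.1 c.2, map_zero,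
    sub_zero] at this
  exact this

/-- If `H` contracts the set `c` to a point, then a path in `c` is, modulo boundaries, the
difference of the tracks of its end points. -/
theorem cls_seg_of_contraction (H : C(X, C(ℝ, X))) (c : Set X) (w : X) (h0 : ∀ x ∈ c, H x 0 = x)
    (h1 : ∀ x ∈ c, H x 1 = w) (Φ : C(ℝ, X)) {a b : ℝ} (hab : a ≤ b)
    (hΦ : ∀ t ∈ Icc a b, Φ t ∈ c) :
    cls (seg Φ a b) = cls (seg (H (Φ a)) 0 1) - cls (seg (H (Φ b)) 0 1) := by
  have hmem : ∀ s : stdSimplex ℝ (Fin 2), s.1 0 * a + s.1 1 * b ∈ Icc a b := by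
    exact fun s => convex_Icc a b (left_mem_Icc.2 hab) (right_mem_Icc.2 hab) (s.2.1 0) (s.2.1 1)
      (by rw [← Fin.sum_univ_two]; exact s.2.2)
  -- In the rectangle swept out by the contraction, one edge is the path, the opposite edge is
  -- constant, and the other two are the tracks of the end points.
  let Ψ : C(ℝ × ℝ, X) := (H.comp Φ).uncurry
  have hΨ : ∀ q, Ψ q = H (Φ q.1) q.2 := fun q => rfl
  have e1 : seg Φ a b = seg Ψ (a, 0) (b, 0) := by
    ext s
    change Φ _ = Ψ _
    rw [hΨ]
    simp [h0 _ (hΦ _ (hmem s))]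
  have e2 : seg Ψ (a, 1) (b, 1) = ContinuousMap.const _ w := by
    ext s
    change Ψ _ = w
    have : s.1 0 + s.1 1 = 1 := by rw [← Fin.sum_univ_two]; exact s.2.2
    rw [hΨ]
    simp [this, h1 _ (hΦ _ (hmem s))]
  have e3 : ∀ t, seg Ψ (t, 0) (t, 1) = seg (H (Φ t)) 0 1 := by
    intro t
    ext s
    change Ψ _ = H _ _
    have : s.1 0 + s.1 1 = 1 := by rw [← Fin.sum_univ_two]; exact s.2.2
    rw [hΨ]
    simp [← add_mul, this]
  rw [e1, ← e3, ← e3, ← cls_seg_add Ψ (a, 0) (a, 1) (b, 0), ← cls_seg_add Ψ (a, 1) (b, 1) (b, 0),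
    e2, cls_const, cls_seg_symm Ψ (b, 0)]
  abel

/-- If `X` has an open cover by sets which are contractible in `X`, then `H₁(X)` is contained in
every submodule `W` that contains the differences of tracks. -/
theorem toChainClass_mem_of_cover {J : Type*} (c : J → Set X) (hc : ∀ j, IsOpen (c j))
    (hcov : ∀ x, ∃ j, x ∈ c j) (H : J → C(X, C(ℝ, X))) (w : J → X)
    (h0 : ∀ j, ∀ x ∈ c j, H j x 0 = x) (h1 : ∀ j, ∀ x ∈ c j, H j x 1 = w j)
    (W : Submodule ℝ (ChainClass X))
    (hW : ∀ j k x, x ∈ c j → x ∈ c k → cls (seg (H j x) 0 1) - cls (seg (H k x) 0 1) ∈ W)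
    (γ : H1 X) : toChainClass X γ ∈ W := by
  choose J₀ hJ₀ using hcov
  -- Replacing the chosen set `J₀ x` by any other member of the cover containing `x` changes this
  -- value by an element of `W`.
  let K : X → ChainClass X := fun x => -cls (seg (H (J₀ x) x) 0 1)
  refine toChainClass_mem_of_simplices K W (fun s => ?_) γ
  obtain ⟨Φ, rfl⟩ := exists_eq_seg s
  have hloc : ∀ a b : ℝ, a ≤ b → (∃ j, ∀ t ∈ Icc a b, Φ t ∈ c j) →
      cls (seg Φ a b) - (K (Φ b) - K (Φ a)) ∈ W := by
    rintro a b hab ⟨j, hj⟩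
    rw [cls_seg_of_contraction (H j) (c j) (w j) (h0 j) (h1 j) Φ hab hj]
    have := W.sub_mem (hW j _ (Φ a) (hj a ⟨le_rfl, hab⟩) (hJ₀ _))
      (hW j _ (Φ b) (hj b ⟨hab, le_rfl⟩) (hJ₀ _))
    convert this using 1
    simp only [K]
    abel
  -- Lebesgue subdivision: each short piece lies in one set of the cover, and the contributions of
  -- `K` telescope.
  obtain ⟨t, ht0, htm, ⟨N, hN⟩, ht⟩ := exists_monotone_Icc_subset_open_cover_unitInterval
    (c := fun j => (fun r : unitInterval => Φ r) ⁻¹' c j)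
    (fun j => (hc j).preimage (by fun_prop)) (fun r _ => mem_iUnion.2 ⟨_, hJ₀ (Φ r)⟩)
  have hind : ∀ k, cls (seg Φ 0 (t k)) - (K (Φ (t k)) - K (Φ 0)) ∈ W := by
    intro k
    induction k with
    | zero => simp [ht0, cls_seg_self]
    | succ k ih =>
      obtain ⟨j, hj⟩ := ht k
      have := hloc (t k) (t (k + 1)) (htm k.le_succ) ⟨j, fun r hr => @hj
        ⟨r, (t k).2.1.trans hr.1, hr.2.trans (t (k + 1)).2.2⟩ hr⟩
      convert W.add_mem ih this using 1
      rw [← cls_seg_add Φ 0 (t k) (t (k + 1))]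
      abel
  have := hind N
  rw [hN N le_rfl] at this
  convert this using 4 <;> simp [seg, stdSimplex.vertex]

end Sing

/-! ### Cellular calculus with the sides of the squares. -/

namespace Origami

open Sing

variable {n : ℕ} (O : Origami n)

/-! ### Sides of the squares as singular simplices -/

/-- The square `i` as a map from the plane. -/
def square (i : Fin n) : C(ℝ × ℝ, O.Surface) := ⟨fun q => O.pt i q.1 q.2, O.continuous_pt i⟩

/-- The horizontal strip of square `i` as a map from the plane. -/
def strip (i : Fin n) : C(ℝ × ℝ, O.Surface) :=
  ⟨fun q => O.hStrip i q.1 q.2, O.continuous_hStrip i⟩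

/-- The bottom side of square `i`, from left to right. -/
def bottom (i : Fin n) : Simplex 1 O.Surface := seg (O.square i) (0, 0) (1, 0)

/-- The left side of square `i`, from bottom to top. -/
def left (i : Fin n) : Simplex 1 O.Surface := seg (O.square i) (0, 0) (0, 1)

theorem coord_add (s : stdSimplex ℝ (Fin 2)) : s.1 0 + s.1 1 = 1 := by
  rw [← Fin.sum_univ_two]
  exact s.2.2

theorem coord_mem_Icc (s : stdSimplex ℝ (Fin 2)) : s.1 1 ∈ Icc (0 : ℝ) 1 :=
  ⟨s.2.1 1, by linarith [s.2.1 0, coord_add s]⟩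

theorem seg_square_apply (i : Fin n) (P Q : ℝ × ℝ) (s : stdSimplex ℝ (Fin 2)) :
    seg (O.square i) P Q s =
      O.pt i (P.1 + s.1 1 * (Q.1 - P.1)) (P.2 + s.1 1 * (Q.2 - P.2)) := by
  have h : s.1 0 = 1 - s.1 1 := by linarith [coord_add s]
  change O.pt i (s.1 0 * P.1 + s.1 1 * Q.1) (s.1 0 * P.2 + s.1 1 * Q.2) = _
  rw [h]
  congr 1 <;> ring

theorem seg_strip_apply (i : Fin n) (P Q : ℝ × ℝ) (s : stdSimplex ℝ (Fin 2)) :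
    seg (O.strip i) P Q s =
      O.hStrip i (P.1 + s.1 1 * (Q.1 - P.1)) (P.2 + s.1 1 * (Q.2 - P.2)) := by
  have h : s.1 0 = 1 - s.1 1 := by linarith [coord_add s]
  change O.hStrip i (s.1 0 * P.1 + s.1 1 * Q.1) (s.1 0 * P.2 + s.1 1 * Q.2) = _
  rw [h]
  congr 1 <;> ring

theorem bottom_apply (i : Fin n) (s : stdSimplex ℝ (Fin 2)) :
    O.bottom i s = O.pt i (s.1 1) 0 := by
  simp [bottom, seg_square_apply]

theorem left_apply (i : Fin n) (s : stdSimplex ℝ (Fin 2)) : O.left i s = O.pt i 0 (s.1 1) := by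
  simp [left, seg_square_apply]

theorem seg_top (i : Fin n) : seg (O.square i) (0, 1) (1, 1) = O.bottom (O.v i) := by
  ext s
  simp [bottom_apply, seg_square_apply, pt_top]

theorem seg_right (i : Fin n) : seg (O.square i) (1, 0) (1, 1) = O.left (O.h i) := by
  ext s
  simp [left_apply, seg_square_apply, pt_right]

/-- The boundary of a square is a boundary. -/
theorem square_relation (i : Fin n) :
    cls (O.bottom i) + cls (O.left (O.h i)) = cls (O.left i) + cls (O.bottom (O.v i)) := by
  rw [← seg_top, ← seg_right, bottom, left, cls_seg_add, cls_seg_add]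

theorem hSegment_eq (i : Fin n) :
    O.hSegment i = seg (O.square i) (0, 1 / 2) (1, 1 / 2) := by
  ext s
  rw [seg_square_apply]
  have h1 : (stdSimplexHomeomorphUnitInterval s : ℝ) = s.1 1 := rfl
  have h2 : (half : ℝ) = 1 / 2 := rfl
  change O.proj _ = O.proj _
  simp only [sub_zero, mul_one, zero_add, sub_self, mul_zero, add_zero, ← h1, ← h2, projIcc_val]

theorem vSegment_eq (i : Fin n) :
    O.vSegment i = seg (O.square i) (1 / 2, 0) (1 / 2, 1) := by
  ext s
  rw [seg_square_apply]
  have h1 : (stdSimplexHomeomorphUnitInterval s : ℝ) = s.1 1 := rfl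
  have h2 : (half : ℝ) = 1 / 2 := rfl
  change O.proj _ = O.proj _
  simp only [sub_zero, mul_one, zero_add, sub_self, mul_zero, add_zero, ← h1, ← h2, projIcc_val]

/-- Slide the segment down to the bottom side; the error terms are halves of left sides, and they
telescope around a closed cylinder. -/
theorem cls_hSegment (i : Fin n) : cls (O.hSegment i) = cls (O.bottom i) +
    (cls (seg (O.square (O.h i)) (0, 0) (0, 1 / 2)) -
      cls (seg (O.square i) (0, 0) (0, 1 / 2))) := by
  have h : seg (O.square (O.h i)) (0, 0) (0, 1 / 2) = seg (O.square i) (1, 0) (1, 1 / 2) := by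
    ext s
    simp [seg_square_apply, pt_right]
  rw [h, hSegment_eq, bottom, ← cls_seg_add (O.square i) (0, 1 / 2) (0, 0) (1, 1 / 2),
    ← cls_seg_add (O.square i) (0, 0) (1, 0) (1, 1 / 2), cls_seg_symm (O.square i) (0, 0)]
  abel

theorem cls_vSegment (i : Fin n) : cls (O.vSegment i) = cls (O.left i) +
    (cls (seg (O.square (O.v i)) (0, 0) (1 / 2, 0)) -
      cls (seg (O.square i) (0, 0) (1 / 2, 0))) := by
  have h : seg (O.square (O.v i)) (0, 0) (1 / 2, 0) = seg (O.square i) (0, 1) (1 / 2, 1) := by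
    ext s
    simp [seg_square_apply, pt_top]
  rw [h, vSegment_eq, left, ← cls_seg_add (O.square i) (1 / 2, 0) (0, 0) (1 / 2, 1),
    ← cls_seg_add (O.square i) (0, 0) (0, 1) (1 / 2, 1), cls_seg_symm (O.square i) (0, 0)]
  abel

theorem toChainClass_hCurve (i : Fin n) (m : ℕ) (hm : (O.h ^ m) i = i) :
    toChainClass _ (O.hCurve i m hm) = ∑ k ∈ Finset.range m, cls (O.bottom ((O.h ^ k) i)) := by
  have h : toChainClass _ (O.hCurve i m hm) =
      ∑ k ∈ Finset.range m, cls (O.hSegment ((O.h ^ k) i)) := by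
    simp only [cls, ← map_sum]
    rfl
  simp only [h, cls_hSegment, Finset.sum_add_distrib, ← Equiv.Perm.mul_apply, ← pow_succ']
  rw [Finset.sum_range_sub fun k => cls (seg (O.square ((O.h ^ k) i)) (0, 0) (0, 1 / 2)), hm]
  simp

theorem toChainClass_vCurve (i : Fin n) (m : ℕ) (hm : (O.v ^ m) i = i) :
    toChainClass _ (O.vCurve i m hm) = ∑ k ∈ Finset.range m, cls (O.left ((O.v ^ k) i)) := by
  have h : toChainClass _ (O.vCurve i m hm) =
      ∑ k ∈ Finset.range m, cls (O.vSegment ((O.v ^ k) i)) := by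
    simp only [cls, ← map_sum]
    rfl
  simp only [h, cls_vSegment, Finset.sum_add_distrib, ← Equiv.Perm.mul_apply, ← pow_succ']
  rw [Finset.sum_range_sub fun k => cls (seg (O.square ((O.v ^ k) i)) (0, 0) (1 / 2, 0)), hm]
  simp

/-! ### Circle-valued maps dual to cylinders -/

/-- The map `(i, x, y) ↦ D i * y`, for `D` constant on the horizontal cylinders. -/
def heightMap (D : Fin n → ℤ) (hD : ∀ i, D (O.h i) = D i) : C(O.Surface, UnitAddCircle) :=
  O.desc (fun i _ y => ((D i * y : ℝ) : UnitAddCircle))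
    (fun i => (AddCircle.continuous_mk' (1 : ℝ)).comp (by fun_prop))
    (fun i y _ => by rw [hD]) (fun i x _ => by rw [mul_one, coe_intCast]; simp)

/-- The map `(i, x, y) ↦ D i * x`, for `D` constant on the vertical cylinders. -/
def widthMap (D : Fin n → ℤ) (hD : ∀ i, D (O.v i) = D i) : C(O.Surface, UnitAddCircle) :=
  O.desc (fun i x _ => ((D i * x : ℝ) : UnitAddCircle))
    (fun i => (AddCircle.continuous_mk' (1 : ℝ)).comp (by fun_prop))
    (fun i y _ => by rw [mul_one, coe_intCast]; simp) (fun i x _ => by rw [hD])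

theorem heightMap_pt (D : Fin n → ℤ) (hD : ∀ i, D (O.h i) = D i) (i : Fin n) {x y : ℝ}
    (hx : x ∈ Icc (0 : ℝ) 1) (hy : y ∈ Icc (0 : ℝ) 1) :
    O.heightMap D hD (O.pt i x y) = ((D i * y : ℝ) : UnitAddCircle) :=
  O.desc_pt _ _ _ i hx hy

theorem widthMap_pt (D : Fin n → ℤ) (hD : ∀ i, D (O.v i) = D i) (i : Fin n) {x y : ℝ}
    (hx : x ∈ Icc (0 : ℝ) 1) (hy : y ∈ Icc (0 : ℝ) 1) :
    O.widthMap D hD (O.pt i x y) = ((D i * x : ℝ) : UnitAddCircle) :=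
  O.desc_pt _ _ _ i hx hy

theorem heightMap_bottom (D : Fin n → ℤ) (hD : ∀ i, D (O.h i) = D i) (i : Fin n) :
    chainClassPeriod (O.heightMap D hD) (cls (O.bottom i)) = 0 :=
  chainClassPeriod_of_lift _ _ _ fun t => by
    rw [bottom_apply, heightMap_pt _ _ _ _ (coord_mem_Icc t) (by simp)]
    simp

theorem heightMap_left (D : Fin n → ℤ) (hD : ∀ i, D (O.h i) = D i) (i : Fin n) :
    chainClassPeriod (O.heightMap D hD) (cls (O.left i)) = D i :=
  chainClassPeriod_of_lift _ _ _ fun t => by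
    rw [left_apply, heightMap_pt _ _ _ _ (by simp) (coord_mem_Icc t)]

theorem widthMap_bottom (D : Fin n → ℤ) (hD : ∀ i, D (O.v i) = D i) (i : Fin n) :
    chainClassPeriod (O.widthMap D hD) (cls (O.bottom i)) = D i :=
  chainClassPeriod_of_lift _ _ _ fun t => by
    rw [bottom_apply, widthMap_pt _ _ _ _ (coord_mem_Icc t) (by simp)]

theorem widthMap_left (D : Fin n → ℤ) (hD : ∀ i, D (O.v i) = D i) (i : Fin n) :
    chainClassPeriod (O.widthMap D hD) (cls (O.left i)) = 0 :=
  chainClassPeriod_of_lift _ _ _ fun t => by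
    rw [left_apply, widthMap_pt _ _ _ _ (by simp) (coord_mem_Icc t)]
    simp

theorem coordX_eq_widthMap : O.coordX = O.widthMap (fun _ => 1) fun _ => rfl := by
  ext z
  obtain ⟨i, x, hx, y, hy, rfl⟩ := O.exists_pt z
  rw [coordX_pt _ _ hx, widthMap_pt _ _ _ _ hx hy]
  simp

theorem coordY_eq_heightMap : O.coordY = O.heightMap (fun _ => 1) fun _ => rfl := by
  ext z
  obtain ⟨i, x, hx, y, hy, rfl⟩ := O.exists_pt z
  rw [coordY_pt _ _ _ hy, heightMap_pt _ _ _ _ hx hy]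
  simp

/-! ### Action of the affine homeomorphisms on the sides -/

theorem seg_strip_bottom (i : Fin n) (k : ℕ) :
    seg (O.strip i) ((k : ℝ), 0) ((k + 1 : ℝ), 0) = O.bottom ((O.h ^ k) i) := by
  ext s
  rw [seg_strip_apply, bottom_apply, ← hStrip_eq_pt _ _ (coord_mem_Icc s)]
  have := O.hStrip_add_int i (s.1 1) 0 k
  rw [zpow_natCast] at this
  rw [← this]
  simp [add_comm]

theorem seg_strip_left (i : Fin n) (k : ℕ) :
    seg (O.strip i) ((k : ℝ), 0) ((k : ℝ), 1) = O.left ((O.h ^ k) i) := by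
  ext s
  rw [seg_strip_apply, left_apply, ← hStrip_eq_pt _ _ (by simp)]
  have := O.hStrip_add_int i 0 (s.1 1) k
  rw [zpow_natCast] at this
  rw [← this]
  simp

theorem seg_strip_top (i : Fin n) :
    seg (O.strip i) (0, 1) (1, 1) = O.bottom (O.v i) := by
  ext s
  rw [seg_strip_apply, bottom_apply, ← pt_top, ← hStrip_eq_pt _ _ (coord_mem_Icc s)]
  simp

theorem cls_seg_strip_bottom (i : Fin n) (m : ℕ) :
    cls (seg (O.strip i) (0, 0) ((m : ℝ), 0)) =
      ∑ k ∈ Finset.range m, cls (O.bottom ((O.h ^ k) i)) := by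
  induction m with
  | zero => simpa using cls_seg_self (O.strip i) (0, 0)
  | succ m ih =>
    rw [Finset.sum_range_succ, ← ih, ← seg_strip_bottom, cls_seg_add, Nat.cast_succ]

theorem shear_comp_bottom (k : ℤ) (hk : O.h ^ k = 1) (i : Fin n) :
    (O.shear k hk : C(O.Surface, O.Surface)).comp (O.bottom i) = O.bottom i := by
  ext s
  change O.shear k hk (O.bottom i s) = _
  rw [bottom_apply, shear_pt _ _ _ _ (coord_mem_Icc s) (by simp),
    ← hStrip_eq_pt _ _ (coord_mem_Icc s)]
  simp

/-- The image is the segment from (0, 0) to (k, 1) in the strip, homotopic to `k` bottom sides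
followed by a left side, which is that of `i` because `h ^ k = 1`. -/
theorem cls_shear_comp_left (k : ℕ) (hk : O.h ^ (k : ℤ) = 1) (i : Fin n) :
    cls ((O.shear k hk : C(O.Surface, O.Surface)).comp (O.left i)) =
      ∑ l ∈ Finset.range k, cls (O.bottom ((O.h ^ l) i)) + cls (O.left i) := by
  have h : (O.shear k hk : C(O.Surface, O.Surface)).comp (O.left i) =
      seg (O.strip i) (0, 0) ((k : ℝ), 1) := by
    ext s
    change O.shear k hk (O.left i s) = _
    rw [left_apply, shear_pt _ _ _ _ (by simp) (coord_mem_Icc s), seg_strip_apply]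
    simp [mul_comm]
  have hi : (O.h ^ k) i = i := by
    rw [zpow_natCast] at hk
    rw [hk, Equiv.Perm.one_apply]
  rw [h, ← cls_seg_strip_bottom, ← cls_seg_add (O.strip i) (0, 0) ((k : ℝ), 0) ((k : ℝ), 1),
    seg_strip_left, hi]

section Turn

variable (φ : Equiv.Perm (Fin n)) (hh : ∀ i, O.v (φ (O.h i)) = O.h (φ i))
  (hv : ∀ i, φ (O.v i) = O.h (φ i))

/-- The image is the falling diagonal of square `φ i`: down its left side, then along its bottom. -/
theorem cls_turn_comp_bottom (i : Fin n) :
    cls ((O.turn φ hh hv : C(O.Surface, O.Surface)).comp (O.bottom i)) =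
      cls (O.bottom (φ i)) - cls (O.left (φ i)) := by
  have h : (O.turn φ hh hv : C(O.Surface, O.Surface)).comp (O.bottom i) =
      seg (O.strip (φ i)) (0, 1) (1, 0) := by
    ext s
    change O.turn φ hh hv (O.bottom i s) = _
    rw [bottom_apply, turn_pt _ _ _ _ _ (coord_mem_Icc s) (by simp), seg_strip_apply]
    simp [sub_eq_add_neg]
  have h1 := O.seg_strip_bottom (φ i) 0
  have h2 := O.seg_strip_left (φ i) 0
  simp only [Nat.cast_zero, zero_add, pow_zero, Equiv.Perm.one_apply] at h1 h2
  rw [h, ← cls_seg_add (O.strip (φ i)) (0, 1) (0, 0) (1, 0), h1, cls_seg_symm, h2]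
  abel

theorem turn_comp_left (i : Fin n) :
    (O.turn φ hh hv : C(O.Surface, O.Surface)).comp (O.left i) = O.bottom (O.v (φ i)) := by
  rw [← seg_strip_top]
  ext s
  change O.turn φ hh hv (O.left i s) = _
  rw [left_apply, turn_pt _ _ _ _ _ (by simp) (coord_mem_Icc s), seg_strip_apply]
  simp

end Turn

/-! ### Actions on homology -/

variable {O}

/-- The holonomy of the image class is `M` applied to the holonomy of the class. -/
theorem Covers.map_zeroHolonomy {f : O.Surface ≃ₜ O.Surface}
    {M : Matrix.SpecialLinearGroup (Fin 2) ℤ} (hf : O.Covers f M) {γ : H1 O.Surface}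
    (hγ : γ ∈ O.zeroHolonomy) : H1map (f : C(O.Surface, O.Surface)) γ ∈ O.zeroHolonomy := by
  have h := LinearMap.mem_ker.1 hγ
  have hX : period O.coordX γ = 0 := congrArg Prod.fst h
  have hY : period O.coordY γ = 0 := congrArg Prod.snd h
  refine LinearMap.mem_ker.2 (Prod.ext ?_ ?_)
  · change period O.coordX _ = 0
    rw [period_H1map, period_linear (u₁ := O.coordX) (u₂ := O.coordY) (k := M.1 0 0) (m := M.1 0 1)
      (fun z => (hf z).1), hX, hY, mul_zero, mul_zero, add_zero]
  · change period O.coordY _ = 0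
    rw [period_H1map, period_linear (u₁ := O.coordX) (u₂ := O.coordY) (k := M.1 1 0) (m := M.1 1 1)
      (fun z => (hf z).2), hX, hY, mul_zero, mul_zero, add_zero]

theorem H1map_symm_apply (f : O.Surface ≃ₜ O.Surface) (γ : H1 O.Surface) :
    H1map (f.symm : C(O.Surface, O.Surface)) (H1map (f : C(O.Surface, O.Surface)) γ) = γ := by
  rw [← H1map_comp]
  have : (f.symm : C(O.Surface, O.Surface)).comp (f : C(O.Surface, O.Surface)) =
      ContinuousMap.id _ := by
    ext z
    exact f.symm_apply_apply z
  rw [this, H1map_id]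

/-- The action of a homeomorphism that covers a torus automorphism on the zero-holonomy subspace. -/
def Covers.action {f : O.Surface ≃ₜ O.Surface} {M : Matrix.SpecialLinearGroup (Fin 2) ℤ}
    (hf : O.Covers f M) : O.zeroHolonomy ≃ₗ[ℝ] O.zeroHolonomy :=
  LinearEquiv.ofLinearMap
    ((H1map (f : C(O.Surface, O.Surface))).restrict fun _ h => hf.map_zeroHolonomy h)
    ((H1map (f.symm : C(O.Surface, O.Surface))).restrict fun _ h => hf.symm.map_zeroHolonomy h)
    (by ext γ; exact H1map_symm_apply f.symm γ) (by ext γ; exact H1map_symm_apply f γ)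

theorem Covers.induces_action {f : O.Surface ≃ₜ O.Surface}
    {M : Matrix.SpecialLinearGroup (Fin 2) ℤ} (hf : O.Covers f M) : O.Induces f hf.action :=
  fun _ => rfl

theorem Induces.trans {f f' : O.Surface ≃ₜ O.Surface}
    {g g' : O.zeroHolonomy ≃ₗ[ℝ] O.zeroHolonomy} (h : O.Induces f g) (h' : O.Induces f' g') :
    O.Induces (f.trans f') (g' * g) := by
  intro γ
  change (g' (g γ) : H1 O.Surface) = _
  rw [h', h, ← H1map_comp]
  rfl

theorem Induces.symm {f : O.Surface ≃ₜ O.Surface} {g : O.zeroHolonomy ≃ₗ[ℝ] O.zeroHolonomy}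
    (h : O.Induces f g) : O.Induces f.symm g⁻¹ := by
  intro γ
  obtain ⟨γ, rfl⟩ := g.surjective γ
  rw [h γ, H1map_symm_apply]
  exact congrArg Subtype.val (g.symm_apply_apply γ)

end Origami

/-! ### Homology of the octahedral origami: generation by sides and cylinder periods. -/

namespace Octahedron

open Origami Sing

/-! ### The open stars of the vertices -/

/-- The vertex of the octahedron at the lower left corner of a square. -/
def corner : Fin 12 → Fin 6 := ![0, 1, 2, 3, 4, 1, 5, 2, 4, 5, 3, 0]

theorem corner_h_v : ∀ i, corner (O.h (O.v i)) = corner (O.v (O.h i)) := by decide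

/-- Each square meets a vertex in at most one corner, so moving towards that corner is unambiguous.
-/
theorem corner_distinct : ∀ i, corner i ≠ corner (O.h i) ∧ corner i ≠ corner (O.v i) ∧
    corner i ≠ corner (O.v (O.h i)) ∧ corner (O.h i) ≠ corner (O.v i) ∧
    corner (O.h i) ≠ corner (O.v (O.h i)) ∧ corner (O.v i) ≠ corner (O.v (O.h i)) := by decide

/-- A square with a given lower left corner. -/
def cornerSquare : Fin 6 → Fin 12 := ![0, 1, 2, 3, 4, 6]

/-- The vertices as points of the surface. -/
def vertexPoint (w : Fin 6) : O.Surface := O.pt (cornerSquare w) 0 0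

theorem pt_h_v (j : Fin 12) : O.pt (O.h (O.v j)) 0 0 = O.pt (O.v (O.h j)) 0 0 := by
  rw [← pt_right, ← pt_top, pt_right, pt_top]

/-- Each vertex is the lower left corner of two squares, of the form `h (v j)` and `v (h j)`, which
share that corner at the upper right of square `j`. -/
theorem vertexPoint_corner (i : Fin 12) : vertexPoint (corner i) = O.pt i 0 0 := by
  have : ∀ i, cornerSquare (corner i) = i ∨
      ∃ j, cornerSquare (corner i) = O.h (O.v j) ∧ i = O.v (O.h j) := by decide
  rcases this i with h | ⟨j, h1, h2⟩
  · rw [vertexPoint, h]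
  · rw [vertexPoint, h1, pt_h_v, ← h2]

/-- The bilinear weight of vertex `w` in square `i`. -/
def weightFun (w : Fin 6) (i : Fin 12) (x y : ℝ) : ℝ :=
  (if corner i = w then (1 - x) * (1 - y) else 0) + (if corner (O.h i) = w then x * (1 - y) else 0) +
    (if corner (O.v i) = w then (1 - x) * y else 0) +
    (if corner (O.v (O.h i)) = w then x * y else 0)

theorem continuous_weightFun (w : Fin 6) (i : Fin 12) :
    Continuous fun q : ℝ × ℝ => weightFun w i q.1 q.2 := by
  unfold weightFun
  split_ifs <;> fun_prop

theorem weightFun_right (w : Fin 6) (i : Fin 12) (y : ℝ) :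
    weightFun w i 1 y = weightFun w (O.h i) 0 y := by
  simp [weightFun]

theorem weightFun_top (w : Fin 6) (i : Fin 12) (x : ℝ) :
    weightFun w i x 1 = weightFun w (O.v i) x 0 := by
  simp [weightFun, corner_h_v]

/-- The barycentric weight of vertex `w`. -/
def weight (w : Fin 6) : C(O.Surface, ℝ) :=
  O.desc (weightFun w) (continuous_weightFun w) (fun i y _ => weightFun_right w i y)
    (fun i x _ => weightFun_top w i x)

theorem weight_pt (w : Fin 6) (i : Fin 12) {x y : ℝ} (hx : x ∈ Icc (0 : ℝ) 1)
    (hy : y ∈ Icc (0 : ℝ) 1) : weight w (O.pt i x y) = weightFun w i x y :=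
  O.desc_pt _ _ _ i hx hy

theorem sum_weight (z : O.Surface) : ∑ w, weight w z = 1 := by
  obtain ⟨i, x, hx, y, hy, rfl⟩ := O.exists_pt z
  simp only [weight_pt _ _ hx hy, weightFun, Finset.sum_add_distrib, Finset.sum_ite_eq,
    Finset.mem_univ, if_true]
  ring

/-- Six weights add up to 1, so any threshold below 1/6 works; the factor 7 in `cutoff` makes it
equal to 1 above this threshold. -/
theorem exists_weight_gt (z : O.Surface) : ∃ w, 1 / 7 < weight w z := by
  by_contra! h
  have := Finset.sum_le_sum fun w (_ : w ∈ Finset.univ) => h w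
  rw [sum_weight] at this
  norm_num at this

/-- The cut-off of the weight of `w`. -/
def cutoff (w : Fin 6) (i : Fin 12) (x y : ℝ) : ℝ := min 1 (7 * weightFun w i x y)

/-- The horizontal displacement from a point of square `i` to the corner `w`. -/
def moveX (w : Fin 6) (i : Fin 12) (x : ℝ) : ℝ :=
  (if corner i = w ∨ corner (O.v i) = w then 0 - x else 0) +
    (if corner (O.h i) = w ∨ corner (O.v (O.h i)) = w then 1 - x else 0)

/-- The vertical displacement from a point of square `i` to the corner `w`. -/
def moveY (w : Fin 6) (i : Fin 12) (y : ℝ) : ℝ :=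
  (if corner i = w ∨ corner (O.h i) = w then 0 - y else 0) +
    (if corner (O.v i) = w ∨ corner (O.v (O.h i)) = w then 1 - y else 0)

theorem continuous_contractPair (w : Fin 6) (i : Fin 12) : Continuous fun q : (ℝ × ℝ) × ℝ =>
    (q.1.1 + q.2 * (cutoff w i q.1.1 q.1.2 * moveX w i q.1.1),
      q.1.2 + q.2 * (cutoff w i q.1.1 q.1.2 * moveY w i q.1.2)) := by
  have h1 : Continuous fun q : (ℝ × ℝ) × ℝ => cutoff w i q.1.1 q.1.2 :=
    continuous_const.min (continuous_const.mul ((continuous_weightFun w i).comp continuous_fst))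
  have h2 : Continuous (moveX w i) := by unfold moveX; split_ifs <;> fun_prop
  have h3 : Continuous (moveY w i) := by unfold moveY; split_ifs <;> fun_prop
  fun_prop

/-- The contraction of the star of `w`, with cut-off, in square `i`. -/
def contractFun (w : Fin 6) (i : Fin 12) : C((ℝ × ℝ) × ℝ, O.Surface) :=
  ⟨fun q => O.pt i (q.1.1 + q.2 * (cutoff w i q.1.1 q.1.2 * moveX w i q.1.1))
    (q.1.2 + q.2 * (cutoff w i q.1.1 q.1.2 * moveY w i q.1.2)),
    (O.continuous_pt i).comp (continuous_contractPair w i)⟩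

/-- If `w` is an end of the common side, both squares move points along that side by the same
amount; otherwise the weight of `w`, hence the cut-off, vanishes on it. This makes the contraction
well defined across the gluing. -/
theorem cutoff_mul_move_right (w : Fin 6) (i : Fin 12) (y : ℝ) :
    cutoff w i 1 y * moveX w i 1 = 0 ∧ cutoff w (O.h i) 0 y * moveX w (O.h i) 0 = 0 ∧
      cutoff w i 1 y * moveY w i y = cutoff w (O.h i) 0 y * moveY w (O.h i) y := by
  obtain ⟨a1, a2, a3, a4, a5, a6⟩ := corner_distinct i
  obtain ⟨b1, b2, b3, b4, b5, b6⟩ := corner_distinct (O.h i)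
  by_cases h : corner (O.h i) = w
  · subst h
    simp [cutoff, weightFun, moveX, moveY, a1, a4.symm, a5.symm, b1.symm, b3.symm]
  by_cases h' : corner (O.v (O.h i)) = w
  · subst h'
    simp [cutoff, weightFun, moveX, moveY, a3, a6, a5, b4, b6.symm]
  · simp [cutoff, weightFun, h, h']

theorem cutoff_mul_move_top (w : Fin 6) (i : Fin 12) (x : ℝ) :
    cutoff w i x 1 * moveY w i 1 = 0 ∧ cutoff w (O.v i) x 0 * moveY w (O.v i) 0 = 0 ∧
      cutoff w i x 1 * moveX w i x = cutoff w (O.v i) x 0 * moveX w (O.v i) x := by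
  obtain ⟨a1, a2, a3, a4, a5, a6⟩ := corner_distinct i
  obtain ⟨b1, b2, b3, b4, b5, b6⟩ := corner_distinct (O.v i)
  rw [corner_h_v] at b1 b4 b5
  by_cases h : corner (O.v i) = w
  · subst h
    simp [cutoff, weightFun, moveX, moveY, corner_h_v, a2, a4, a6.symm, b2.symm, b3.symm]
  by_cases h' : corner (O.v (O.h i)) = w
  · subst h'
    simp [cutoff, weightFun, moveX, moveY, corner_h_v, a3, a6, a5, b4.symm, b5.symm]
  · simp [cutoff, weightFun, corner_h_v, h, h']

/-- The contraction of the star of `w`, with cut-off. -/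
def contract (w : Fin 6) : C(O.Surface, C(ℝ, O.Surface)) :=
  O.desc (fun i x y => (contractFun w i).curry (x, y)) (fun i => (contractFun w i).curry.continuous)
    (fun i y _ => by
      ext r
      obtain ⟨h1, h2, h3⟩ := cutoff_mul_move_right w i y
      change O.pt i (1 + r * (cutoff w i 1 y * moveX w i 1))
        (y + r * (cutoff w i 1 y * moveY w i y)) =
        O.pt (O.h i) (0 + r * (cutoff w (O.h i) 0 y * moveX w (O.h i) 0))
          (y + r * (cutoff w (O.h i) 0 y * moveY w (O.h i) y))
      rw [h1, h2, h3, mul_zero, add_zero, add_zero, pt_right])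
    (fun i x _ => by
      ext r
      obtain ⟨h1, h2, h3⟩ := cutoff_mul_move_top w i x
      change O.pt i (x + r * (cutoff w i x 1 * moveX w i x))
        (1 + r * (cutoff w i x 1 * moveY w i 1)) =
        O.pt (O.v i) (x + r * (cutoff w (O.v i) x 0 * moveX w (O.v i) x))
          (0 + r * (cutoff w (O.v i) x 0 * moveY w (O.v i) 0))
      rw [h1, h2, h3, mul_zero, add_zero, add_zero, pt_top])

theorem contract_pt (w : Fin 6) (i : Fin 12) {x y : ℝ} (hx : x ∈ Icc (0 : ℝ) 1)
    (hy : y ∈ Icc (0 : ℝ) 1) (r : ℝ) : contract w (O.pt i x y) r =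
      O.pt i (x + r * (cutoff w i x y * moveX w i x)) (y + r * (cutoff w i x y * moveY w i y)) :=
  congrArg (fun f : C(ℝ, O.Surface) => f r)
    (O.desc_pt (F := fun i x y => (contractFun w i).curry (x, y)) _ _ _ i hx hy)

/-- The corners of the unit square. -/
def unitCorners : Set (ℝ × ℝ) := {(0, 0), (1, 0), (0, 1), (1, 1)}

/-- In the star of `w`, the contraction moves points along segments to a corner. -/
theorem exists_contract_eq (w : Fin 6) (i : Fin 12) {x y : ℝ} (hx : x ∈ Icc (0 : ℝ) 1)
    (hy : y ∈ Icc (0 : ℝ) 1) (hw : 1 / 7 < weight w (O.pt i x y)) :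
    ∃ C ∈ unitCorners, O.pt i C.1 C.2 = vertexPoint w ∧
      ∀ r, contract w (O.pt i x y) r = O.pt i (x + r * (C.1 - x)) (y + r * (C.2 - y)) := by
  rw [weight_pt _ _ hx hy] at hw
  have hc : cutoff w i x y = 1 := min_eq_left (by linarith)
  simp only [contract_pt _ _ hx hy, hc, one_mul]
  obtain ⟨a1, a2, a3, a4, a5, a6⟩ := corner_distinct i
  by_cases h1 : corner i = w
  · subst h1
    exact ⟨(0, 0), by simp [unitCorners], (vertexPoint_corner i).symm, fun r => by
      simp [moveX, moveY, a1.symm, a2.symm, a3.symm]⟩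
  by_cases h2 : corner (O.h i) = w
  · subst h2
    exact ⟨(1, 0), by simp [unitCorners], by rw [vertexPoint_corner, pt_right], fun r => by
      simp [moveX, moveY, a1, a4.symm, a5.symm]⟩
  by_cases h3 : corner (O.v i) = w
  · subst h3
    exact ⟨(0, 1), by simp [unitCorners], by rw [vertexPoint_corner, pt_top], fun r => by
      simp [moveX, moveY, a2, a4, a6.symm]⟩
  by_cases h4 : corner (O.v (O.h i)) = w
  · subst h4
    exact ⟨(1, 1), by simp [unitCorners], by rw [vertexPoint_corner, pt_right, pt_top], fun r => by
      simp [moveX, moveY, a3, a5, a6]⟩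
  · norm_num [weightFun, h1, h2, h3, h4] at hw

/-! ### Generation of the homology by the sides of the squares -/

/-- The span of the sides of the squares. -/
def sideSpan : Submodule ℝ (ChainClass O.Surface) :=
  Submodule.span ℝ (range fun i => cls (O.bottom i)) ⊔
    Submodule.span ℝ (range fun i => cls (O.left i))

theorem bottom_mem (i : Fin 12) : cls (O.bottom i) ∈ sideSpan :=
  Submodule.mem_sup_left (Submodule.subset_span ⟨i, rfl⟩)

theorem left_mem (i : Fin 12) : cls (O.left i) ∈ sideSpan :=
  Submodule.mem_sup_right (Submodule.subset_span ⟨i, rfl⟩)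

theorem seg_corner_mem (i : Fin 12) {C : ℝ × ℝ} (hC : C ∈ unitCorners) :
    cls (seg (O.square i) (0, 0) C) ∈ sideSpan := by
  rcases hC with rfl | rfl | rfl | rfl
  · rw [cls_seg_self]; exact zero_mem _
  · exact bottom_mem i
  · exact left_mem i
  · rw [← cls_seg_add (O.square i) (0, 0) (1, 0) (1, 1), seg_right]
    exact add_mem (bottom_mem i) (left_mem _)

/-- The cover consists of the stars of the vertices. Two tracks of one point are segments in one
square ending at corners, so their difference is homologous to a path between corners along sides.
-/
theorem toChainClass_mem_sideSpan (γ : H1 O.Surface) : toChainClass _ γ ∈ sideSpan := by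
  refine toChainClass_mem_of_cover (fun w => weight w ⁻¹' Ioi (1 / 7))
    (fun w => isOpen_Ioi.preimage (weight w).continuous) exists_weight_gt contract vertexPoint
    ?_ ?_ sideSpan ?_ γ
  · intro w z hz
    obtain ⟨i, x, hx, y, hy, rfl⟩ := O.exists_pt z
    simp [contract_pt _ _ hx hy]
  · intro w z hz
    obtain ⟨i, x, hx, y, hy, rfl⟩ := O.exists_pt z
    obtain ⟨C, -, hC, h⟩ := exists_contract_eq w i hx hy hz
    rw [h, ← hC]
    congr 1 <;> ring
  · intro w w' z hz hz'
    obtain ⟨i, x, hx, y, hy, rfl⟩ := O.exists_pt z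
    have key : ∀ w, 1 / 7 < weight w (O.pt i x y) → ∃ C ∈ unitCorners,
        cls (seg (contract w (O.pt i x y)) 0 1) = cls (seg (O.square i) (0, 0) C) -
          cls (seg (O.square i) (0, 0) (x, y)) := by
      intro w hw
      obtain ⟨C, hC, -, h⟩ := exists_contract_eq w i hx hy hw
      refine ⟨C, hC, ?_⟩
      have : seg (contract w (O.pt i x y)) 0 1 = seg (O.square i) (x, y) C := by
        ext s
        rw [seg_square_apply, ← h]
        change contract w (O.pt i x y) _ = _
        simp
      rw [this, ← cls_seg_add (O.square i) (0, 0) (x, y) C]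
      abel
    obtain ⟨C, hC, h⟩ := key w hz
    obtain ⟨C', hC', h'⟩ := key w' hz'
    rw [h, h', sub_sub_sub_cancel_right]
    exact sub_mem (seg_corner_mem i hC) (seg_corner_mem i hC')

theorem exists_eq_sum_sides (γ : H1 O.Surface) : ∃ a b : Fin 12 → ℝ,
    toChainClass _ γ = ∑ i, a i • cls (O.bottom i) + ∑ i, b i • cls (O.left i) := by
  obtain ⟨p, hp, q, hq, h⟩ := Submodule.mem_sup.1 (toChainClass_mem_sideSpan γ)
  obtain ⟨a, rfl⟩ := (Submodule.mem_span_range_iff_exists_fun ℝ).1 hp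
  obtain ⟨b, rfl⟩ := (Submodule.mem_span_range_iff_exists_fun ℝ).1 hq
  exact ⟨a, b, h.symm⟩

/-! ### Periods over the cylinders -/

/-- The horizontal cylinder of a square. -/
def hCyl : Fin 12 → Fin 4 := ![0, 0, 0, 1, 1, 1, 2, 2, 2, 3, 3, 3]

/-- The vertical cylinder of a square. -/
def vCyl : Fin 12 → Fin 4 := ![0, 1, 2, 0, 2, 3, 0, 3, 1, 2, 1, 3]

theorem hCyl_h : ∀ k i, (if hCyl (O.h i) = k then 1 else 0 : ℤ) = if hCyl i = k then 1 else 0 := by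
  decide

theorem vCyl_v : ∀ k i, (if vCyl (O.v i) = k then 1 else 0 : ℤ) = if vCyl i = k then 1 else 0 := by
  decide

/-- The circle-valued maps dual to the horizontal and the vertical cylinders. -/
def cylMap : Fin 4 ⊕ Fin 4 → C(O.Surface, UnitAddCircle)
  | .inl k => O.heightMap (fun i => if hCyl i = k then 1 else 0) (hCyl_h k)
  | .inr k => O.widthMap (fun i => if vCyl i = k then 1 else 0) (vCyl_v k)

/-- The period of `cylMap` over the bottom sides. -/
def bottomPeriod : Fin 4 ⊕ Fin 4 → Fin 12 → ℤ
  | .inl _, _ => 0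
  | .inr k, i => if vCyl i = k then 1 else 0

/-- The period of `cylMap` over the left sides. -/
def leftPeriod : Fin 4 ⊕ Fin 4 → Fin 12 → ℤ
  | .inl k, i => if hCyl i = k then 1 else 0
  | .inr _, _ => 0

theorem cylMap_bottom (c : Fin 4 ⊕ Fin 4) (i : Fin 12) :
    chainClassPeriod (cylMap c) (cls (O.bottom i)) = bottomPeriod c i := by
  rcases c with k | k
  · exact (O.heightMap_bottom _ (hCyl_h k) i).trans (by simp [bottomPeriod])
  · exact O.widthMap_bottom _ (vCyl_v k) i

theorem cylMap_left (c : Fin 4 ⊕ Fin 4) (i : Fin 12) :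
    chainClassPeriod (cylMap c) (cls (O.left i)) = leftPeriod c i := by
  rcases c with k | k
  · exact O.heightMap_left _ (hCyl_h k) i
  · exact (O.widthMap_left _ (vCyl_v k) i).trans (by simp [leftPeriod])

/-- A combination of sides with vanishing boundary and vanishing periods bounds. -/
theorem exists_potential (a b : Fin 12 → ℝ)
    (hd : ∀ w, ∑ i, a i * ((if corner (O.h i) = w then 1 else 0) - if corner i = w then 1 else 0) +
      ∑ i, b i * ((if corner (O.v i) = w then 1 else 0) - if corner i = w then 1 else 0) = 0)
    (hp : ∀ c, ∑ i, a i * bottomPeriod c i + ∑ i, b i * leftPeriod c i = 0) :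
    ∃ x : Fin 12 → ℝ, (∀ i, a (O.v i) = x (O.v i) - x i) ∧ ∀ i, b (O.h i) = x i - x (O.h i) := by
  -- The condition at the sixth vertex is redundant, since the coefficients of a boundary sum to
  -- zero.
  have d0 := hd 0
  have d1 := hd 1
  have d2 := hd 2
  have d3 := hd 3
  have d4 := hd 4
  have u0 := hp (.inl 0)
  have u1 := hp (.inl 1)
  have u2 := hp (.inl 2)
  have u3 := hp (.inl 3)
  have w0 := hp (.inr 0)
  have w1 := hp (.inr 1)
  have w2 := hp (.inr 2)
  have w3 := hp (.inr 3)
  clear hd hp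
  simp [Fin.sum_univ_succ, bottomPeriod, leftPeriod, hCyl, vCyl, corner, O] at *
  -- `x i` is the multiplicity of square `i` in a bounding 2-chain. Starting from `x 0 = 0`, it is
  -- propagated along a spanning tree of eleven gluings: eight inside the horizontal cylinders, and
  -- the bottoms of squares `3`, `6`, `9`. The other thirteen relations follow from the five vertex
  -- and eight period conditions.
  refine ⟨![0, -b 1, -b 1 - b 2, a 3, a 3 - b 4, a 3 - b 4 - b 5, a 3 + a 6, a 3 + a 6 - b 7,
    a 3 + a 6 - b 7 - b 8, -b 1 - b 2 + a 9, -b 1 - b 2 + a 9 - b 10,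
    -b 1 - b 2 + a 9 - b 10 - b 11], fun i => ?_, fun i => ?_⟩
  · fin_cases i <;> simp <;> linarith
  · fin_cases i <;> simp <;> linarith

end Octahedron

/-! ### Cosets of the automorphism group, the basis, the matrices and the monodromy group. -/

namespace Origami

open Sing

variable {n : ℕ} {O : Origami n}

theorem map_intCast_injective :
    Function.Injective (Matrix.SpecialLinearGroup.map (n := Fin 2) (Int.castRingHom ℝ)) := by
  intro M N h
  ext i j
  have := congrArg (fun A : Matrix.SpecialLinearGroup (Fin 2) ℝ => A.1 i j) h
  simpa using this

/-- The affine homeomorphisms over a given matrix form a coset of the automorphism group. -/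
theorem Covers.mem_monodromyOver_iff [NeZero n] {f : O.Surface ≃ₜ O.Surface}
    {N : Matrix.SpecialLinearGroup (Fin 2) ℤ} {t : O.zeroHolonomy ≃ₗ[ℝ] O.zeroHolonomy}
    (hf : O.Covers f N) (ht : O.Induces f t) (g : O.zeroHolonomy ≃ₗ[ℝ] O.zeroHolonomy) :
    g ∈ O.monodromyOver (N.map (Int.castRingHom ℝ)) ↔ ∃ r ∈ O.autMonodromy, g = t * r := by
  constructor
  · rintro ⟨f', hA, hg⟩
    obtain ⟨M, hM, hf'⟩ := hA.exists_covers
    obtain rfl := map_intCast_injective hM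
    -- The composite of `f'` with the inverse of `f` lies over `N⁻¹ * N = 1`, so it is an
    -- automorphism.
    refine ⟨t⁻¹ * g, ⟨f'.trans f.symm, ?_, hg.trans ht.symm⟩, by group⟩
    rw [isAutomorphism_iff_covers, ← inv_mul_cancel N]
    exact hf'.trans hf.symm
  · rintro ⟨r, ⟨f', hf', hr⟩, rfl⟩
    refine ⟨f'.trans f, ?_, hr.trans ht⟩
    have := ((isAutomorphism_iff_covers.1 hf').trans hf).isAffine
    rwa [mul_one] at this

end Origami

namespace Octahedron

open Origami Sing

/-! ### Coordinates on the zero-holonomy subspace -/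

/-- Write the class as a combination of sides. Increments of the vertex weights read off its
boundary, so `exists_potential` applies and exhibits it as a combination of the square relations. -/
theorem eq_zero_of_periods {γ : H1 O.Surface}
    (h : ∀ c, chainClassPeriod (cylMap c) (toChainClass _ γ) = 0) : γ = 0 := by
  obtain ⟨a, b, hab⟩ := exists_eq_sum_sides γ
  have hd : ∀ w, ∑ i, a i * ((if corner (O.h i) = w then 1 else 0) -
      if corner i = w then 1 else 0) + ∑ i, b i * ((if corner (O.v i) = w then 1 else 0) -
        if corner i = w then 1 else 0) = 0 := by
    intro w
    have := chainClassDiff_toChainClass (weight w) γ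
    rw [hab] at this
    simpa [chainClassDiff_cls, bottom_apply, left_apply, stdSimplex.vertex, weight_pt, weightFun]
      using this
  have hp : ∀ c, ∑ i, a i * bottomPeriod c i + ∑ i, b i * leftPeriod c i = 0 := by
    intro c
    have := h c
    rw [hab] at this
    simpa [cylMap_bottom, cylMap_left] using this
  obtain ⟨x, hx, hx'⟩ := exists_potential a b hd hp
  apply toChainClass_injective
  -- Reindexing by `v` and `h` brings the coefficients into the form given by the potential;
  -- summation by parts then collects the boundary of each square.
  rw [map_zero, hab, ← Equiv.sum_comp O.v, ← Equiv.sum_comp O.h fun i => b i • cls (O.left i)]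
  simp only [hx, hx', sub_smul, Finset.sum_sub_distrib]
  rw [Equiv.sum_comp O.v fun i => x i • cls (O.bottom i),
    Equiv.sum_comp O.h fun i => x i • cls (O.left i)]
  simp only [← Finset.sum_sub_distrib, ← Finset.sum_add_distrib, ← smul_sub, ← smul_add]
  refine Finset.sum_eq_zero fun i _ => ?_
  rw [show cls (O.bottom i) - cls (O.bottom (O.v i)) + (cls (O.left (O.h i)) - cls (O.left i)) =
    (cls (O.bottom i) + cls (O.left (O.h i))) - (cls (O.left i) + cls (O.bottom (O.v i))) by abel,
    square_relation, sub_self, smul_zero]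

/-- Every square lies in exactly one vertical cylinder, so dx is the sum of the four dual classes.
-/
theorem chainClassPeriod_coordX (γ : H1 O.Surface) :
    period O.coordX γ = ∑ k, chainClassPeriod (cylMap (.inr k)) (toChainClass _ γ) := by
  obtain ⟨a, b, hab⟩ := exists_eq_sum_sides γ
  have h : ∀ i, ∑ k, bottomPeriod (.inr k) i = 1 := by decide
  have h' : ∀ i, ∑ k, (bottomPeriod (.inr k) i : ℝ) = 1 := fun i => by exact_mod_cast h i
  simp only [period_eq, hab, coordX_eq_widthMap, map_add, map_sum, map_smul, widthMap_bottom,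
    widthMap_left, cylMap_bottom, cylMap_left, smul_eq_mul, Finset.sum_add_distrib]
  rw [Finset.sum_comm]
  simp [← Finset.mul_sum, h', leftPeriod]

theorem chainClassPeriod_coordY (γ : H1 O.Surface) :
    period O.coordY γ = ∑ k, chainClassPeriod (cylMap (.inl k)) (toChainClass _ γ) := by
  obtain ⟨a, b, hab⟩ := exists_eq_sum_sides γ
  have h : ∀ i, ∑ k, leftPeriod (.inl k) i = 1 := by decide
  have h' : ∀ i, ∑ k, (leftPeriod (.inl k) i : ℝ) = 1 := fun i => by exact_mod_cast h i
  simp only [period_eq, hab, coordY_eq_heightMap, map_add, map_sum, map_smul, heightMap_bottom,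
    heightMap_left, cylMap_bottom, cylMap_left, smul_eq_mul, Finset.sum_add_distrib]
  rw [Finset.sum_comm (f := fun k i => b i * (leftPeriod (.inl k) i : ℝ))]
  simp [← Finset.mul_sum, h', bottomPeriod]

/-- The coefficients of `zeroHolonomyFamily` at the bottom sides. -/
def familyBottom : Fin 6 → Fin 12 → ℤ :=
  ![fun i => (if hCyl i = 0 then 1 else 0) - if hCyl i = 3 then 1 else 0,
    fun i => (if hCyl i = 1 then 1 else 0) - if hCyl i = 3 then 1 else 0,
    fun i => (if hCyl i = 2 then 1 else 0) - if hCyl i = 3 then 1 else 0, 0, 0, 0]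

/-- The coefficients of `zeroHolonomyFamily` at the left sides. -/
def familyLeft : Fin 6 → Fin 12 → ℤ :=
  ![0, 0, 0, fun i => (if vCyl i = 0 then 1 else 0) - if vCyl i = 1 then 1 else 0,
    fun i => (if vCyl i = 0 then 1 else 0) - if vCyl i = 2 then 1 else 0,
    fun i => (if vCyl i = 0 then 1 else 0) - if vCyl i = 3 then 1 else 0]

theorem toChainClass_sig (i : Fin 12) : toChainClass _ (sig i) =
    ∑ l, (((if hCyl l = hCyl i then 1 else 0 : ℤ)) : ℝ) • cls (O.bottom l) := by
  have h1 : ∀ i, Finset.univ.filter (fun l => hCyl l = hCyl i) = {i, O.h i, O.h (O.h i)} := by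
    decide
  have h2 : ∀ i, i ∉ ({O.h i, O.h (O.h i)} : Finset (Fin 12)) ∧ O.h i ≠ O.h (O.h i) := by decide
  simp only [Int.cast_ite, Int.cast_one, Int.cast_zero, ite_smul, one_smul, zero_smul]
  rw [← Finset.sum_filter, h1, Finset.sum_insert (h2 i).1, Finset.sum_pair (h2 i).2, sig,
    toChainClass_hCurve, Finset.sum_range_succ, Finset.sum_range_succ, Finset.sum_range_one,
    add_assoc]
  rfl

theorem toChainClass_zet (i : Fin 12) : toChainClass _ (zet i) =
    ∑ l, (((if vCyl l = vCyl i then 1 else 0 : ℤ)) : ℝ) • cls (O.left l) := by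
  have h1 : ∀ i, Finset.univ.filter (fun l => vCyl l = vCyl i) = {i, O.v i, O.v (O.v i)} := by
    decide
  have h2 : ∀ i, i ∉ ({O.v i, O.v (O.v i)} : Finset (Fin 12)) ∧ O.v i ≠ O.v (O.v i) := by decide
  simp only [Int.cast_ite, Int.cast_one, Int.cast_zero, ite_smul, one_smul, zero_smul]
  rw [← Finset.sum_filter, h1, Finset.sum_insert (h2 i).1, Finset.sum_pair (h2 i).2, zet,
    toChainClass_vCurve, Finset.sum_range_succ, Finset.sum_range_succ, Finset.sum_range_one,
    add_assoc]
  rfl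

theorem toChainClass_family (j : Fin 6) : toChainClass _ (zeroHolonomyFamily j) =
    ∑ i, (familyBottom j i : ℝ) • cls (O.bottom i) + ∑ i, (familyLeft j i : ℝ) • cls (O.left i) := by
  fin_cases j <;>
    simp [zeroHolonomyFamily, toChainClass_sig, toChainClass_zet, familyBottom, familyLeft, sub_smul,
      Finset.sum_sub_distrib, hCyl, vCyl] <;>
    rfl

theorem apply_family (L : ChainClass O.Surface →ₗ[ℝ] ℝ) {p q : Fin 12 → ℤ}
    (hp : ∀ i, L (cls (O.bottom i)) = p i) (hq : ∀ i, L (cls (O.left i)) = q i) (j : Fin 6) :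
    L (toChainClass _ (zeroHolonomyFamily j)) =
      ((∑ i, familyBottom j i * p i + ∑ i, familyLeft j i * q i : ℤ) : ℝ) := by
  rw [toChainClass_family]
  simp [hp, hq]

/-- The cylinders dual to `zeroHolonomyFamily`. -/
def dualCyl : Fin 6 → Fin 4 ⊕ Fin 4 := ![.inr 3, .inr 1, .inr 2, .inl 1, .inl 2, .inl 0]

/-- The signs of the duality. -/
def dualSign : Fin 6 → ℤ := ![-1, -1, -1, 1, 1, 1]

/-- The coordinates dual to `zeroHolonomyFamily`. -/
def dualCoord (j : Fin 6) : ChainClass O.Surface →ₗ[ℝ] ℝ :=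
  (dualSign j : ℝ) • chainClassPeriod (cylMap (dualCyl j))

theorem dualCoord_bottom (j : Fin 6) (i : Fin 12) :
    dualCoord j (cls (O.bottom i)) = ((dualSign j * bottomPeriod (dualCyl j) i : ℤ) : ℝ) := by
  simp [dualCoord, cylMap_bottom]

theorem dualCoord_left (j : Fin 6) (i : Fin 12) :
    dualCoord j (cls (O.left i)) = ((dualSign j * leftPeriod (dualCyl j) i : ℤ) : ℝ) := by
  simp [dualCoord, cylMap_left]

/-- Each horizontal cylinder meets three of the four vertical ones, in one square each, and misses
the fourth; likewise with the roles exchanged. Hence the vertical cylinder missed by `σ_k` is seen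
by `Σ_k` with sign -1 and by no other `Σ`; similarly for `Z_k`, with sign +1. This dictates
`dualCyl` and `dualSign`. -/
theorem dualCoord_family (k j : Fin 6) :
    dualCoord k (toChainClass _ (zeroHolonomyFamily j)) = if j = k then 1 else 0 := by
  rw [apply_family _ (dualCoord_bottom k) (dualCoord_left k)]
  have : ∀ k j : Fin 6, ∑ i, familyBottom j i * (dualSign k * bottomPeriod (dualCyl k) i) +
      ∑ i, familyLeft j i * (dualSign k * leftPeriod (dualCyl k) i) = if j = k then 1 else 0 := by
    decide
  rw [this]
  split_ifs <;> simp

theorem family_mem (j : Fin 6) : zeroHolonomyFamily j ∈ O.zeroHolonomy := by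
  refine LinearMap.mem_ker.2 (Prod.ext ?_ ?_)
  · change period O.coordX _ = 0
    rw [period_eq, coordX_eq_widthMap, apply_family _ (p := fun _ => 1) (q := fun _ => 0)
      (fun i => O.widthMap_bottom _ _ i) (fun i => by rw [widthMap_left, Int.cast_zero])]
    have : ∀ j, ∑ i, familyBottom j i * 1 + ∑ i, familyLeft j i * 0 = 0 := by decide
    rw [this, Int.cast_zero]
  · change period O.coordY _ = 0
    rw [period_eq, coordY_eq_heightMap, apply_family _ (p := fun _ => 0) (q := fun _ => 1)
      (fun i => by rw [heightMap_bottom, Int.cast_zero]) (fun i => O.heightMap_left _ _ i)]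
    have : ∀ j, ∑ i, familyBottom j i * 0 + ∑ i, familyLeft j i * 1 = 0 := by decide
    rw [this, Int.cast_zero]

/-- The coordinate map on the zero-holonomy subspace. -/
def coordMap : O.zeroHolonomy →ₗ[ℝ] (Fin 6 → ℝ) :=
  LinearMap.pi fun j => dualCoord j ∘ₗ toChainClass _ ∘ₗ O.zeroHolonomy.subtype

theorem coordMap_family (j : Fin 6) : coordMap ⟨_, family_mem j⟩ = Pi.single j 1 := by
  ext k
  rw [Pi.single_apply]
  exact (dualCoord_family k j).trans (by simp [eq_comm])

/-- Six periods vanish by assumption, and the two remaining ones because the four periods in each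
direction sum to the holonomy. -/
theorem coordMap_injective : Function.Injective coordMap := by
  rw [injective_iff_map_eq_zero]
  rintro ⟨γ, hγ⟩ h
  have h0 : ∀ j, dualCoord j (toChainClass _ γ) = 0 := fun j => congrFun h j
  have hX : period O.coordX γ = 0 := congrArg Prod.fst (LinearMap.mem_ker.1 hγ)
  have hY : period O.coordY γ = 0 := congrArg Prod.snd (LinearMap.mem_ker.1 hγ)
  rw [chainClassPeriod_coordX, Fin.sum_univ_four] at hX
  rw [chainClassPeriod_coordY, Fin.sum_univ_four] at hY
  have a0 := h0 0
  have a1 := h0 1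
  have a2 := h0 2
  have a3 := h0 3
  have a4 := h0 4
  have a5 := h0 5
  simp [dualCoord, dualCyl, dualSign] at a0 a1 a2 a3 a4 a5
  rw [a0, a1, a2] at hX
  rw [a3, a4, a5] at hY
  refine Subtype.ext (eq_zero_of_periods ?_)
  rintro (c | c) <;> fin_cases c
  · exact a5
  · exact a3
  · exact a4
  · simpa using hY
  · simpa using hX
  · exact a1
  · exact a2
  · exact a0

theorem coordMap_surjective : Function.Surjective coordMap := by
  intro c
  refine ⟨∑ j, c j • ⟨_, family_mem j⟩, ?_⟩
  simp only [map_sum, map_smul, coordMap_family]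
  ext k
  simp [Pi.single_apply]

/-- The basis of the zero-holonomy subspace. -/
def zeroHolonomyBasis : Module.Basis (Fin 6) ℝ O.zeroHolonomy :=
  .ofEquivFun (LinearEquiv.ofBijective coordMap ⟨coordMap_injective, coordMap_surjective⟩)

theorem zeroHolonomyBasis_apply (j : Fin 6) : zeroHolonomyBasis j = ⟨_, family_mem j⟩ := by
  rw [zeroHolonomyBasis, Module.Basis.coe_ofEquivFun, LinearEquiv.symm_apply_eq]
  exact (coordMap_family j).symm

theorem zeroHolonomyBasis_repr (γ : O.zeroHolonomy) (k : Fin 6) :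
    zeroHolonomyBasis.repr γ k = dualCoord k (toChainClass _ γ.1) := rfl

/-! ### The matrices of the two generators -/

theorem toMatrix_apply_of_induces {f : O.Surface ≃ₜ O.Surface}
    {g : O.zeroHolonomy ≃ₗ[ℝ] O.zeroHolonomy} (hg : O.Induces f g) (k j : Fin 6)
    {p q : Fin 12 → ℤ}
    (hp : ∀ i, dualCoord k (cls ((f : C(O.Surface, O.Surface)).comp (O.bottom i))) = p i)
    (hq : ∀ i, dualCoord k (cls ((f : C(O.Surface, O.Surface)).comp (O.left i))) = q i) :
    LinearMap.toMatrix zeroHolonomyBasis zeroHolonomyBasis g.toLinearMap k j =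
      ((∑ i, familyBottom j i * p i + ∑ i, familyLeft j i * q i : ℤ) : ℝ) := by
  rw [LinearMap.toMatrix_apply, zeroHolonomyBasis_repr, zeroHolonomyBasis_apply]
  change dualCoord k (toChainClass _ (g _).1) = _
  rw [hg, toChainClass_H1map]
  exact apply_family (dualCoord k ∘ₗ chainClassMap _)
    (fun i => by rw [LinearMap.comp_apply, chainClassMap_cls, hp])
    (fun i => by rw [LinearMap.comp_apply, chainClassMap_cls, hq]) j

theorem toMatrix_affT3 : LinearMap.toMatrix zeroHolonomyBasis zeroHolonomyBasis
    covers_affT3.action.toLinearMap = matT3 := by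
  ext k j
  rw [toMatrix_apply_of_induces covers_affT3.induces_action k j
    (p := fun i => dualSign k * bottomPeriod (dualCyl k) i)
    (q := fun i => ∑ l ∈ Finset.range 3, dualSign k * bottomPeriod (dualCyl k) ((O.h ^ l) i) +
      dualSign k * leftPeriod (dualCyl k) i)
    (fun i => by rw [affT3, shear_comp_bottom, dualCoord_bottom])
    (fun i => by
      have := O.cls_shear_comp_left 3 h_zpow_three i
      rw [affT3]
      refine (congrArg (dualCoord k) this).trans ?_
      rw [map_add, map_sum, dualCoord_left]
      simp only [dualCoord_bottom]
      push_cast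
      rfl)]
  have : ∀ k j, ∑ i, familyBottom j i * (dualSign k * bottomPeriod (dualCyl k) i) +
      ∑ i, familyLeft j i * (∑ l ∈ Finset.range 3,
        dualSign k * bottomPeriod (dualCyl k) ((O.h ^ l) i) + dualSign k * leftPeriod (dualCyl k) i) =
      (![![1, 0, 0, 0, 0, 1], ![0, 1, 0, 1, 0, 0], ![0, 0, 1, 0, 1, 0], ![0, 0, 0, 1, 0, 0],
        ![0, 0, 0, 0, 1, 0], ![0, 0, 0, 0, 0, 1]] : Fin 6 → Fin 6 → ℤ) k j := by
    decide +kernel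
  rw [this]
  fin_cases k <;> fin_cases j <;> simp [matT3]

theorem toMatrix_affSinvT : LinearMap.toMatrix zeroHolonomyBasis zeroHolonomyBasis
    covers_affSinvT.action.toLinearMap = matSinvT := by
  ext k j
  rw [toMatrix_apply_of_induces covers_affSinvT.induces_action k j
    (p := fun i => dualSign k * bottomPeriod (dualCyl k) (turnPerm i) -
      dualSign k * leftPeriod (dualCyl k) (turnPerm i))
    (q := fun i => dualSign k * bottomPeriod (dualCyl k) (O.v (turnPerm i)))
    (fun i => by
      rw [affSinvT, cls_turn_comp_bottom, map_sub, dualCoord_left, dualCoord_bottom]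
      push_cast
      rfl)
    (fun i => by rw [affSinvT, turn_comp_left, dualCoord_bottom])]
  have : ∀ k j, ∑ i, familyBottom j i * (dualSign k * bottomPeriod (dualCyl k) (turnPerm i) -
      dualSign k * leftPeriod (dualCyl k) (turnPerm i)) +
      ∑ i, familyLeft j i * (dualSign k * bottomPeriod (dualCyl k) (O.v (turnPerm i))) =
      (![![-1, -1, -1, 1, 1, 1], ![0, 0, 1, 0, -1, 0], ![1, 0, 0, 0, 0, -1], ![0, 0, 1, 0, 0, 0],
        ![1, 0, 0, 0, 0, 0], ![-1, -1, -1, 0, 0, 0]] : Fin 6 → Fin 6 → ℤ) k j := by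
    decide +kernel
  rw [this]
  fin_cases k <;> fin_cases j <;> simp [matSinvT]

/-! ### The monodromy group -/

/-- One induction on words keeps matrix, lift and action together: the lift serves the Veech group,
the action serves the monodromy group. -/
theorem exists_covers_of_mem_Γ {M : Matrix.SpecialLinearGroup (Fin 2) ℤ}
    (hM : M ∈ ModularSubgroup.Γ) : ∃ f g, O.Covers f M ∧ O.Induces f g ∧
      g ∈ Subgroup.closure {covers_affT3.action, covers_affSinvT.action} := by
  induction hM using Subgroup.closure_induction with
  | mem x hx =>
    rcases hx with rfl | rfl
    · exact ⟨_, _, covers_affT3, covers_affT3.induces_action, Subgroup.subset_closure (by simp)⟩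
    · exact ⟨_, _, covers_affSinvT, covers_affSinvT.induces_action,
        Subgroup.subset_closure (by simp)⟩
  | one => exact ⟨Homeomorph.refl _, 1, fun z => by simp, fun γ => (H1map_id _).symm, one_mem _⟩
  | mul x y _ _ hx hy =>
    obtain ⟨f, g, h1, h2, h3⟩ := hx
    obtain ⟨f', g', h1', h2', h3'⟩ := hy
    -- `trans` applies its first argument first, hence the reversed order.
    exact ⟨_, _, h1'.trans h1, h2'.trans h2, mul_mem h3 h3'⟩
  | inv x _ hx =>
    obtain ⟨f, g, h1, h2, h3⟩ := hx
    exact ⟨_, _, h1.symm, h2.symm, inv_mem h3⟩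

theorem exists_covers_of_mem_closure {w : O.zeroHolonomy ≃ₗ[ℝ] O.zeroHolonomy}
    (hw : w ∈ Subgroup.closure {covers_affT3.action, covers_affSinvT.action}) :
    ∃ f M, O.Covers f M ∧ O.Induces f w := by
  induction hw using Subgroup.closure_induction with
  | mem x hx =>
    rcases hx with rfl | rfl
    · exact ⟨_, _, covers_affT3, covers_affT3.induces_action⟩
    · exact ⟨_, _, covers_affSinvT, covers_affSinvT.induces_action⟩
  | one => exact ⟨Homeomorph.refl _, 1, fun z => by simp, fun γ => (H1map_id _).symm⟩
  | mul x y _ _ hx hy =>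
    obtain ⟨f, M, h1, h2⟩ := hx
    obtain ⟨f', M', h1', h2'⟩ := hy
    exact ⟨_, _, h1'.trans h1, h2'.trans h2⟩
  | inv x _ hx =>
    obtain ⟨f, M, h1, h2⟩ := hx
    exact ⟨_, _, h1.symm, h2.symm⟩

theorem covers_mem_Γ {f : O.Surface ≃ₜ O.Surface} {M : Matrix.SpecialLinearGroup (Fin 2) ℤ}
    (hf : O.Covers f M) : M ∈ ModularSubgroup.Γ :=
  mem_Γ_of_covers hf fun _ hγ => let ⟨g, _, hg, _⟩ := exists_covers_of_mem_Γ hγ; ⟨g, hg⟩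

theorem veechGroup_eq : O.veechGroup = Subgroup.closure {T ^ 3, S⁻¹ * T} := by
  rw [← map_Γ]
  ext A
  constructor
  · rintro ⟨f, hf⟩
    obtain ⟨M, rfl, hM⟩ := hf.exists_covers
    exact ⟨M, covers_mem_Γ hM, rfl⟩
  · rintro ⟨M, hM, rfl⟩
    obtain ⟨f, -, hf, -⟩ := exists_covers_of_mem_Γ hM
    exact ⟨f, hf.isAffine⟩

/-- An affine homeomorphism lies over some matrix in Γ, and so does a word in the generators; the
two are then compared in the same coset of the automorphisms. -/
theorem mem_kzMonodromy_iff (g : O.zeroHolonomy ≃ₗ[ℝ] O.zeroHolonomy) :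
    g ∈ O.kzMonodromy ↔ ∃ w ∈ Subgroup.closure {covers_affT3.action, covers_affSinvT.action},
      ∃ r ∈ O.autMonodromy, g = w * r := by
  constructor
  · rintro ⟨f, A, hA, hg⟩
    obtain ⟨M, rfl, hM⟩ := hA.exists_covers
    obtain ⟨f', w, h1, h2, h3⟩ := exists_covers_of_mem_Γ (covers_mem_Γ hM)
    exact ⟨w, h3, (h1.mem_monodromyOver_iff h2 g).1 ⟨f, hA, hg⟩⟩
  · rintro ⟨w, hw, h⟩
    obtain ⟨f, M, h1, h2⟩ := exists_covers_of_mem_closure hw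
    obtain ⟨f', hf', hg⟩ := (h1.mem_monodromyOver_iff h2 g).2 h
    exact ⟨f', _, hf', hg⟩

end Octahedron

end

theorem mainTheorem2 :
    Octahedron.O.veechGroup =
        Subgroup.closure {Octahedron.T ^ 3, Octahedron.S⁻¹ * Octahedron.T} ∧
      (∀ f A, Octahedron.O.IsAffine f A → ∃ g, Octahedron.O.Induces f g) ∧
      ∃ (b : Module.Basis (Fin 6) ℝ Octahedron.O.zeroHolonomy)
        (t u : Octahedron.O.zeroHolonomy ≃ₗ[ℝ] Octahedron.O.zeroHolonomy),
        (∀ j, (b j : Sing.H1 Octahedron.O.Surface) = Octahedron.zeroHolonomyFamily j) ∧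
        LinearMap.toMatrix b b t.toLinearMap = Octahedron.matT3 ∧
        LinearMap.toMatrix b b u.toLinearMap = Octahedron.matSinvT ∧
        (∀ g, g ∈ Octahedron.O.monodromyOver (Octahedron.T ^ 3) ↔
          ∃ r ∈ Octahedron.O.autMonodromy, g = t * r) ∧
        (∀ g, g ∈ Octahedron.O.monodromyOver (Octahedron.S⁻¹ * Octahedron.T) ↔
          ∃ r ∈ Octahedron.O.autMonodromy, g = u * r) ∧
        (∀ g, g ∈ Octahedron.O.kzMonodromy ↔
          ∃ w ∈ Subgroup.closure {t, u}, ∃ r ∈ Octahedron.O.autMonodromy, g = w * r) := by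
  refine ⟨Octahedron.veechGroup_eq, fun f A hf => ?_, Octahedron.zeroHolonomyBasis,
    Octahedron.covers_affT3.action, Octahedron.covers_affSinvT.action,
    fun j => by rw [Octahedron.zeroHolonomyBasis_apply], Octahedron.toMatrix_affT3,
    Octahedron.toMatrix_affSinvT, fun g => ?_, fun g => ?_, Octahedron.mem_kzMonodromy_iff⟩
  · obtain ⟨M, -, hM⟩ := hf.exists_covers
    exact ⟨hM.action, hM.induces_action⟩
  · have := Octahedron.covers_affT3.mem_monodromyOver_iff
      Octahedron.covers_affT3.induces_action g
    rwa [map_pow, Octahedron.map_T] at this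
  · have := Octahedron.covers_affSinvT.mem_monodromyOver_iff
      Octahedron.covers_affSinvT.induces_action g
    rwa [Octahedron.map_U] at this
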